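/- Let $K$ be a field. A tower of curves over $K$ is a sequence $\mathcal C=(\{C_n\}_{n\ge 0},\{\varphi_n\}_{n\ge 1})$ of smooth projective geometrically connected algebraic curves $C_n$ over $K$ and nonconstant $K$-morphisms $\varphi_n\colon C_n\to C_{n-1}$ of degree $>1$. Write $g(C_n)=\dim_K H^1(C_n,\mathcal O_{C_n})$ for the genus of $C_n$ and $g(\mathcal C)=\limsup_n g(C_n)\in\{0,1,2,\dots\}\cup\{\infty\}$ for the genus of the tower. For every tower $\mathcal C$ one has $g(C_n)\ge g(C_{n-1})$ for all $n\ge 1$, so that $g(\mathcal C)=\lim_n g(C_n)$. Suppose moreover that no $\varphi_n$ is purely inseparable, i.e. no extension of function fields $K(C_n)/K(C_{n-1})$ is purely inseparable (this is automatic in characteristic $0$, and holds whenever all $\varphi_n$ are separable). Then, if $g(C_n)>1$ for some $n$, one has $g(C_{m+1})>g(C_m)$ for all $m\ge n$. Consequently $g(\mathcal C)$ is $0$, $1$ or $\infty$. -/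

import Mathlib

open AlgebraicGeometry CategoryTheory

universe u

namespace CurveTower

/-! ### A smooth connected curve over a field is integral -/

theorem isDomain_of_maximalIdeal_span {R : Type*} [CommRing R] [IsLocalRing R] [IsNoetherianRing R]
    (t : R) (ht : t = 0 ∨ t ∈ nonZeroDivisors R)
    (hm : IsLocalRing.maximalIdeal R = Ideal.span {t}) : IsDomain R := by
  rcases ht with rfl | ht
  · exact (IsLocalRing.isField_iff_maximalIdeal_eq.mpr (by simpa using hm)).isDomain
  have key : ∀ a : R, a ≠ 0 → ∃ (n : ℕ) (u : R), IsUnit u ∧ a = t ^ n * u := by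
    intro a ha
    have hfin : FiniteMultiplicity t a := by
      by_contra h
      rw [FiniteMultiplicity.not_iff_forall] at h
      apply ha
      have h0 := Ideal.iInf_pow_eq_bot_of_isLocalRing (IsLocalRing.maximalIdeal R)
        (IsLocalRing.maximalIdeal.isMaximal R).ne_top
      rw [← Ideal.mem_bot, ← h0, Ideal.mem_iInf]
      intro n
      rw [hm, Ideal.span_singleton_pow, Ideal.mem_span_singleton]
      exact h n
    obtain ⟨c, hc, hnc⟩ := hfin.exists_eq_pow_mul_and_not_dvd
    refine ⟨_, c, ?_, hc⟩
    by_contra hu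
    have : c ∈ IsLocalRing.maximalIdeal R := hu
    rw [hm, Ideal.mem_span_singleton] at this
    exact hnc this
  have : NoZeroDivisors R := by
    refine ⟨fun {a b} hab => ?_⟩
    by_contra! h
    obtain ⟨n, u, hu, rfl⟩ := key a h.1
    obtain ⟨m, v, hv, rfl⟩ := key b h.2
    have h1 : (u * v) * t ^ (n + m) = 0 := by rw [← hab]; ring
    have h2 : u * v = 0 := (mem_nonZeroDivisors_iff_right.mp (pow_mem ht (n + m))) _ h1
    have := (hu.mul hv)
    rw [h2] at this
    exact not_isUnit_zero this
  exact NoZeroDivisors.to_isDomain R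

theorem isDomain_atPrime_of_etale {K S : Type*} [CommRing K] (hK : IsField K) [CommRing S]
    [Algebra (MvPolynomial (Fin 1) K) S] [Algebra.Etale (MvPolynomial (Fin 1) K) S]
    (q : Ideal S) [q.IsPrime] : IsDomain (Localization.AtPrime q) := by
  let P := MvPolynomial (Fin 1) K
  have hKX : IsPrincipalIdealRing (Polynomial K) := by
    let := hK.toField
    exact (inferInstance : IsPrincipalIdealRing (Polynomial K))
  have : IsDomain K := hK.isDomain
  have : IsNoetherianRing K := by
    let := hK.toField
    exact (inferInstance : IsNoetherianRing K)
  have : IsNoetherianRing S := Algebra.FiniteType.isNoetherianRing P S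
  have hP : IsPrincipalIdealRing P :=
    IsPrincipalIdealRing.of_surjective (MvPolynomial.uniqueAlgEquiv K (Fin 1)).symm
      (MvPolynomial.uniqueAlgEquiv K (Fin 1)).symm.surjective
  let p := q.under P
  let := Localization.AtPrime.algebraOfLiesOver p q
  have h := ((Algebra.isUnramifiedAt_iff_map_eq P p q).mp inferInstance).2
  obtain ⟨t, ht⟩ := hP.principal p
  have : Module.Flat P (Localization.AtPrime q) := Module.Flat.trans P S _
  refine isDomain_of_maximalIdeal_span (algebraMap P _ t) ?_ ?_
  · by_cases h0 : t = 0
    · left; simp [h0]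
    · right
      have hr : IsSMulRegular P t := IsLeftRegular.isSMulRegular (IsRegular.of_ne_zero h0).left
      have := IsSMulRegular.of_flat (S := Localization.AtPrime q) hr
      rw [mem_nonZeroDivisors_iff_right]
      intro z hz
      exact this (by simpa [mul_comm] using hz)
  · rw [← h, ht, ← Set.image_singleton, ← Ideal.map_span]

open PrimeSpectrum in
theorem exists_isPreirreducible_basicOpen {S : Type*} [CommRing S] [IsNoetherianRing S]
    (q : PrimeSpectrum S) [IsDomain (Localization.AtPrime q.asIdeal)] :
    ∃ f, q ∈ basicOpen f ∧ IsPreirreducible (basicOpen f : Set (PrimeSpectrum S)) := by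
  set φ := algebraMap S (Localization.AtPrime q.asIdeal) with hφ
  obtain ⟨f, hf, hI⟩ : ∃ f ∉ q.asIdeal, ∀ a, φ a = 0 → f * a = 0 := by
    obtain ⟨s, hs⟩ := (isNoetherianRing_iff_ideal_fg S).mp inferInstance (RingHom.ker φ)
    have h1 : ∀ a : S, ∃ f : S, f ∉ q.asIdeal ∧ (φ a = 0 → f * a = 0) := by
      intro a
      by_cases ha : φ a = 0
      · obtain ⟨m, hm⟩ := (IsLocalization.map_eq_zero_iff q.asIdeal.primeCompl _ a).mp ha
        exact ⟨m, m.2, fun _ => hm⟩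
      · exact ⟨1, q.asIdeal.primeCompl.one_mem, fun h => absurd h ha⟩
    choose g hg hg' using h1
    refine ⟨∏ a ∈ s, g a, q.asIdeal.primeCompl.prod_mem fun a _ => hg a, fun a ha => ?_⟩
    have : RingHom.ker φ ≤ (LinearMap.ker (LinearMap.lsmul S S (∏ a ∈ s, g a))) := by
      rw [← hs, Submodule.span_le]
      intro b hb
      have hb0 : φ b = 0 := by
        have : b ∈ RingHom.ker φ := hs ▸ Submodule.subset_span hb
        exact this
      simp only [SetLike.mem_coe, LinearMap.mem_ker, LinearMap.lsmul_apply, smul_eq_mul]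
      obtain ⟨c, hc⟩ := Finset.dvd_prod_of_mem g (Finset.mem_coe.mp hb)
      rw [hc, mul_right_comm, hg' b hb0, zero_mul]
    exact this ha
  refine ⟨f, hf, ?_⟩
  have hlift : ∀ U : Set (PrimeSpectrum S), IsOpen U → ((basicOpen f : Set _) ∩ U).Nonempty →
      ∃ a, (basicOpen a : Set _) ⊆ U ∧ φ a ≠ 0 := by
    rintro U hU ⟨x, hxf, hxU⟩
    obtain ⟨_, ⟨a, rfl⟩, hxa, haU⟩ := isTopologicalBasis_basic_opens.exists_subset_of_mem_open hxU hU
    refine ⟨a, haU, fun h0 => ?_⟩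
    have : f * a ∈ x.asIdeal := by rw [hI a h0]; exact zero_mem _
    exact (x.isPrime.mem_or_mem this).elim hxf hxa
  intro U V hU hV hfU hfV
  obtain ⟨a, haU, ha⟩ := hlift U hU hfU
  obtain ⟨b, hbV, hb⟩ := hlift V hV hfV
  have hn : ¬ IsNilpotent (f * (a * b)) := by
    intro h
    have h' := (h.map φ).eq_zero
    rw [map_mul, map_mul] at h'
    have hfu : φ f ≠ 0 := (IsLocalization.map_units (M := q.asIdeal.primeCompl) _ ⟨f, hf⟩).ne_zero
    exact mul_ne_zero hfu (mul_ne_zero ha hb) h'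
  rw [← PrimeSpectrum.basicOpen_eq_bot_iff, ← TopologicalSpace.Opens.coe_eq_empty, ← ne_eq,
    ← Set.nonempty_iff_ne_empty] at hn
  obtain ⟨x, hx⟩ := hn
  rw [basicOpen_mul, basicOpen_mul] at hx
  exact ⟨x, hx.1, haU hx.2.1, hbV hx.2.2⟩

theorem preirreducibleSpace_of_locally {X : Type*} [TopologicalSpace X] [PreconnectedSpace X]
    (h : ∀ x : X, ∃ V : Set X, IsOpen V ∧ x ∈ V ∧ IsPreirreducible V) : PreirreducibleSpace X := by
  refine ⟨fun U W hU hW hXU hXW => ?_⟩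
  rw [Set.univ_inter] at *
  have hcl : IsOpen (closure U) := by
    rw [isOpen_iff_mem_nhds]
    intro x hx
    obtain ⟨V, hV, hxV, hirr⟩ := h x
    refine Filter.mem_of_superset (hV.mem_nhds hxV) fun y hy => ?_
    rw [mem_closure_iff]
    intro O hO hyO
    have hne : (V ∩ U).Nonempty := mem_closure_iff.mp hx V hV hxV
    obtain ⟨z, -, hz⟩ := hirr O U hO hU ⟨y, hy, hyO⟩ hne
    exact ⟨z, hz⟩
  have := IsClopen.eq_univ ⟨isClosed_closure, hcl⟩ (hXU.mono subset_closure)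
  obtain ⟨w, hw⟩ := hXW
  obtain ⟨z, hz⟩ := mem_closure_iff.mp (this ▸ Set.mem_univ w) W hW hw
  exact ⟨z, hz.2, hz.1⟩

theorem isIntegral_of_smooth {K : Type u} [Field K] {X : Scheme.{u}} (f : X ⟶ Spec (.of K))
    [SmoothOfRelativeDimension 1 f] [ConnectedSpace X] : IsIntegral X := by
  have main : ∀ x : X, IsDomain (X.presheaf.stalk x) ∧
      ∃ V : Set X, IsOpen V ∧ x ∈ V ∧ IsPreirreducible V := by
    intro x
    obtain ⟨U, hU, V, hV, hx, e, hf⟩ :=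
      SmoothOfRelativeDimension.exists_isStandardSmoothOfRelativeDimension (n := 1) (f := f) x
    have hUt : U = ⊤ := by
      ext y
      simp only [TopologicalSpace.Opens.coe_top, Set.mem_univ, iff_true]
      exact Subsingleton.elim (f x) y ▸ e hx
    have hfield : IsField Γ(Spec (.of K), U) := by
      subst hUt
      exact isField_of_isIntegral_of_subsingleton _
    obtain ⟨g, -, hg⟩ := hf.exists_etale_mvPolynomial
    algebraize [g]
    let := hfield.toField
    have : IsNoetherianRing Γ(Spec (.of K), U) := by
      exact (inferInstance : IsNoetherianRing Γ(Spec (.of K), U))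
    have hnoeth : IsNoetherianRing Γ(X, V) :=
      Algebra.FiniteType.isNoetherianRing (MvPolynomial (Fin 1) Γ(Spec (.of K), U)) _
    let q := hV.primeIdealOf ⟨x, hx⟩
    have hq : hV.fromSpec q = x := hV.fromSpec_primeIdealOf ⟨x, hx⟩
    have hdom : IsDomain (Localization.AtPrime q.asIdeal) :=
      isDomain_atPrime_of_etale hfield q.asIdeal
    constructor
    · let : Algebra Γ(X, V) (X.presheaf.stalk x) := (X.presheaf.germ V x hx).hom.toAlgebra
      have : IsLocalization.AtPrime (X.presheaf.stalk x) q.asIdeal :=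
        hV.isLocalization_stalk ⟨x, hx⟩
      exact (IsLocalization.algEquiv q.asIdeal.primeCompl (X.presheaf.stalk x)
        (Localization.AtPrime q.asIdeal)).toRingEquiv.toMulEquiv.isDomain _
    · obtain ⟨a, ha, hirr⟩ := exists_isPreirreducible_basicOpen q
      exact ⟨_, hV.fromSpec.isOpenEmbedding.isOpenMap _ (PrimeSpectrum.basicOpen a).2,
        ⟨q, ha, hq⟩, hirr.image _ hV.fromSpec.continuous.continuousOn⟩
  have : ∀ x : X, _root_.IsReduced (X.presheaf.stalk x) := fun x => by
    have := (main x).1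
    infer_instance
  have : IsReduced X := isReduced_of_isReduced_stalk X
  have : PreirreducibleSpace X := preirreducibleSpace_of_locally fun x => (main x).2
  have : IrreducibleSpace X := { toNonempty := inferInstance }
  exact isIntegral_of_irreducibleSpace_of_isReduced X

/-! ### Repartitions and smooth projective curves -/

noncomputable section

section Repartitions

variable {K F ι : Type u} [Field K] [Field F] [Algebra K F] (O : ι → Subalgebra K F)

/-- Repartitions with respect to a family of subrings `O x` of `F`: families `(r_x)` of elements
of `F` with `r_x ∈ O x` for all but finitely many `x`. -/
def repartitions : Submodule K (ι → F) where
  carrier := {r | {x | r x ∉ O x}.Finite}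
  zero_mem' := Set.finite_empty.subset fun x hx => hx (O x).zero_mem
  add_mem' {r s} hr hs := (hr.union hs).subset fun x hx => by
    by_contra h
    simp only [Set.mem_union, Set.mem_ofPred_eq, not_or, not_not] at h
    exact hx ((O x).add_mem h.1 h.2)
  smul_mem' c r hr := Set.Finite.subset hr fun x hx h => hx ((O x).smul_mem h c)

/-- Families with `r_x ∈ O x` for every `x`. -/
def regularRepartitions : Submodule K (ι → F) :=
  Submodule.pi Set.univ fun x => Subalgebra.toSubmodule (O x)

/-- The constant families. -/
def principalRepartitions (K F ι : Type u) [Field K] [Field F] [Algebra K F] :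
    Submodule K (ι → F) :=
  LinearMap.range (LinearMap.pi fun _ => LinearMap.id : F →ₗ[K] ι → F)

/-- Repartitions modulo the regular and the principal ones. When every element of `F` lies in all
but finitely many `O x`, this is the cokernel of the diagonal map `F → ⨁ₓ F / O x`. -/
abbrev RepartitionQuotient : Type u :=
  repartitions O ⧸
    (regularRepartitions O ⊔ principalRepartitions K F ι).comap (repartitions O).subtype

end Repartitions

attribute [local instance] MvPolynomial.gradedAlgebra

/-- Projective space of dimension `n` over the field `K`, as a scheme. -/
def projSpace (K : Type u) [Field K] (n : ℕ) : Scheme.{u} :=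
  Proj (MvPolynomial.homogeneousSubmodule (Fin (n + 1)) K)

/-- The structure morphism of projective space over `K`. -/
def projSpaceStr (K : Type u) [Field K] (n : ℕ) : projSpace K n ⟶ Spec (.of K) :=
  Proj.toSpecZero (MvPolynomial.homogeneousSubmodule (Fin (n + 1)) K) ≫
    Spec.map (CommRingCat.ofHom
      (algebraMap K (MvPolynomial.homogeneousSubmodule (Fin (n + 1)) K 0)))

/-- A `K`-scheme is projective if it is a closed subscheme of some projective space over `K`. -/
def IsProjectiveOver {K : Type u} [Field K] {X : Scheme.{u}} (f : X ⟶ Spec (.of K)) : Prop :=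
  ∃ (n : ℕ) (i : X ⟶ projSpace K n), IsClosedImmersion i ∧ i ≫ projSpaceStr K n = f

/-- A smooth projective geometrically connected algebraic curve over the field `K`. -/
structure Curve (K : Type u) [Field K] where
  /-- The underlying scheme. -/
  X : Scheme.{u}
  /-- The structure morphism. -/
  str : X ⟶ Spec (.of K)
  smooth : SmoothOfRelativeDimension 1 str
  projective : IsProjectiveOver str
  geometricallyConnected : GeometricallyConnected str

namespace Curve

variable {K : Type u} [Field K] (C : Curve K)

instance : IsIntegral C.X := by
  have := C.smooth
  have := C.geometricallyConnected
  have : ConnectedSpace C.X := GeometricallyConnected.connectedSpace_of_subsingleton C.str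
  exact isIntegral_of_smooth C.str

/-- The generic point of the curve. -/
def generic : C.X := genericPoint C.X

/-- The function field `K(C)`: the local ring at the generic point. -/
def FunctionField : Type u := C.X.functionField

instance : Field C.FunctionField := inferInstanceAs (Field C.X.functionField)

/-- The inclusion of the local ring at `x` into the function field. -/
def stalkToFunctionField (x : C.X) : C.X.presheaf.stalk x →+* C.FunctionField :=
  algebraMap (C.X.presheaf.stalk x) C.X.functionField

/-- The structure of `K`-algebra of the local ring at `x`. -/
def scalarsToStalk (x : C.X) : K →+* C.X.presheaf.stalk x :=
  (C.X.presheaf.germ ⊤ x trivial).hom.comp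
    (C.str.appTop.hom.comp (Scheme.ΓSpecIso (.of K)).inv.hom)

instance : Algebra K C.FunctionField := (C.scalarsToStalk C.generic).toAlgebra

theorem stalkToFunctionField_scalars (x : C.X) (c : K) :
    C.stalkToFunctionField x (C.scalarsToStalk x c) = algebraMap K C.FunctionField c :=
  ConcreteCategory.congr_hom (C.X.presheaf.germ_stalkSpecializes (U := ⊤) (y := x) trivial
    ((genericPoint_spec C.X).specializes trivial)) _

/-- The local ring `𝒪_x` of the curve at `x`, as a subring of the function field. -/
def localRing (x : C.X) : Subalgebra K C.FunctionField where
  __ := (C.stalkToFunctionField x).range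
  algebraMap_mem' c := ⟨_, C.stalkToFunctionField_scalars x c⟩

/-- The closed points of the curve. -/
def ClosedPoint : Type u := {x : C.X // IsClosed ({x} : Set C.X)}

/-- The cohomology group `H¹(C, 𝒪_C)`, through the flasque resolution
`0 → 𝒪_C → K(C) → ⨁ₓ K(C)/𝒪_x → 0` (`x` runs over the closed points and the last term is the sum
of the skyscraper sheaves): it is the cokernel of the map of global sections
`K(C) → ⨁ₓ K(C)/𝒪_x`. -/
abbrev H1 : Type u :=
  RepartitionQuotient fun x : C.ClosedPoint => C.localRing x.1

/-- The genus `g(C) = dim_K H¹(C, 𝒪_C)`. -/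
def genus : ℕ := Module.finrank K C.H1

end Curve

/-! ### Morphisms of curves -/

section Morphisms

variable {K : Type u} [Field K] {C D : Curve K}

/-- A morphism is constant if it sends the whole curve to one point. -/
def IsConstant (f : C.X ⟶ D.X) : Prop := ∃ y : D.X, ∀ x : C.X, f x = y

/-- The degree of a nonconstant morphism of curves `f : C → D`, i.e. the degree of the extension
of function fields `K(C)/K(D)`. It is written as the degree of the residue field at the generic
point of `C` over the residue field at its image, which is the generic point of `D`. -/
def degree (f : C.X ⟶ D.X) : ℕ := f.residueDegree C.generic

/-- A nonconstant morphism of curves `f : C → D` is purely inseparable if the extension of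
function fields `K(C)/K(D)` is (again written with residue fields at the generic points). -/
def IsPurelyInsep (f : C.X ⟶ D.X) : Prop :=
  letI := (f.residueFieldMap C.generic).hom.toAlgebra
  IsPurelyInseparable (D.X.residueField (f C.generic)) (C.X.residueField C.generic)

end Morphisms

/-- A tower of curves over `K`: smooth projective geometrically connected curves `C_n`, `n ≥ 0`,
and nonconstant `K`-morphisms `C_{n+1} → C_n` of degree `> 1`. -/
structure Tower (K : Type u) [Field K] where
  curve : ℕ → Curve K
  map (n : ℕ) : (curve (n + 1)).X ⟶ (curve n).X
  map_str (n : ℕ) : map n ≫ (curve n).str = (curve (n + 1)).str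
  not_isConstant (n : ℕ) : ¬ IsConstant (map n)
  one_lt_degree (n : ℕ) : 1 < degree (map n)

/-- The genus of a tower, `limsup g(C_n)`, possibly infinite. -/
def Tower.genus {K : Type u} [Field K] (T : Tower K) : ℕ∞ :=
  Filter.limsup (fun n => ((T.curve n).genus : ℕ∞)) Filter.atTop

end

end CurveTower

/-! The theorem reduces to one finite extension of function fields `L / F` over `K`. Each function
field is finite separable over some `K(X)`. Let `A` and `B` be the integral closures in `F` of
`K[X]` and of the local ring at infinity. Every place contains one of them, so H¹ is `F / (A + B)`;
this is finite-dimensional, and by strong approximation it agrees with the repartition quotient over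
all closed points (`IsPlaceFamily.finrank_eq`). The quotient is therefore independent of the choice
of `X`.

Separable case. The trace maps `L` onto `F` and sends `A' + B'` into `A + B`, where `A'`, `B'` are
the integral closures in `L`; hence `g ≤ g'`. For strictness let `g ≥ 2` and take a nonzero
functional `ψ` on `F / (A + B)`, which plays the role of a regular differential. Let `I`, `J` be the
largest modules over `A`, `B` killed by `ψ`, and put `d = dim I/A + dim J/B`, `h = dim F/(I + J)`.
By Weil's argument all such functionals are multiples of `ψ` (`exists_eq_twist`), so `dim I ∩ J ≥
g`, and the Euler characteristic formula (`euler_char`) gives `2g ≤ d + 1 + h`. Also `d ≥ 1`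
(`exists_canonical`). In `L` the extended modules have degree `d' ≥ 2d` (`two_mul_finrank_le`), the
trace gives `h' ≥ h`, and twisting `ψ ∘ Tr` gives `dim I' ∩ J' ≤ g'`. Therefore `2g' ≥ 1 + d' + h' ≥
1 + 2d + h ≥ 2g + d > 2g`. This replaces Riemann–Hurwitz and needs no different.

Inseparable case. Let `M` be the separable closure of `F` in `L` and `q = [L : M]`. Then `M = K ·
L^q`, so `x ↦ x^q` is a semilinear map `L → M` whose image spans, and it respects suitable charts;
hence `g(M) ≥ g(F)` is followed by `g(L) ≥ g(M)` (`exists_ratGenus_le`). If `L / F` is not purely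
inseparable then `[M : F] ≥ 2`, and the separable case applies to `M / F`.

The geometry supplies three inputs: closed points correspond to places (valuative criterion),
function fields are finite separable over `K(X)` (étale coordinates), and `K` is algebraically
closed in `K(C)` (geometric connectedness). -/

namespace CurveTower

/-! ### Euler characteristics of pairs of subspaces -/

section EulerChar

variable {K V : Type*} [Field K] [AddCommGroup V] [Module K V]

theorem finrank_quotient_sup_eq (A B I : Submodule K V) (hAI : A ≤ I)
    [Module.Finite K (V ⧸ (A ⊔ B))] :
    Module.finrank K (V ⧸ (I ⊔ B)) + Module.finrank K (I.map (A ⊔ B).mkQ) =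
      Module.finrank K (V ⧸ (A ⊔ B)) := by
  have h1 : (I ⊔ B).map (A ⊔ B).mkQ = I.map (A ⊔ B).mkQ := by
    rw [Submodule.map_sup]
    refine sup_eq_left.mpr ?_
    rw [Submodule.map_le_iff_le_comap]
    intro x hx
    rw [Submodule.mem_comap, Submodule.mkQ_apply,
      (Submodule.Quotient.mk_eq_zero _).mpr (Submodule.mem_sup_right hx)]
    exact zero_mem _
  have h2 := (Submodule.quotientQuotientEquivQuotient (A ⊔ B) (I ⊔ B)
    (sup_le_sup_right hAI B)).finrank_eq
  rw [← h2, h1]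
  exact Submodule.finrank_quotient_add_finrank _

/-- This is the modular law `I ∩ (A + B) = A + (I ∩ B)`, read modulo `A`. -/
theorem ker_factor_map (A B I : Submodule K V) (hAI : A ≤ I) :
    (LinearMap.ker ((Submodule.factor (le_sup_left : A ≤ A ⊔ B)).domRestrict (I.map A.mkQ))).map
      (I.map A.mkQ).subtype = (I ⊓ B).map A.mkQ := by
  ext x
  constructor
  · rintro ⟨⟨_, v, hv, rfl⟩, hx, rfl⟩
    change (A ⊔ B).mkQ v = 0 at hx
    rw [Submodule.mkQ_apply, Submodule.Quotient.mk_eq_zero] at hx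
    obtain ⟨a, ha, b, hb, rfl⟩ := Submodule.mem_sup.mp hx
    refine ⟨b, ⟨?_, hb⟩, ?_⟩
    · have := I.sub_mem hv (hAI ha)
      simpa using this
    · simpa using ha
  · rintro ⟨v, ⟨hv, hb⟩, rfl⟩
    refine ⟨⟨A.mkQ v, v, hv, rfl⟩, ?_, rfl⟩
    change (A ⊔ B).mkQ v = 0
    rw [Submodule.mkQ_apply, Submodule.Quotient.mk_eq_zero]
    exact Submodule.mem_sup_right hb

theorem comap_subtype_eq_inf (A J : Submodule K V) :
    A.comap J.subtype = (A ⊓ J).comap J.subtype := by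
  rw [Submodule.comap_inf]; simp

theorem finrank_map_mkQ_add (A J : Submodule K V) [Module.Finite K J] :
    Module.finrank K (J.map A.mkQ) + Module.finrank K ↥(A ⊓ J) = Module.finrank K J := by
  have h := LinearMap.finrank_range_add_finrank_ker (A.mkQ.domRestrict J)
  rw [LinearMap.range_domRestrict, LinearMap.ker_domRestrict, Submodule.ker_mkQ] at h
  rw [← h, comap_subtype_eq_inf]
  congr 1
  exact (LinearEquiv.finrank_eq (Submodule.comap_equiv_self_of_inj_of_le
    (f := J.subtype) J.injective_subtype (p := A ⊓ J) (by simp))).symm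

theorem finite_of_map_mkQ (A J : Submodule K V) [Module.Finite K ↥(A ⊓ J)]
    [Module.Finite K (J.map A.mkQ)] : Module.Finite K J := by
  have e := (Submodule.comap_equiv_self_of_inj_of_le
    (f := J.subtype) J.injective_subtype (p := A ⊓ J) (by simp))
  have h1 : Module.Finite K (LinearMap.ker (A.mkQ.domRestrict J)) := by
    rw [LinearMap.ker_domRestrict, Submodule.ker_mkQ]
    rw [comap_subtype_eq_inf]
    exact Module.Finite.equiv e.symm
  have h2 : Module.Finite K (LinearMap.range (A.mkQ.domRestrict J)) := by
    rw [LinearMap.range_domRestrict]; infer_instance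
  have := Module.Finite.equiv (A.mkQ.domRestrict J).quotKerEquivRange.symm
  exact Module.Finite.of_submodule_quotient (LinearMap.ker (A.mkQ.domRestrict J))

theorem finite_map_mkQ_of_inf (A B I : Submodule K V) (hAI : A ≤ I)
    [Module.Finite K (V ⧸ (A ⊔ B))] [Module.Finite K ↥(I ⊓ B)] :
    Module.Finite K (I.map A.mkQ) := by
  set f := (Submodule.factor (le_sup_left : A ≤ A ⊔ B)).domRestrict (I.map A.mkQ) with hf
  have h1 : Module.Finite K (LinearMap.ker f) := by
    have : Module.Finite K ((LinearMap.ker f).map (I.map A.mkQ).subtype) := by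
      rw [hf, ker_factor_map A B I hAI]; infer_instance
    exact Module.Finite.equiv (Submodule.equivMapOfInjective _ (Submodule.injective_subtype _)
      (LinearMap.ker f)).symm
  have := Module.Finite.equiv f.quotKerEquivRange.symm
  exact Module.Finite.of_submodule_quotient (LinearMap.ker f)

/-- Alternating sum of dimensions in the exact sequence `0 → A ∩ B → I ∩ B → I/A → V/(A + B) → V/(I
+ B) → 0`. -/
theorem euler_step (A B I : Submodule K V) (hAI : A ≤ I)
    [Module.Finite K (V ⧸ (A ⊔ B))] [Module.Finite K ↥(I ⊓ B)] :
    Module.finrank K ↥(I ⊓ B) + Module.finrank K (V ⧸ (A ⊔ B)) =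
      Module.finrank K ↥(A ⊓ B) + Module.finrank K (I.map A.mkQ)
        + Module.finrank K (V ⧸ (I ⊔ B)) := by
  have := finite_map_mkQ_of_inf A B I hAI
  set f := (Submodule.factor (le_sup_left : A ≤ A ⊔ B)).domRestrict (I.map A.mkQ) with hf
  have h1 := LinearMap.finrank_range_add_finrank_ker f
  have h2 : Module.finrank K (LinearMap.ker f) = Module.finrank K ((I ⊓ B).map A.mkQ) := by
    rw [← ker_factor_map A B I hAI]
    exact (LinearEquiv.finrank_eq (Submodule.equivMapOfInjective _ (Submodule.injective_subtype _)
      (LinearMap.ker f)))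
  have h3 : LinearMap.range f = I.map (A ⊔ B).mkQ := by
    rw [hf, LinearMap.range_domRestrict, ← Submodule.map_comp]
    congr 1
  have h4 := finrank_quotient_sup_eq A B I hAI
  have h5 := finrank_map_mkQ_add A (I ⊓ B)
  rw [← inf_assoc, inf_eq_left.mpr hAI] at h5
  rw [h3] at h1
  omega

/-- Riemann's formula for pairs: with `h⁰ = dim A ∩ B` and `h¹ = dim V/(A + B)`, the difference `h⁰
- h¹` grows by the degree `dim I/A + dim J/B`. It follows by enlarging one member of the pair at a
time. -/
theorem euler_char (A B I J : Submodule K V) (hAI : A ≤ I) (hBJ : B ≤ J)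
    [Module.Finite K (V ⧸ (A ⊔ B))] [Module.Finite K ↥(I ⊓ J)] :
    Module.finrank K ↥(I ⊓ J) + Module.finrank K (V ⧸ (A ⊔ B)) =
      Module.finrank K ↥(A ⊓ B) + Module.finrank K (I.map A.mkQ)
        + Module.finrank K (J.map B.mkQ) + Module.finrank K (V ⧸ (I ⊔ J)) := by
  have hq : Module.Finite K (V ⧸ (I ⊔ B)) :=
    Module.Finite.of_surjective (Submodule.factor (sup_le_sup_right hAI B))
      (Submodule.factor_surjective _)
  have hi : Module.Finite K ↥(I ⊓ B) := Submodule.finiteDimensional_of_le (inf_le_inf_left I hBJ)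
  have e1 := euler_step A B I hAI
  have : Module.Finite K (V ⧸ (B ⊔ I)) := by rwa [sup_comm]
  have : Module.Finite K ↥(J ⊓ I) := by rwa [inf_comm]
  have e2 := euler_step B I J hBJ
  rw [inf_comm J I, sup_comm B I, inf_comm B I, sup_comm J I] at e2
  omega

theorem finite_inf_of_finite_map (A B I J : Submodule K V) (hAI : A ≤ I) (hBJ : B ≤ J)
    [Module.Finite K ↥(A ⊓ B)] [Module.Finite K (I.map A.mkQ)] [Module.Finite K (J.map B.mkQ)] :
    Module.Finite K ↥(I ⊓ J) := by
  have h0 : ∀ A B I : Submodule K V, A ≤ I → Module.Finite K ↥(A ⊓ B) →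
      Module.Finite K (I.map A.mkQ) → Module.Finite K ↥(I ⊓ B) := by
    intro A B I hAI h1 h2
    have : Module.Finite K ↥(A ⊓ (I ⊓ B)) := by rwa [← inf_assoc, inf_eq_left.mpr hAI]
    have : Module.Finite K ((I ⊓ B).map A.mkQ) :=
      Submodule.finiteDimensional_of_le (Submodule.map_mono inf_le_left)
    exact finite_of_map_mkQ A _
  have h1 := h0 A B I hAI inferInstance inferInstance
  rw [inf_comm] at h1 ⊢
  exact h0 B I J hBJ h1 inferInstance

end EulerChar
end CurveTower

namespace CurveTower

/-! ### Weil's duality argument for two subrings of a field -/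

section Duality

variable {K F : Type*} [Field K] [Field F] [Algebra K F]

/-- The functional `r ↦ ψ (s * r)`, as a linear function of `s`. -/
def twist (ψ : F →ₗ[K] K) : F →ₗ[K] F →ₗ[K] K := (LinearMap.mul K F).compr₂ ψ

@[simp] theorem twist_apply (ψ : F →ₗ[K] K) (s r : F) : twist ψ s r = ψ (s * r) := rfl

theorem twist_injective {ψ : F →ₗ[K] K} (hψ : ψ ≠ 0) : Function.Injective (twist ψ) := by
  rw [injective_iff_map_eq_zero]
  intro s hs
  by_contra h
  apply hψ
  ext r
  have := LinearMap.congr_fun hs (s⁻¹ * r)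
  simpa [h] using this

/-- The functionals vanishing on `P`. -/
def killing (P : Submodule K F) : Submodule K (F →ₗ[K] K) := LinearMap.range (LinearMap.lcomp K K P.mkQ)

theorem mem_killing {P : Submodule K F} {φ : F →ₗ[K] K} : φ ∈ killing P ↔ ∀ p ∈ P, φ p = 0 := by
  constructor
  · rintro ⟨f, rfl⟩ p hp
    have : P.mkQ p = 0 := (Submodule.Quotient.mk_eq_zero P).mpr hp
    rw [LinearMap.lcomp_apply, this, map_zero]
  · intro h
    exact ⟨P.liftQ φ h, by ext x; rfl⟩

theorem finrank_killing (P : Submodule K F) [Module.Finite K (F ⧸ P)] :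
    Module.Finite K (killing P) ∧ Module.finrank K (killing P) = Module.finrank K (F ⧸ P) := by
  have hinj : Function.Injective (LinearMap.lcomp K K P.mkQ) := fun f g h =>
    LinearMap.ext fun x => by
      obtain ⟨x, rfl⟩ := P.mkQ_surjective x
      exact LinearMap.congr_fun h x
  refine ⟨inferInstanceAs (Module.Finite K (LinearMap.range _)), ?_⟩
  rw [killing, LinearMap.finrank_range_of_inj hinj]
  exact Subspace.dual_finrank_eq

/-- The map `s ↦ ψ(s ·)` embeds `W` into the dual of `F / P`. -/
theorem finrank_le_of_twist {ψ : F →ₗ[K] K} (hψ : ψ ≠ 0) (W P : Submodule K F)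
    [Module.Finite K (F ⧸ P)] (h : ∀ s ∈ W, ∀ p ∈ P, ψ (s * p) = 0) :
    Module.Finite K W ∧ Module.finrank K W ≤ Module.finrank K (F ⧸ P) := by
  obtain ⟨h1, h2⟩ := finrank_killing P
  have : IsNoetherian K (killing P) :=
    @isNoetherian_of_isNoetherianRing_of_finite K (killing P) _ _ _ _ h1
  let f : W →ₗ[K] (killing P) := ((twist ψ).domRestrict W).codRestrict _ fun s =>
    mem_killing.mpr fun p hp => h s s.2 p hp
  have hf : Function.Injective f := fun a b hab =>
    Subtype.ext (twist_injective hψ (congrArg Subtype.val hab))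
  exact ⟨Module.Finite.of_injective f hf, h2 ▸ LinearMap.finrank_le_finrank_of_injective hf⟩

/-- The elements `r` such that `ψ` vanishes on `r * A`. -/
def annihilated (ψ : F →ₗ[K] K) (A : Subalgebra K F) : Submodule K F where
  carrier := {r | ∀ a ∈ A, ψ (r * a) = 0}
  zero_mem' := by simp
  add_mem' hx hy a ha := by rw [add_mul, map_add, hx a ha, hy a ha, add_zero]
  smul_mem' c x hx a ha := by rw [smul_mul_assoc, map_smul, hx a ha, smul_zero]

theorem mul_mem_annihilated {ψ : F →ₗ[K] K} {A : Subalgebra K F} {a x : F} (ha : a ∈ A)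
    (hx : x ∈ annihilated ψ A) : a * x ∈ annihilated ψ A := fun b hb => by
  rw [mul_comm a x, mul_assoc]
  exact hx _ (A.mul_mem ha hb)

theorem le_annihilated {ψ : F →ₗ[K] K} {A : Subalgebra K F} (h : ∀ a ∈ A, ψ a = 0) :
    Subalgebra.toSubmodule A ≤ annihilated ψ A := fun _ hx _ ha => h _ (A.mul_mem hx ha)

/-- The subspace `s * W`. -/
abbrev scale (s : F) (W : Submodule K F) : Submodule K F := W.map (LinearMap.mulLeft K s)

theorem mem_scale {s : F} (hs : s ≠ 0) {W : Submodule K F} {x : F} :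
    x ∈ scale s W ↔ s⁻¹ * x ∈ W := by
  constructor
  · rintro ⟨w, hw, rfl⟩
    simpa [hs] using hw
  · intro h
    exact ⟨_, h, by simp [hs]⟩

/-- Multiplication by `s` as a linear automorphism. -/
noncomputable def mulLeftEquiv {s : F} (hs : s ≠ 0) : F ≃ₗ[K] F :=
  LinearEquiv.ofBijective (LinearMap.mulLeft K s) ⟨mul_right_injective₀ hs, mul_left_surjective₀ hs⟩

/-- `Y / X ≃ sY / sX`. -/
noncomputable def scaleQuotEquiv {s : F} (hs : s ≠ 0) (X Y : Submodule K F) :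
    Y.map X.mkQ ≃ₗ[K] (scale s Y).map (scale s X).mkQ :=
  let e := Submodule.Quotient.equiv X (scale s X) (mulLeftEquiv (K := K) hs) rfl
  (e.submoduleMap (Y.map X.mkQ)).trans (LinearEquiv.ofEq _ _ (by
    rw [← Submodule.map_comp, ← Submodule.map_comp]
    rfl))

variable (A B : Subalgebra K F) (t : F)

/-- The subspace `s ^ m * B`. -/
abbrev shift {K F : Type*} [Field K] [Field F] [Algebra K F] (B : Subalgebra K F) (s : F) (m : ℕ) :
    Submodule K F := scale (s ^ m) (Subalgebra.toSubmodule B)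

theorem le_scale_pow (hs : t⁻¹ ∈ B) (ht : t ∉ B) {m n : ℕ} (hmn : m ≤ n) : (shift B t m) ≤ (shift B t n) := by
  have h0 : t ≠ 0 := by rintro rfl; exact ht B.zero_mem
  intro x hx
  rw [mem_scale (pow_ne_zero _ h0)] at hx ⊢
  obtain ⟨k, rfl⟩ := Nat.exists_eq_add_of_le hmn
  rw [add_comm, pow_add, mul_inv, mul_assoc, ← inv_pow]
  exact B.mul_mem (B.pow_mem hs k) hx

theorem lt_scale_pow (hs : t⁻¹ ∈ B) (ht : t ∉ B) (m : ℕ) : (shift B t m) < (shift B t (m + 1)) := by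
  have h0 : t ≠ 0 := by rintro rfl; exact ht B.zero_mem
  refine lt_of_le_not_ge (le_scale_pow B t hs ht m.le_succ) fun h => ht ?_
  have h1 : t ^ (m + 1) ∈ (shift B t (m + 1)) := by
    rw [mem_scale (pow_ne_zero _ h0), inv_mul_cancel₀ (pow_ne_zero _ h0)]
    exact B.one_mem
  have := h h1
  rw [mem_scale (pow_ne_zero _ h0), pow_succ, inv_mul_cancel_left₀ (pow_ne_zero _ h0)] at this
  exact this

/-- The chain `B ⊂ tB ⊂ t²B ⊂ …` is strict, so each step adds at least one dimension. This crude
linear growth is all that the duality argument needs. -/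
theorem le_finrank_scale (hs : t⁻¹ ∈ B) (ht : t ∉ B) 
    (hf : ∀ m, Module.Finite K ((shift B t m).map (Subalgebra.toSubmodule B).mkQ)) (m : ℕ) :
    m ≤ Module.finrank K ((shift B t m).map (Subalgebra.toSubmodule B).mkQ) := by
  have hB : Subalgebra.toSubmodule B = (shift B t 0) := by
    ext x; simp
  induction m with
  | zero => exact Nat.zero_le _
  | succ m ih =>
    refine lt_of_le_of_lt ih (Submodule.finrank_lt_finrank_of_lt (lt_of_le_of_ne
      (Submodule.map_mono (le_scale_pow B t hs ht m.le_succ)) fun h => ?_))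
    have := congrArg (Submodule.comap (Subalgebra.toSubmodule B).mkQ) h
    rw [Submodule.comap_map_mkQ, Submodule.comap_map_mkQ, sup_eq_right.mpr, sup_eq_right.mpr] at this
    · exact (lt_scale_pow B t hs ht m).ne this
    · exact hB.trans_le (le_scale_pow B t hs ht (Nat.zero_le _))
    · exact hB.trans_le (le_scale_pow B t hs ht (Nat.zero_le _))

variable {A B t} in
/-- Two functionals vanishing on `A + B` are proportional over `F`. -/
theorem exists_eq_twist (hs : t⁻¹ ∈ B) (ht : t ∉ B)
    (hfin : ∀ m : ℕ, Module.Finite K (F ⧸ (Subalgebra.toSubmodule A ⊔ (shift B t⁻¹ m))))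
    (h01 : Module.finrank K ↥(Subalgebra.toSubmodule A ⊓ Subalgebra.toSubmodule B) = 1)
    {ψ ψ' : F →ₗ[K] K} (hψ : ψ ≠ 0) (hA : ∀ a ∈ A, ψ a = 0) (hB : ∀ b ∈ B, ψ b = 0)
    (hA' : ∀ a ∈ A, ψ' a = 0) (hB' : ∀ b ∈ B, ψ' b = 0) : ∃ u, ψ' = twist ψ u := by
  by_cases hψ' : ψ' = 0
  · exact ⟨0, by simp [hψ']⟩
  have h0 : t ≠ 0 := by rintro rfl; exact ht B.zero_mem
  set A₁ := Subalgebra.toSubmodule A with hA₁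
  set B₁ := Subalgebra.toSubmodule B with hB₁
  have hw0 : (shift B t⁻¹ 0) = B₁ := by ext x; simp [hB₁]
  have hW0 : (shift B t 0) = B₁ := by ext x; simp [hB₁]
  have hfin0 : Module.Finite K (F ⧸ (A₁ ⊔ B₁)) := hw0 ▸ hfin 0
  have hfAB : Module.Finite K ↥(A₁ ⊓ B₁) := Module.finite_of_finrank_eq_succ h01
  have hle : ∀ m, B₁ ≤ (shift B t m) := fun m => hW0 ▸ le_scale_pow B t hs ht (Nat.zero_le _)
  have hle' : ∀ m, (shift B t⁻¹ m) ≤ B₁ := by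
    rintro m _ ⟨b, hb, rfl⟩
    exact B.mul_mem (B.pow_mem hs m) hb
  have hsc : ∀ m, scale (t ^ m) ((shift B t⁻¹ m)) = B₁ := by
    intro m
    ext x
    rw [mem_scale (pow_ne_zero _ h0), mem_scale (pow_ne_zero _ (inv_ne_zero h0))]
    simp [h0, hB₁]
  have hq : ∀ m, Module.Finite K (B₁.map ((shift B t⁻¹ m)).mkQ) := by
    intro m
    have := hfin m
    rw [sup_comm] at this
    have : Module.Finite K ↥(B₁ ⊓ A₁) := by rwa [inf_comm]
    exact finite_map_mkQ_of_inf ((shift B t⁻¹ m)) A₁ B₁ (hle' m)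
  have he : ∀ m, Nonempty (B₁.map ((shift B t⁻¹ m)).mkQ ≃ₗ[K] ((shift B t m)).map B₁.mkQ) := by
    intro m
    have e := scaleQuotEquiv (pow_ne_zero m h0) ((shift B t⁻¹ m)) B₁
    rw [hsc m] at e
    exact ⟨e⟩
  have hq' : ∀ m, Module.Finite K (((shift B t m)).map B₁.mkQ) := fun m =>
    Module.Finite.equiv (he m).some
  set g := Module.finrank K (F ⧸ (A₁ ⊔ B₁)) with hg
  -- With `β = dim t^m B / B`, Riemann's formula gives `dim A ∩ t^m B ≥ 1 + β - g` (from `e1`) and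
  -- `dim F / (A + t^(-m) B) ≤ β + g` (from `e2` and `h3`). Twice the first exceeds the second once
  -- `β > 3g - 2`, and `β ≥ m`.
  let m := 3 * g
  set β := Module.finrank K (((shift B t m)).map B₁.mkQ) with hβ
  have hβm : 3 * g ≤ β := le_finrank_scale B t hs ht hq' m
  have hW : Module.Finite K ↥(A₁ ⊓ (shift B t m)) := by
    have : Module.Finite K (A₁.map A₁.mkQ) := by
      rw [Submodule.mkQ_map_self]; infer_instance
    exact finite_inf_of_finite_map A₁ B₁ A₁ ((shift B t m)) le_rfl (hle m)
  have e1 := euler_char A₁ B₁ A₁ ((shift B t m)) le_rfl (hle m)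
  have hinf : Module.Finite K (F ⧸ ((shift B t⁻¹ m) ⊔ A₁)) := by rw [sup_comm]; exact hfin m
  have hinf' : Module.Finite K ↥(B₁ ⊓ A₁) := by rwa [inf_comm]
  have e2 := euler_step ((shift B t⁻¹ m)) A₁ B₁ (hle' m)
  have h3 : Module.finrank K ↥((shift B t⁻¹ m) ⊓ A₁) ≤ Module.finrank K ↥(B₁ ⊓ A₁) :=
    Submodule.finrank_mono (inf_le_inf_right _ (hle' m))
  rw [(he m).some.finrank_eq, sup_comm ((shift B t⁻¹ m)), sup_comm B₁] at e2
  set P := A₁ ⊔ (shift B t⁻¹ m) with hP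
  have := hfin m
  obtain ⟨h4, h5⟩ := finrank_killing P
  -- Multiplication by an element of `A ∩ t^m B` carries `A + t^(-m) B` into `A + B`.
  have key : ∀ φ : F →ₗ[K] K, (∀ a ∈ A, φ a = 0) → (∀ b ∈ B, φ b = 0) →
      ∀ s ∈ A₁ ⊓ (shift B t m), twist φ s ∈ (killing P) := by
    rintro φ h1 h2 s ⟨hsA, hsB⟩
    rw [mem_killing]
    intro p hp
    obtain ⟨a, ha, c, hc, rfl⟩ := Submodule.mem_sup.mp hp
    obtain ⟨b, hb, rfl⟩ := hc
    replace hsB := (mem_scale (pow_ne_zero _ h0)).mp hsB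
    rw [map_add, twist_apply, twist_apply, h1 _ (A.mul_mem hsA ha), zero_add]
    have := h2 _ (B.mul_mem hsB hb)
    rw [← this]
    congr 1
    simp only [LinearMap.mulLeft_apply, inv_pow]
    ring
  -- By dimension this map has a nonzero kernel element `(s, s')`, that is `ψ(s ·) + ψ'(s' ·) = 0`;
  -- then `s' ≠ 0` and one divides by it.
  let f : (↥(A₁ ⊓ (shift B t m)) × ↥(A₁ ⊓ (shift B t m))) →ₗ[K] (killing P) :=
    LinearMap.coprod
      (((twist ψ).domRestrict _).codRestrict _ fun s => key ψ hA hB s s.2)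
      (((twist ψ').domRestrict _).codRestrict _ fun s => key ψ' hA' hB' s s.2)
  have hlt : Module.finrank K (killing P) <
      Module.finrank K (↥(A₁ ⊓ (shift B t m)) × ↥(A₁ ⊓ (shift B t m))) := by
    rw [Module.finrank_prod, h5]
    rw [inf_comm B₁ A₁] at h3
    have : Module.finrank K (A₁.map A₁.mkQ) = 0 := by rw [Submodule.mkQ_map_self]; simp
    rw [inf_comm B₁ A₁] at e2
    omega
  obtain ⟨⟨s, s'⟩, hss, hne⟩ := (Submodule.ne_bot_iff _).mp (
    LinearMap.ker_ne_bot_of_finrank_lt (V₂ := killing P) (f := f) hlt)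
  have hrel : ∀ r, ψ (s * r) + ψ' (s' * r) = 0 := fun r =>
    LinearMap.congr_fun (congrArg Subtype.val hss) r
  have hs0 : (s' : F) ≠ 0 := by
    intro h
    have h1 : twist ψ s = 0 := by
      ext r
      have := hrel r
      rw [h, zero_mul, map_zero, add_zero] at this
      exact this
    have h2 := (injective_iff_map_eq_zero _).mp (twist_injective hψ) _ h1
    exact hne (Prod.ext (Subtype.ext h2) (Subtype.ext h))
  refine ⟨-(s / s'), ?_⟩
  ext r
  have := hrel ((s' : F)⁻¹ * r)
  rw [mul_inv_cancel_left₀ hs0, add_comm, add_eq_zero_iff_eq_neg, ← map_neg] at this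
  rw [this, twist_apply]
  congr 1
  ring

variable {A B t} in
/-- The canonical divisor: a pair `(I, J)` of large degree with nonzero `H¹`. -/
theorem exists_canonical (hs : t⁻¹ ∈ B) (ht : t ∉ B)
    (hfin : ∀ m : ℕ, Module.Finite K (F ⧸ (Subalgebra.toSubmodule A ⊔ shift B t⁻¹ m)))
    (h01 : Module.finrank K ↥(Subalgebra.toSubmodule A ⊓ Subalgebra.toSubmodule B) = 1)
    (hg : 2 ≤ Module.finrank K (F ⧸ (Subalgebra.toSubmodule A ⊔ Subalgebra.toSubmodule B))) :
    ∃ (I J : Submodule K F) (ψ : F →ₗ[K] K), ψ ≠ 0 ∧ (∀ x ∈ I, ψ x = 0) ∧ (∀ x ∈ J, ψ x = 0) ∧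
      Subalgebra.toSubmodule A ≤ I ∧ Subalgebra.toSubmodule B ≤ J ∧
      (∀ a ∈ A, ∀ x ∈ I, a * x ∈ I) ∧ (∀ b ∈ B, ∀ x ∈ J, b * x ∈ J) ∧
      Module.Finite K (I.map (Subalgebra.toSubmodule A).mkQ) ∧
      Module.Finite K (J.map (Subalgebra.toSubmodule B).mkQ) ∧
      1 ≤ Module.finrank K (I.map (Subalgebra.toSubmodule A).mkQ) +
        Module.finrank K (J.map (Subalgebra.toSubmodule B).mkQ) ∧
      2 * Module.finrank K (F ⧸ (Subalgebra.toSubmodule A ⊔ Subalgebra.toSubmodule B)) ≤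
        Module.finrank K (I.map (Subalgebra.toSubmodule A).mkQ) +
        Module.finrank K (J.map (Subalgebra.toSubmodule B).mkQ) + 1 +
        Module.finrank K (F ⧸ (I ⊔ J)) := by
  set A₁ := Subalgebra.toSubmodule A with hA₁
  set B₁ := Subalgebra.toSubmodule B with hB₁
  have hfin0 : Module.Finite K (F ⧸ (A₁ ⊔ B₁)) := by
    have : shift B t⁻¹ 0 = B₁ := by ext x; simp [hB₁]
    exact this ▸ hfin 0
  obtain ⟨hd, hd'⟩ := finrank_killing (A₁ ⊔ B₁)
  have : Nontrivial (killing (A₁ ⊔ B₁)) := Module.nontrivial_of_finrank_pos (R := K) (by omega)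
  obtain ⟨⟨ψ, hψk⟩, hψ⟩ := exists_ne (0 : killing (A₁ ⊔ B₁))
  have hψ0 : ψ ≠ 0 := fun h => hψ (Subtype.ext h)
  rw [mem_killing] at hψk
  have hA : ∀ a ∈ A, ψ a = 0 := fun a ha => hψk a (Submodule.mem_sup_left ha)
  have hB : ∀ b ∈ B, ψ b = 0 := fun b hb => hψk b (Submodule.mem_sup_right hb)
  -- The pair `(I, J)` is the divisor of the differential `ψ`: an element `s` lies in `I ∩ J`
  -- exactly when `ψ(s ·)` vanishes on `A + B`.
  set I := annihilated ψ A with hI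
  set J := annihilated ψ B with hJ
  have hAI : A₁ ≤ I := le_annihilated hA
  have hBJ : B₁ ≤ J := le_annihilated hB
  have hIJ : ∀ s ∈ I ⊓ J, ∀ p ∈ A₁ ⊔ B₁, ψ (s * p) = 0 := by
    rintro s ⟨h1, h2⟩ p hp
    obtain ⟨a, ha, b, hb, rfl⟩ := Submodule.mem_sup.mp hp
    rw [mul_add, map_add, h1 a ha, h2 b hb, add_zero]
  obtain ⟨f1, f2⟩ := finrank_le_of_twist hψ0 (I ⊓ J) (A₁ ⊔ B₁) hIJ
  have f3 : Module.finrank K (killing (A₁ ⊔ B₁)) ≤ Module.finrank K ↥(I ⊓ J) := by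
    have hle : (killing (A₁ ⊔ B₁)) ≤ (I ⊓ J).map (twist ψ) := by
      intro ψ' h'
      rw [mem_killing] at h'
      have hA' : ∀ a ∈ A, ψ' a = 0 := fun a ha => h' a (Submodule.mem_sup_left ha)
      have hB' : ∀ b ∈ B, ψ' b = 0 := fun b hb => h' b (Submodule.mem_sup_right hb)
      obtain ⟨u, rfl⟩ := exists_eq_twist hs ht hfin h01 hψ0 hA hB hA' hB'
      exact ⟨u, ⟨hA', hB'⟩, rfl⟩
    exact (Submodule.finrank_mono hle).trans (Submodule.finrank_map_le _ _)
  have hIB : Module.Finite K ↥(I ⊓ B₁) := Submodule.finiteDimensional_of_le (inf_le_inf_left I hBJ)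
  have hJA : Module.Finite K ↥(J ⊓ A₁) :=
    Submodule.finiteDimensional_of_le (S₂ := I ⊓ J) (by rw [inf_comm]; exact inf_le_inf_right J hAI)
  have g1 := finite_map_mkQ_of_inf A₁ B₁ I hAI
  have g2 : Module.Finite K (J.map B₁.mkQ) := by
    have : Module.Finite K (F ⧸ (B₁ ⊔ A₁)) := by rwa [sup_comm]
    exact finite_map_mkQ_of_inf B₁ A₁ J hBJ
  -- Together with `dim A ∩ B = 1` and `dim I ∩ J ≥ g` this yields the inequality `2g ≤ deg + 1 +
  -- h¹(I, J)`, which is the last claim.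
  have e := euler_char A₁ B₁ I J hAI hBJ
  refine ⟨I, J, ψ, hψ0, fun x hx => ?_, fun x hx => ?_, hAI, hBJ,
    fun a ha x hx => mul_mem_annihilated ha hx, fun b hb x hx => mul_mem_annihilated hb hx,
    g1, g2, ?_, by omega⟩
  · simpa using hx 1 A.one_mem
  · simpa using hx 1 B.one_mem
  -- Degree zero would force `I = A` and `J = B`, so `dim I ∩ J = 1`, against `dim I ∩ J ≥ g ≥ 2`.
  · by_contra hlt
    have h1 : ∀ (X Y : Submodule K F), X ≤ Y → Module.Finite K (Y.map X.mkQ) →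
        Module.finrank K (Y.map X.mkQ) = 0 → Y = X := by
      intro X Y hXY _ h0
      refine le_antisymm ?_ hXY
      rw [Submodule.finrank_eq_zero] at h0
      have := congrArg (Submodule.comap X.mkQ) h0
      rw [Submodule.comap_map_mkQ, sup_eq_right.mpr hXY] at this
      rw [this]
      intro x hx
      simpa using hx
    have h2 := h1 A₁ I hAI g1 (by omega)
    have h3 := h1 B₁ J hBJ g2 (by omega)
    rw [h2, h3] at f3
    omega

end Duality
end CurveTower

namespace CurveTower

/-! ### Pairs of affine charts of a function field -/

section Charts

variable {K F : Type*} [Field K] [Field F] [Algebra K F]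

/-- Coordinate rings of an affine chart `A` and of the semilocal chart `B` at the poles of `t`, which together
cover all the places of the function field `F / K`. -/
structure IsChartPair (A B : Subalgebra K F) (t : F) : Prop where
  mem : t ∈ A
  inv_mem : t⁻¹ ∈ B
  not_mem : t ∉ B
  dedekind_left : IsDedekindDomain A
  dedekind_right : IsDedekindDomain B
  fraction_left : IsFractionRing A F
  fraction_right : IsFractionRing B F
  left_le : ∀ V : ValuationSubring F, (∀ c : K, algebraMap K F c ∈ V) → t ∈ V → ∀ a ∈ A, a ∈ V
  right_le : ∀ V : ValuationSubring F, (∀ c : K, algebraMap K F c ∈ V) → t ∉ V → ∀ b ∈ B, b ∈ V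
  exists_pow_mul_mem : ∀ f : F, ∃ m : ℕ, t⁻¹ ^ m * f ∈ B
  finite_quot : ∀ m : ℕ, Module.Finite K (F ⧸ (Subalgebra.toSubmodule A ⊔ shift B t⁻¹ m))

theorem finite_quotient_iff_exists_fg {V : Type*} [AddCommGroup V] [Module K V] (P : Submodule K V) :
    Module.Finite K (V ⧸ P) ↔ ∃ W : Submodule K V, W.FG ∧ P ⊔ W = ⊤ := by
  constructor
  · intro h
    obtain ⟨W, hW⟩ := P.exists_isCompl
    have e := P.quotientEquivOfIsCompl W hW
    have : Module.Finite K W := Module.Finite.equiv e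
    exact ⟨W, Module.Finite.iff_fg.mp this, hW.sup_eq_top⟩
  · rintro ⟨W, hW, htop⟩
    have : Module.Finite K W := Module.Finite.iff_fg.mpr hW
    refine Module.Finite.of_surjective (P.mkQ.domRestrict W) fun x => ?_
    obtain ⟨x, rfl⟩ := P.mkQ_surjective x
    obtain ⟨p, hp, w, hw, rfl⟩ := Submodule.mem_sup.mp (htop ▸ Submodule.mem_top : x ∈ P ⊔ W)
    refine ⟨⟨w, hw⟩, ?_⟩
    have h0 : P.mkQ p = 0 := (Submodule.Quotient.mk_eq_zero P).mpr hp
    rw [map_add, h0, zero_add]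
    rfl

theorem mem_valuationSubring_of_isIntegral {F A : Type*} [Field F] [CommRing A] [Algebra A F]
    (V : ValuationSubring F) (hA : ∀ a : A, algebraMap A F a ∈ V) {x : F} (hx : IsIntegral A x) :
    x ∈ V := by
  let φ : A →+* V := (algebraMap A F).codRestrict V.toSubring hA
  have h : IsIntegral V x := by
    obtain ⟨p, hp, hpx⟩ := hx
    refine ⟨p.map φ, hp.map φ, ?_⟩
    rw [Polynomial.eval₂_map]
    exact hpx
  obtain ⟨y, rfl⟩ := IsIntegrallyClosed.isIntegral_iff.mp h
  exact y.2

theorem IsChartPair.ne_zero {A B : Subalgebra K F} {t : F} (h : IsChartPair A B t) : t ≠ 0 := by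
  rintro rfl
  exact h.not_mem B.zero_mem

theorem IsChartPair.eq_top {A B : Subalgebra K F} {t : F} (h : IsChartPair A B t)
    (V : ValuationSubring F) (ht : t ∈ V) (hB : ∀ b ∈ B, b ∈ V) : V = ⊤ := by
  refine eq_top_iff.mpr fun f _ => ?_
  obtain ⟨m, hm⟩ := h.exists_pow_mul_mem f
  have := V.mul_mem _ _ (pow_mem ht m) (hB _ hm)
  rwa [← mul_assoc, ← mul_pow, mul_inv_cancel₀ h.ne_zero, one_pow, one_mul] at this

/-- A valuation ring over `K` contains `A` or `B` according to whether it contains `t`. So `x` lies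
in all of them, and their intersection is the integral closure of `K`. -/
theorem IsChartPair.isIntegral_of_mem {A B : Subalgebra K F} {t : F} (h : IsChartPair A B t)
    {x : F} (hA : x ∈ A) (hB : x ∈ B) : IsIntegral K x := by
  have h1 : x ∈ ⨅ V : {V : ValuationSubring F // Set.range (algebraMap K F) ⊆ V.toSubring},
      V.1.toSubring := by
    rw [Subring.mem_iInf]
    rintro ⟨V, hV⟩
    have hV' : ∀ c : K, algebraMap K F c ∈ V := fun c => hV ⟨c, rfl⟩
    by_cases ht : t ∈ V
    · exact h.left_le V hV' ht x hA
    · exact h.right_le V hV' ht x hB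
  rw [iInf_valuationSubring_superset] at h1
  have h2 : Subring.closure (Set.range (algebraMap K F)) = (algebraMap K F).range := by
    rw [← RingHom.coe_range, Subring.closure_eq]
  rw [h2] at h1
  obtain ⟨p, hp, hpx⟩ := h1
  have hlift : p ∈ Polynomial.lifts ((algebraMap K F).rangeRestrict) := by
    rw [Polynomial.lifts_iff_coeff_lifts]
    exact fun n => (algebraMap K F).rangeRestrict_surjective _
  obtain ⟨q, hq, -, hqm⟩ := Polynomial.lifts_and_natDegree_eq_and_monic hlift hp
  refine ⟨q, hqm, ?_⟩
  rw [← hq, Polynomial.eval₂_map] at hpx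
  exact hpx

theorem IsChartPair.finrank_inf {A B : Subalgebra K F} {t : F} (h : IsChartPair A B t)
    (hK : ∀ x : F, IsIntegral K x → ∃ c, algebraMap K F c = x) :
    Module.finrank K ↥(Subalgebra.toSubmodule A ⊓ Subalgebra.toSubmodule B) = 1 := by
  have : Subalgebra.toSubmodule A ⊓ Subalgebra.toSubmodule B =
      Subalgebra.toSubmodule (⊥ : Subalgebra K F) := by
    refine le_antisymm ?_ (le_inf ?_ ?_)
    · rintro x ⟨hA, hB⟩
      obtain ⟨c, rfl⟩ := hK x (h.isIntegral_of_mem hA hB)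
      exact (⊥ : Subalgebra K F).algebraMap_mem c
    · exact bot_le (a := A)
    · exact bot_le (a := B)
  rw [this]
  exact Subalgebra.finrank_bot

end Charts

/-! ### The chart pair of the projective line -/

section Base

variable (K : Type*) [Field K]

/-- Polynomials, in the field of rational functions. -/
noncomputable def polynomialChart : Subalgebra K (RatFunc K) :=
  (IsScalarTower.toAlgHom K (Polynomial K) (RatFunc K)).range

open Classical in
/-- Rational functions without a pole at infinity. -/
noncomputable def inftyChart : Subalgebra K (RatFunc K) where
  __ := (RatFunc.inftyValuation K).valuationSubring.toSubring
  algebraMap_mem' c := by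
    change RatFunc.inftyValuation K (algebraMap K (RatFunc K) c) ≤ 1
    by_cases hc : c = 0
    · simp [hc]
    · exact (RatFunc.inftyValuation.C K hc).le

open Classical in
theorem mem_inftyChart_iff {x : RatFunc K} : x ∈ inftyChart K ↔ RatFunc.inftyValuation K x ≤ 1 :=
  Iff.rfl

theorem mem_inftyChart {x : RatFunc K} : x ∈ inftyChart K ↔ x.intDegree ≤ 0 := by
  classical
  rw [mem_inftyChart_iff]
  by_cases hx : x = 0
  · simp [hx]
  · rw [RatFunc.inftyValuation_apply, RatFunc.inftyValuation_of_nonzero K hx, ← WithZero.exp_zero, WithZero.exp_le_exp]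

/-- Division with remainder of the numerator by the denominator: the fractional part vanishes at
infinity, and the quotient is constant when `f` has no pole there. -/
theorem exists_polynomial_add (f : RatFunc K) :
    ∃ p : Polynomial K, ∃ b ∈ inftyChart K,
      f = algebraMap (Polynomial K) (RatFunc K) p + RatFunc.X⁻¹ * b ∧
      (f ∈ inftyChart K → ∃ c : K, p = Polynomial.C c) := by
  have hm := f.monic_denom
  set q := f.denom with hq
  set r := f.num %ₘ q with hr
  set p := f.num /ₘ q with hp
  have hq0 : algebraMap (Polynomial K) (RatFunc K) q ≠ 0 :=
    RatFunc.algebraMap_ne_zero f.denom_ne_zero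
  have hX : (RatFunc.X : RatFunc K) ≠ 0 := RatFunc.X_ne_zero
  refine ⟨p, RatFunc.X * (algebraMap _ _ r / algebraMap _ _ q), ?_, ?_, ?_⟩
  · rw [mem_inftyChart]
    by_cases h0 : r = 0
    · simp [h0]
    have h1 : algebraMap (Polynomial K) (RatFunc K) r ≠ 0 := RatFunc.algebraMap_ne_zero h0
    have h2 : r.natDegree < q.natDegree := by
      refine Polynomial.natDegree_modByMonic_lt _ hm fun h => h0 ?_
      rw [hr, h, Polynomial.modByMonic_one]
    rw [RatFunc.intDegree_mul hX (div_ne_zero h1 hq0), RatFunc.intDegree_div h1 hq0,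
      RatFunc.intDegree_X, RatFunc.intDegree_polynomial, RatFunc.intDegree_polynomial]
    omega
  · rw [inv_mul_cancel_left₀ hX]
    conv_lhs => rw [← RatFunc.num_div_denom f, ← Polynomial.modByMonic_add_div f.num q]
    rw [map_add, map_mul, ← hq]
    field_simp
    ring
  · intro hf
    rw [mem_inftyChart, RatFunc.intDegree] at hf
    refine ⟨p.coeff 0, Polynomial.eq_C_of_natDegree_eq_zero ?_⟩
    rw [hp, Polynomial.natDegree_divByMonic _ hm, hq]
    omega

theorem isChartPair_ratFunc : IsChartPair (polynomialChart K) (inftyChart K) RatFunc.X := by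
  classical
  have hX : (RatFunc.X : RatFunc K) ≠ 0 := RatFunc.X_ne_zero
  have hfrac : ∀ A : Subalgebra K (RatFunc K), (∀ f, ∃ x ∈ A, ∃ y ∈ A, f = x / y) →
      IsFractionRing A (RatFunc K) := by
    intro A h
    refine IsFractionRing.of_field _ _ fun f => ?_
    obtain ⟨x, hx, y, hy, rfl⟩ := h f
    exact ⟨⟨x, hx⟩, ⟨y, hy⟩, rfl⟩
  have hinv : (RatFunc.X : RatFunc K)⁻¹ ∈ inftyChart K := by
    rw [mem_inftyChart]; simp
  have hpow : ∀ f : RatFunc K, ∃ m : ℕ, RatFunc.X⁻¹ ^ m * f ∈ inftyChart K := by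
    intro f
    refine ⟨f.intDegree.toNat, ?_⟩
    by_cases hf : f = 0
    · rw [hf, mul_zero]; exact zero_mem _
    have : ∀ m : ℕ, ((RatFunc.X : RatFunc K)⁻¹ ^ m).intDegree = -m := by
      intro m
      induction m with
      | zero => simp
      | succ m ih =>
        rw [pow_succ, RatFunc.intDegree_mul (pow_ne_zero _ (inv_ne_zero hX)) (inv_ne_zero hX), ih]
        simp
        ring
    rw [mem_inftyChart, RatFunc.intDegree_mul (pow_ne_zero _ (inv_ne_zero hX)) hf, this]
    have := Int.self_le_toNat f.intDegree
    omega
  refine ⟨⟨Polynomial.X, by simp⟩, hinv, ?_, ?_, ?_, ?_, ?_, ?_, ?_, hpow, ?_⟩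
  · rw [mem_inftyChart]; simp
  · have : IsPrincipalIdealRing (polynomialChart K) := IsPrincipalIdealRing.of_surjective
      (IsScalarTower.toAlgHom K (Polynomial K) (RatFunc K)).rangeRestrict
      (AlgHom.rangeRestrict_surjective _)
    infer_instance
  · exact inferInstanceAs (IsDedekindDomain (RatFunc.inftyValuation K).valuationSubring)
  · refine hfrac _ fun f => ?_
    exact ⟨_, ⟨f.num, rfl⟩, _, ⟨f.denom, rfl⟩, (RatFunc.num_div_denom f).symm⟩
  · refine hfrac _ fun f => ?_
    obtain ⟨m, hm⟩ := hpow f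
    refine ⟨_, hm, _, pow_mem hinv m, ?_⟩
    field_simp
  · rintro V hV ht _ ⟨p, rfl⟩
    induction p using Polynomial.induction_on' with
    | add p q hp hq => rw [map_add]; exact V.add_mem _ _ hp hq
    | monomial n c =>
      rw [← Polynomial.C_mul_X_pow_eq_monomial, map_mul, map_pow]
      refine V.mul_mem _ _ (hV c) (pow_mem ?_ n)
      simpa using ht
  -- A valuation trivial on `K` with `|X| > 1` is equivalent to the valuation at infinity, so `V` is
  -- the ring `inftyChart K` itself.
  · intro V hV ht b hb
    have : V.valuation.IsTrivialOn K := by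
      refine ⟨fun c hc => ?_⟩
      have h1 := (V.valuation_le_one_iff _).mpr (hV c)
      have h2 := (V.valuation_le_one_iff _).mpr (hV c⁻¹)
      refine le_antisymm h1 ?_
      rw [map_inv₀, map_inv₀] at h2
      have h0 : V.valuation (algebraMap K (RatFunc K) c) ≠ 0 := by simpa using hc
      exact (inv_le_one₀ (zero_lt_iff.mpr h0)).mp h2
    have h1 := RatFunc.valuation_isEquiv_inftyValuation_of_one_lt_valuation_X (v := V.valuation)
      (lt_of_not_ge fun h => ht ((V.valuation_le_one_iff _).mp h))
    rw [Valuation.isEquiv_iff_valuationSubring, ValuationSubring.valuationSubring_valuation] at h1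
    rw [h1]
    exact hb
  -- With `O` the ring at infinity, `K[X] + X⁻¹O` is everything, and `X^(-m) O = K · X^(-m) +
  -- X^(-m-1) O`: each increase of `m` costs at most one dimension.
  · intro m
    rw [finite_quotient_iff_exists_fg]
    induction m with
    | zero =>
      refine ⟨⊥, Submodule.fg_bot, eq_top_iff.mpr fun f _ => ?_⟩
      obtain ⟨p, b, hb, rfl, -⟩ := exists_polynomial_add K f
      refine Submodule.mem_sup_left (Submodule.add_mem_sup ⟨p, rfl⟩ ?_)
      rw [shift, pow_zero, mem_scale one_ne_zero]
      simpa using mul_mem hinv hb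
    | succ m ih =>
      obtain ⟨W, hW, htop⟩ := ih
      refine ⟨W ⊔ K ∙ (RatFunc.X⁻¹ ^ m), hW.sup (Submodule.fg_span_singleton _), eq_top_iff.mpr ?_⟩
      rw [← htop]
      refine sup_le (sup_le (le_sup_left.trans le_sup_left) ?_) (le_sup_left.trans le_sup_right)
      rintro _ ⟨f, hf, rfl⟩
      obtain ⟨p, b, hb, rfl, hp⟩ := exists_polynomial_add K f
      obtain ⟨c, rfl⟩ := hp hf
      rw [LinearMap.mulLeft_apply, mul_add, ← mul_assoc, ← pow_succ]
      refine add_mem (Submodule.mem_sup_right (Submodule.mem_sup_right ?_))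
        (Submodule.mem_sup_left (Submodule.mem_sup_right ⟨b, hb, rfl⟩))
      refine Submodule.mem_span_singleton.mpr ⟨c, ?_⟩
      rw [Algebra.smul_def, mul_comm]
      rfl

end Base

end CurveTower

namespace CurveTower

/-! ### Integral closures of charts in a finite separable extension -/

section Extension

variable {K F : Type*} [Field K] [Field F] [Algebra K F] 

/-- The integral closure of `A` in an extension of its ambient field. -/
def intClosure (A : Subalgebra K F) (L : Type*) [Field L] [Algebra K L] [Algebra F L]
    [IsScalarTower K F L] : Subalgebra K L :=
  (integralClosure A L).restrictScalars K

variable {L : Type*} [Field L] [Algebra K L] [Algebra F L] [IsScalarTower K F L]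

theorem mem_intClosure {A : Subalgebra K F} {x : L} : x ∈ intClosure A L ↔ IsIntegral A x := Iff.rfl

theorem algebraMap_mem_intClosure {A : Subalgebra K F} {a : F} (ha : a ∈ A) :
    algebraMap F L a ∈ intClosure A L :=
  mem_intClosure.mpr (isIntegral_algebraMap (R := A) (A := L) (x := ⟨a, ha⟩))

theorem mul_mem_intClosure {A : Subalgebra K F} {a : F} (ha : a ∈ A) {x : L}
    (hx : x ∈ intClosure A L) : algebraMap F L a * x ∈ intClosure A L :=
  mul_mem (algebraMap_mem_intClosure ha) hx

theorem mem_of_algebraMap_mem_intClosure {A : Subalgebra K F} [IsDedekindDomain A]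
    [IsFractionRing A F] {a : F} (ha : algebraMap F L a ∈ intClosure A L) : a ∈ A := by
  rw [mem_intClosure] at ha
  have h1 : IsIntegral A a := by
    rwa [← isIntegral_algebraMap_iff (algebraMap F L).injective (R := A)]
  obtain ⟨y, rfl⟩ := IsIntegrallyClosed.isIntegral_iff.mp h1
  exact y.2

variable (L) [FiniteDimensional F L]

theorem isFractionRing_intClosure (A : Subalgebra K F) [IsDedekindDomain A] [IsFractionRing A F] :
    IsFractionRing (intClosure A L) L :=
  integralClosure.isFractionRing_of_finite_extension F L

variable [Algebra.IsSeparable F L]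

theorem isDedekindDomain_intClosure (A : Subalgebra K F) [IsDedekindDomain A] [IsFractionRing A F] :
    IsDedekindDomain (intClosure A L) :=
  integralClosure.isDedekindDomain A F L

/-- A valuation ring of `L` restricts to one of `F`, and being integrally closed it contains the
integral closure of any chart contained in its restriction. -/
theorem IsChartPair.intClosure {A B : Subalgebra K F} {t : F} (h : IsChartPair A B t) :
    IsChartPair (CurveTower.intClosure A L) (CurveTower.intClosure B L) (algebraMap F L t) := by
  have := h.dedekind_left
  have := h.dedekind_right
  have := h.fraction_left
  have := h.fraction_right
  have hcomap : ∀ V : ValuationSubring L, (∀ c : K, algebraMap K L c ∈ V) →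
      ∀ c : K, algebraMap K F c ∈ V.comap (algebraMap F L) := by
    intro V hV c
    rw [ValuationSubring.mem_comap, ← IsScalarTower.algebraMap_apply]
    exact hV c
  have hle : ∀ (V : ValuationSubring L) (C : Subalgebra K F),
      (∀ c ∈ C, c ∈ V.comap (algebraMap F L)) → ∀ x ∈ CurveTower.intClosure C L, x ∈ V := by
    intro V C hC x hx
    exact mem_valuationSubring_of_isIntegral V (fun c : C => hC c c.2) (mem_intClosure.mp hx)
  -- Some nonzero `y` in `B` makes `y f` integral over `B`; a power of `t⁻¹` then brings `y⁻¹` into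
  -- `B`.
  have hpow : ∀ f : L, ∃ m : ℕ, (algebraMap F L t)⁻¹ ^ m * f ∈ CurveTower.intClosure B L := by
    intro f
    obtain ⟨y, hy0, hy⟩ := exists_integral_multiples B F ({f} : Finset L)
    have hyf := hy f (Finset.mem_singleton_self f)
    obtain ⟨m, hm⟩ := h.exists_pow_mul_mem (y : F)⁻¹
    refine ⟨m, ?_⟩
    have h1 := mul_mem_intClosure hm (mem_intClosure.mpr hyf)
    have hy0' : algebraMap F L (y : F) ≠ 0 := by
      simpa using hy0
    have h2 : (y • f : L) = algebraMap F L (y : F) * f := Algebra.smul_def _ _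
    rw [h2, map_mul, map_pow, map_inv₀, map_inv₀, mul_assoc, inv_mul_cancel_left₀ hy0'] at h1
    exact h1
  refine ⟨algebraMap_mem_intClosure h.mem, ?_, ?_, isDedekindDomain_intClosure L A,
    isDedekindDomain_intClosure L B, isFractionRing_intClosure L A, isFractionRing_intClosure L B,
    ?_, ?_, hpow, ?_⟩
  · rw [← map_inv₀]
    exact algebraMap_mem_intClosure h.inv_mem
  · exact fun ht => h.not_mem (mem_of_algebraMap_mem_intClosure ht)
  · exact fun V hV ht => hle V A (h.left_le _ (hcomap V hV) ht)
  · exact fun V hV ht => hle V B (h.right_le _ (hcomap V hV) ht)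
  · intro m
    -- Choose a basis `b` of `L / F` integral over `A`, and `N` with all `t^(-N) b i` integral over
    -- `B`. Writing each coordinate in `A + t^(-m-N) B + W` puts the vector in `A' + t^(-m) B' + ∑ W
    -- b i`.
    obtain ⟨s, b, hb⟩ := FiniteDimensional.exists_is_basis_integral A F L
    obtain ⟨N, hN⟩ : ∃ N : ℕ, ∀ i, (algebraMap F L t)⁻¹ ^ N * b i ∈ CurveTower.intClosure B L := by
      choose n hn using fun i => hpow (b i)
      refine ⟨∑ i, n i, fun i => ?_⟩
      obtain ⟨k, hk⟩ := Nat.exists_eq_add_of_le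
        (Finset.single_le_sum (f := n) (fun _ _ => Nat.zero_le _) (Finset.mem_univ i))
      rw [hk, add_comm, pow_add, mul_assoc]
      refine mul_mem (pow_mem ?_ k) (hn i)
      rw [← map_inv₀]
      exact algebraMap_mem_intClosure h.inv_mem
    obtain ⟨W, hW, htop⟩ := (finite_quotient_iff_exists_fg _).mp (h.finite_quot (m + N))
    rw [finite_quotient_iff_exists_fg]
    let μ : s → F →ₗ[K] L := fun i =>
      (LinearMap.mulLeft K (b i)).comp (IsScalarTower.toAlgHom K F L).toLinearMap
    have hμ : ∀ i f, μ i f = b i * algebraMap F L f := fun i f => rfl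
    refine ⟨⨆ i, W.map (μ i), Submodule.fg_iSup _ fun i => hW.map _, eq_top_iff.mpr fun x _ => ?_⟩
    rw [← b.sum_repr x]
    refine sum_mem fun i _ => ?_
    obtain ⟨p, hp, w, hw, hpw⟩ := Submodule.mem_sup.mp
      (htop ▸ Submodule.mem_top : b.repr x i ∈ _ ⊔ W)
    obtain ⟨a, ha, c, hc, rfl⟩ := Submodule.mem_sup.mp hp
    obtain ⟨c, hc, rfl⟩ := hc
    have hsm : b.repr x i • b i = μ i (b.repr x i) := by rw [hμ, mul_comm, Algebra.smul_def]
    rw [hsm, ← hpw, map_add, map_add]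
    refine add_mem (Submodule.mem_sup_left (add_mem (Submodule.mem_sup_left ?_)
      (Submodule.mem_sup_right ?_))) (Submodule.mem_sup_right ?_)
    · rw [hμ, mul_comm]
      exact mul_mem_intClosure ha (hb i)
    · refine ⟨algebraMap F L c * ((algebraMap F L t)⁻¹ ^ N * b i), mul_mem_intClosure hc (hN i), ?_⟩
      rw [hμ, LinearMap.mulLeft_apply, LinearMap.mulLeft_apply, map_mul, map_pow, map_inv₀]
      ring
    · exact Submodule.mem_iSup_of_mem i ⟨w, hw, rfl⟩

end Extension
end CurveTower

namespace CurveTower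

section

variable {K V : Type*} [Field K] [AddCommGroup V] [Module K V]

theorem finrank_map_mkQ_trans {A X Y : Submodule K V} (hAX : A ≤ X) (hXY : X ≤ Y)
    [Module.Finite K (Y.map A.mkQ)] :
    Module.Finite K (Y.map X.mkQ) ∧ Module.finrank K (Y.map A.mkQ) =
      Module.finrank K (X.map A.mkQ) + Module.finrank K (Y.map X.mkQ) := by
  set f := (Submodule.factor hAX).domRestrict (Y.map A.mkQ) with hf
  have h1 : LinearMap.range f = Y.map X.mkQ := by
    rw [hf, LinearMap.range_domRestrict, ← Submodule.map_comp]
    congr 1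
  have h2 : (LinearMap.ker f).map (Y.map A.mkQ).subtype = X.map A.mkQ := by
    ext x
    constructor
    · rintro ⟨⟨_, v, hv, rfl⟩, hx, rfl⟩
      change X.mkQ v = 0 at hx
      rw [Submodule.mkQ_apply, Submodule.Quotient.mk_eq_zero] at hx
      exact ⟨v, hx, rfl⟩
    · rintro ⟨v, hv, rfl⟩
      refine ⟨⟨A.mkQ v, v, hXY hv, rfl⟩, ?_, rfl⟩
      change X.mkQ v = 0
      rw [Submodule.mkQ_apply, Submodule.Quotient.mk_eq_zero]
      exact hv
  refine ⟨h1 ▸ inferInstance, ?_⟩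
  rw [← h1, ← h2, ← (Submodule.equivMapOfInjective _ (Submodule.injective_subtype _)
    (LinearMap.ker f)).finrank_eq, add_comm]
  exact (LinearMap.finrank_range_add_finrank_ker f).symm

end

/-! ### Degrees of fractional ideals in extensions -/

section Degree

variable {K F : Type*} [Field K] [Field F] [Algebra K F] {A : Subalgebra K F}
variable (L : Type*) [Field L] [Algebra F L]

/-- The extension of a fractional ideal of `A` to the integral closure of `A` in `L`. -/
noncomputable def extendIdeal (Y : Submodule A F) : Submodule A L :=
  Subalgebra.toSubmodule (integralClosure A L) * Y.map (IsScalarTower.toAlgHom A F L).toLinearMap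

theorem extendIdeal_mono {X Y : Submodule A F} (h : X ≤ Y) : extendIdeal L X ≤ extendIdeal L Y :=
  mul_le_mul' le_rfl (Submodule.map_mono h)

theorem mul_mem_extendIdeal {Y : Submodule A F} {a : L} {y : F} (ha : IsIntegral A a) (hy : y ∈ Y) :
    a * algebraMap F L y ∈ extendIdeal L Y :=
  Submodule.mul_mem_mul ha ⟨y, hy, rfl⟩

theorem mul_mem_extendIdeal' {Y : Submodule A F} {a x : L} (ha : IsIntegral A a)
    (hx : x ∈ extendIdeal L Y) : a * x ∈ extendIdeal L Y := by
  induction hx using Submodule.mul_induction_on' with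
  | mem_mul_mem m hm n hn =>
    obtain ⟨y, hy, rfl⟩ := hn
    rw [← mul_assoc]
    exact mul_mem_extendIdeal L (ha.mul hm) hy
  | add x _ y _ hx hy => rw [mul_add]; exact add_mem hx hy

theorem extendIdeal_smul_le (P : Ideal A) (Y : Submodule A F) :
    extendIdeal L (P • Y) ≤ P • extendIdeal L Y := by
  rw [extendIdeal, Submodule.mul_le, Submodule.map_smul'']
  intro m hm n hn
  induction hn using Submodule.smul_induction_on' with
  | smul r hr n hn =>
    rw [mul_smul_comm]
    exact Submodule.smul_mem_smul hr (Submodule.mul_mem_mul hm hn)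
  | add x _ y _ hx hy => rw [mul_add]; exact add_mem hx hy

theorem smul_extendIdeal_le {P : Ideal A} {X Y : Submodule A F} (h : P • Y ≤ X) :
    P • extendIdeal L Y ≤ extendIdeal L X := by
  rw [Submodule.smul_le]
  intro r hr n hn
  induction hn using Submodule.mul_induction_on' with
  | mem_mul_mem m hm n hn =>
    obtain ⟨y, hy, rfl⟩ := hn
    rw [← mul_smul_comm]
    exact Submodule.mul_mem_mul hm ⟨r • y, h (Submodule.smul_mem_smul hr hy), by simp⟩
  | add x _ y _ hx hy => rw [smul_add]; exact add_mem hx hy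

/-- By `hmax` the module `Y / X` is simple, with maximal annihilator `P`. Invertibility of
fractional ideals gives `X = J Y` with `J = X Y⁻¹`, a proper ideal containing `P`, hence equal to
`P`. -/
theorem exists_maximal_smul_eq [IsDedekindDomain A] [IsFractionRing A F] {X Y : Submodule A F}
    (hXY : X < Y) (hX : 1 ∈ X) (hY : Y.FG)
    (hmax : ∀ z ∈ Y, z ∉ X → Y ≤ X ⊔ Submodule.span A {z}) :
    ∃ (P : Ideal A) (y : F), P.IsMaximal ∧ X = P • Y ∧ y ∈ Y ∧ Y ≤ X ⊔ Submodule.span A {y} ∧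
      ∀ a : A, a • y ∈ X ↔ a ∈ P := by
  obtain ⟨y, hyY, hyX⟩ := Set.exists_of_ssubset hXY
  let P : Ideal A := X.comap (LinearMap.toSpanSingleton A F y)
  have hP : ∀ a : A, a ∈ P ↔ a • y ∈ X := fun a => Iff.rfl
  have hPmax : P.IsMaximal := by
    rw [Ideal.isMaximal_iff]
    refine ⟨by rwa [hP, one_smul], fun J a hPJ haP haJ => ?_⟩
    rw [hP] at haP
    obtain ⟨x, hx, w, hw, hxw⟩ := Submodule.mem_sup.mp (hmax _ (Y.smul_mem a hyY) haP hyY)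
    obtain ⟨c, rfl⟩ := Submodule.mem_span_singleton.mp hw
    have h1 : 1 - c * a ∈ P := by
      rw [hP, sub_smul, one_smul, mul_smul]
      rwa [← eq_sub_of_add_eq hxw]
    have := J.add_mem (hPJ h1) (J.mul_mem_left c haJ)
    simpa using this
  refine ⟨P, y, hPmax, ?_, hyY, hmax y hyY hyX, fun a => (hP a).symm⟩
  have hPY : P • Y ≤ X := by
    rw [Submodule.smul_le]
    intro r hr n hn
    obtain ⟨x, hx, w, hw, rfl⟩ := Submodule.mem_sup.mp (hmax y hyY hyX hn)
    obtain ⟨c, rfl⟩ := Submodule.mem_span_singleton.mp hw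
    rw [smul_add, smul_comm r c]
    exact add_mem (X.smul_mem _ hx) (X.smul_mem _ ((hP r).mp hr))
  refine le_antisymm ?_ hPY
  have hYf : IsFractional (nonZeroDivisors A) Y := FractionalIdeal.isFractional_of_fg hY
  have hXf : IsFractional (nonZeroDivisors A) X := by
    obtain ⟨a, ha, h⟩ := hYf
    exact ⟨a, ha, fun b hb => h b (hXY.le hb)⟩
  let 𝓧 : FractionalIdeal (nonZeroDivisors A) F := ⟨X, hXf⟩
  let 𝓨 : FractionalIdeal (nonZeroDivisors A) F := ⟨Y, hYf⟩
  have hle : 𝓧 ≤ 𝓨 := hXY.le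
  have h0 : 𝓨 ≠ 0 := by
    intro h
    have h1 : (1 : F) ∈ 𝓨 := hXY.le hX
    rw [h, FractionalIdeal.mem_zero_iff] at h1
    exact one_ne_zero h1
  have hcoe : ((P : FractionalIdeal (nonZeroDivisors A) F) * 𝓨 : Submodule A F) ≤ P • Y := by
    rw [Submodule.mul_le]
    rintro _ hm n hn
    obtain ⟨r, hr, rfl⟩ := (FractionalIdeal.mem_coeIdeal _).mp hm
    rw [← Algebra.smul_def]
    exact Submodule.smul_mem_smul hr hn
  have hPX : (P : FractionalIdeal (nonZeroDivisors A) F) * 𝓨 ≤ 𝓧 := by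
    rw [← FractionalIdeal.coe_le_coe, FractionalIdeal.coe_mul]
    exact hcoe.trans hPY
  obtain ⟨J, hJ⟩ := FractionalIdeal.le_one_iff_exists_coeIdeal.mp
    (show 𝓧 * 𝓨⁻¹ ≤ 1 by
      rw [← mul_inv_cancel₀ h0]
      exact mul_le_mul_left hle _)
  have hJ' : 𝓧 = (J : FractionalIdeal (nonZeroDivisors A) F) * 𝓨 := by
    rw [hJ, mul_assoc, inv_mul_cancel₀ h0, mul_one]
  have hPJ : P ≤ J := by
    rw [← FractionalIdeal.coeIdeal_le_coeIdeal F, hJ]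
    calc (P : FractionalIdeal (nonZeroDivisors A) F) = P * 𝓨 * 𝓨⁻¹ := by
          rw [mul_assoc, mul_inv_cancel₀ h0, mul_one]
      _ ≤ _ := mul_le_mul_left hPX _
  have hJt : J ≠ ⊤ := by
    rintro rfl
    rw [FractionalIdeal.coeIdeal_top, one_mul] at hJ'
    exact hXY.ne (congrArg Subtype.val hJ')
  rw [← hPmax.eq_of_le hJt hPJ] at hJ'
  have : X = ((P : FractionalIdeal (nonZeroDivisors A) F) * 𝓨 : Submodule A F) := by
    rw [← FractionalIdeal.coe_mul, ← hJ']
    rfl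
  rw [this]
  exact hcoe

variable [FiniteDimensional F L] [Algebra.IsSeparable F L]

/-- Let `Y'` be the extended module. If `Y' ⊆ A z + P Y'`, Nakayama gives a nonzero `r ≡ 1` mod `P`
with `r Y' ⊆ A z`. Then `z` spans `L` over `F`, against degree at least two. -/
theorem extendIdeal_not_le [IsDedekindDomain A] [IsFractionRing A F] (hn : 2 ≤ Module.finrank F L)
    {P : Ideal A} (hP : P ≠ ⊤) {Y : Submodule A F} (hY1 : 1 ∈ Y) (hY : Y.FG) (z : L) :
    ¬ extendIdeal L Y ≤ Submodule.span A {z} ⊔ P • extendIdeal L Y := by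
  intro h
  have hfg : (extendIdeal L Y).FG := by
    have := IsIntegralClosure.finite A F L (integralClosure A L)
    exact Submodule.FG.mul (Module.Finite.iff_fg.mp this) (hY.map _)
  obtain ⟨r, hr, hle⟩ := Submodule.exists_sub_one_mem_and_smul_le_of_fg_of_le_sup hfg le_rfl h
  have hr0 : (r : F) ≠ 0 := by
    intro h0
    have h0' : r = 0 := Subtype.ext h0
    rw [h0', zero_sub] at hr
    exact hP ((Ideal.eq_top_iff_one P).mpr (by simpa using hr))
  have : Module.finrank F L ≤ 1 := by
    refine finrank_le_one z fun l => ?_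
    obtain ⟨y, hy0, hy⟩ := exists_integral_multiples A F ({l} : Finset L)
    have hyl := hy l (Finset.mem_singleton_self l)
    have hy0' : (y : F) ≠ 0 := fun h => hy0 (Subtype.ext h)
    have h1 := mul_mem_extendIdeal L hyl hY1
    rw [map_one, mul_one] at h1
    obtain ⟨c, hc⟩ := Submodule.mem_span_singleton.mp
      (hle (Submodule.smul_mem_pointwise_smul _ r _ h1))
    refine ⟨(c : F) / ((r : F) * (y : F)), ?_⟩
    have h2 : (c : F) • z = (r : F) • (y : F) • l := hc
    rw [div_eq_inv_mul, mul_smul, h2, ← mul_smul, ← mul_smul, mul_assoc,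
      inv_mul_cancel₀ (mul_ne_zero hr0 hy0'), one_smul]
  omega

variable [Algebra K L] [IsScalarTower K F L]

/-- Here `X = P Y` and the extensions satisfy `X' = P Y'`. So `Y / X` is a line over `A / P`, while
`Y' / X'` is an `A / P`-space not generated by one element. Only the factor two is needed, so
ramification indices and residue degrees never enter. -/
theorem two_mul_finrank_step [IsDedekindDomain A] [IsFractionRing A F]
    (hn : 2 ≤ Module.finrank F L) {X Y : Submodule A F}
    (hXY : X < Y) (hX : 1 ∈ X) (hY : Y.FG)
    (hmax : ∀ z ∈ Y, z ∉ X → Y ≤ X ⊔ Submodule.span A {z})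
    [Module.Finite K (((extendIdeal L Y).restrictScalars K).map
      ((extendIdeal L X).restrictScalars K).mkQ)] :
    2 * Module.finrank K ((Y.restrictScalars K).map (X.restrictScalars K).mkQ) ≤
    Module.finrank K (((extendIdeal L Y).restrictScalars K).map
      ((extendIdeal L X).restrictScalars K).mkQ) := by
  obtain ⟨P, y, hP, hXP, hyY, hYy, hyP⟩ := exists_maximal_smul_eq hXY hX hY hmax
  have hE : extendIdeal L X = P • extendIdeal L Y :=
    le_antisymm (by rw [hXP]; exact extendIdeal_smul_le L P Y)
      (smul_extendIdeal_le L hXP.ge)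
  have hnle := extendIdeal_not_le L hn hP.ne_top (hXY.le hX) hY
  -- First `z₁` outside `P Y'`, then `z₂` outside `A z₁ + P Y'`: two classes independent over `A /
  -- P`.
  obtain ⟨z₁, hz₁, hz₁'⟩ := SetLike.not_le_iff_exists.mp (hnle 0)
  obtain ⟨z₂, hz₂, hz₂'⟩ := SetLike.not_le_iff_exists.mp (hnle z₁)
  rw [Submodule.span_zero_singleton, bot_sup_eq] at hz₁'
  set X₁ := X.restrictScalars K
  set X₂ := (extendIdeal L X).restrictScalars K with hX₂
  let f : A →ₗ[K] F ⧸ X₁ := X₁.mkQ ∘ₗ (LinearMap.toSpanSingleton A F y).restrictScalars K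
  let g (z : L) : A →ₗ[K] L ⧸ X₂ := X₂.mkQ ∘ₗ (LinearMap.toSpanSingleton A L z).restrictScalars K
  have hf : ∀ a, a ∈ LinearMap.ker f ↔ a ∈ P := by
    intro a
    rw [← hyP a]
    exact Submodule.Quotient.mk_eq_zero X₁
  have hfr : LinearMap.range f = (Y.restrictScalars K).map X₁.mkQ := by
    refine le_antisymm ?_ ?_
    · rintro _ ⟨a, rfl⟩
      exact ⟨a • y, Y.smul_mem a hyY, rfl⟩
    · rintro _ ⟨v, hv, rfl⟩
      obtain ⟨x, hx, w, hw, rfl⟩ := Submodule.mem_sup.mp (hYy hv)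
      obtain ⟨c, rfl⟩ := Submodule.mem_span_singleton.mp hw
      refine ⟨c, ?_⟩
      have : X₁.mkQ x = 0 := (Submodule.Quotient.mk_eq_zero X₁).mpr hx
      rw [map_add, this, zero_add]
      rfl
  have hg : ∀ z ∈ extendIdeal L Y, LinearMap.ker f ≤ LinearMap.ker (g z) := by
    intro z hz a ha
    rw [hf] at ha
    refine (Submodule.Quotient.mk_eq_zero X₂).mpr ?_
    change a • z ∈ extendIdeal L X
    rw [hE]
    exact Submodule.smul_mem_smul ha hz
  let φ : (A ⧸ LinearMap.ker f) × (A ⧸ LinearMap.ker f) →ₗ[K]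
      ((extendIdeal L Y).restrictScalars K).map X₂.mkQ :=
    LinearMap.codRestrict _ (LinearMap.coprod ((LinearMap.ker f).liftQ (g z₁) (hg z₁ hz₁))
      ((LinearMap.ker f).liftQ (g z₂) (hg z₂ hz₂))) (by
        rintro ⟨a, b⟩
        obtain ⟨a, rfl⟩ := Submodule.mkQ_surjective _ a
        obtain ⟨b, rfl⟩ := Submodule.mkQ_surjective _ b
        exact ⟨a • z₁ + b • z₂, add_mem (Submodule.smul_mem _ a hz₁) (Submodule.smul_mem _ b hz₂),
          rfl⟩)
  have hφ : Function.Injective φ := by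
    rw [injective_iff_map_eq_zero]
    rintro ⟨a, b⟩ hab
    obtain ⟨a, rfl⟩ := Submodule.mkQ_surjective _ a
    obtain ⟨b, rfl⟩ := Submodule.mkQ_surjective _ b
    have h1 : X₂.mkQ (a • z₁ + b • z₂) = 0 := congrArg Subtype.val hab
    rw [Submodule.mkQ_apply, Submodule.Quotient.mk_eq_zero, hX₂, Submodule.restrictScalars_mem,
      hE] at h1
    have hb : b ∈ P := by
      by_contra hb
      obtain ⟨c, i, hi, hci⟩ := hP.exists_inv hb
      apply hz₂'
      have : z₂ = -(c * a) • z₁ + (c • (a • z₁ + b • z₂) + i • z₂) := by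
        conv_lhs => rw [← one_smul A z₂, ← hci]
        module
      rw [this]
      exact Submodule.add_mem_sup (Submodule.smul_mem _ _ (Submodule.mem_span_singleton_self _))
        (add_mem (Submodule.smul_mem _ _ h1) (Submodule.smul_mem_smul hi hz₂))
    have ha : a ∈ P := by
      by_contra ha
      obtain ⟨c, i, hi, hci⟩ := hP.exists_inv ha
      apply hz₁'
      have : z₁ = (c • (a • z₁ + b • z₂) - c • (b • z₂)) + i • z₁ := by
        conv_lhs => rw [← one_smul A z₁, ← hci]
        module
      rw [this]
      exact add_mem (sub_mem (Submodule.smul_mem _ _ h1)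
        (Submodule.smul_mem _ _ (Submodule.smul_mem_smul hb hz₂))) (Submodule.smul_mem_smul hi hz₁)
    rw [← hf] at ha hb
    exact Prod.ext ((Submodule.Quotient.mk_eq_zero _).mpr ha)
      ((Submodule.Quotient.mk_eq_zero _).mpr hb)
  have : Module.Finite K (A ⧸ LinearMap.ker f) := Module.Finite.of_injective
    (φ.comp (LinearMap.inl K _ _)) (hφ.comp LinearMap.inl_injective)
  have h2 := LinearMap.finrank_le_finrank_of_injective hφ
  rw [Module.finrank_prod, f.quotKerEquivRange.finrank_eq, hfr] at h2
  omega

theorem two_mul_finrank_le [IsDedekindDomain A] [IsFractionRing A F]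
    (hn : 2 ≤ Module.finrank F L) (n : ℕ) : ∀ (Y : Submodule A F), 1 ≤ Y → Y.FG →
    Module.Finite K ((Y.restrictScalars K).map (Subalgebra.toSubmodule A).mkQ) →
    Module.Finite K (((extendIdeal L Y).restrictScalars K).map
      (Subalgebra.toSubmodule (intClosure A L)).mkQ) →
    Module.finrank K ((Y.restrictScalars K).map (Subalgebra.toSubmodule A).mkQ) = n →
    2 * n ≤ Module.finrank K (((extendIdeal L Y).restrictScalars K).map
      (Subalgebra.toSubmodule (intClosure A L)).mkQ) := by
  have h1A : (1 : Submodule A F).restrictScalars K = Subalgebra.toSubmodule A := by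
    ext x
    rw [Submodule.restrictScalars_mem, Submodule.mem_one]
    exact ⟨fun ⟨a, ha⟩ => ha ▸ a.2, fun hx => ⟨⟨x, hx⟩, rfl⟩⟩
  induction n using Nat.strong_induction_on with
  | _ n ih =>
  intro Y hY1 hYfg hfin hfin' hd
  rcases eq_or_lt_of_le hY1 with rfl | hlt
  · rw [h1A, Submodule.mkQ_map_self, finrank_bot] at hd
    omega
  -- A maximal proper submodule of the finitely generated module `Y` containing `A`; the induction
  -- continues with it.
  obtain ⟨X, hX1, hXY, hmax⟩ : ∃ X : Submodule A F, 1 ≤ X ∧ X < Y ∧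
      ∀ z ∈ Y, z ∉ X → Y ≤ X ⊔ Submodule.span A {z} := by
    have : Module.Finite A Y := Module.Finite.iff_fg.mpr hYfg
    rcases eq_top_or_exists_le_coatom ((1 : Submodule A F).comap Y.subtype) with h | ⟨M, hM, hle⟩
    · exact absurd (Submodule.comap_subtype_eq_top.mp h) hlt.not_ge
    · refine ⟨M.map Y.subtype, fun x hx => ⟨⟨x, hY1 hx⟩, hle hx, rfl⟩, ?_, ?_⟩
      · refine lt_of_le_of_ne (Submodule.map_subtype_le _ _) fun h => hM.1 ?_
        rw [eq_top_iff]
        rintro ⟨x, hx⟩ -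
        rw [← h] at hx
        obtain ⟨⟨x', _⟩, hm, rfl⟩ := hx
        exact hm
      · intro z hz hzM
        have h1 : M < M ⊔ Submodule.span A {⟨z, hz⟩} := by
          refine lt_of_le_of_ne le_sup_left fun h => hzM ⟨⟨z, hz⟩, ?_, rfl⟩
          rw [h]
          exact Submodule.mem_sup_right (Submodule.mem_span_singleton_self _)
        have h2 := congrArg (Submodule.map Y.subtype) (hM.2 _ h1)
        rw [Submodule.map_sup, Submodule.map_span, Set.image_singleton, Submodule.map_top,
          Submodule.range_subtype] at h2
        exact h2.ge
  have h1 : (1 : F) ∈ X := hX1 (Submodule.one_le.mp le_rfl)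
  have hle1 : Subalgebra.toSubmodule A ≤ X.restrictScalars K := h1A ▸ hX1
  obtain ⟨f1, e1⟩ := finrank_map_mkQ_trans hle1
    (show X.restrictScalars K ≤ Y.restrictScalars K from hXY.le)
  have hle2 : Subalgebra.toSubmodule (intClosure A L) ≤ (extendIdeal L X).restrictScalars K := by
    intro a ha
    have := mul_mem_extendIdeal L (mem_intClosure.mp ha) h1
    rwa [map_one, mul_one] at this
  have hle3 : (extendIdeal L X).restrictScalars K ≤ (extendIdeal L Y).restrictScalars K :=
    extendIdeal_mono L hXY.le
  obtain ⟨f2, e2⟩ := finrank_map_mkQ_trans hle2 hle3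
  have hs := two_mul_finrank_step (K := K) L hn hXY h1 hYfg hmax
  have hXfg : X.FG := by
    have : Module.Finite A Y := Module.Finite.iff_fg.mpr hYfg
    have hN : IsNoetherian A Y := isNoetherian_of_isNoetherianRing_of_finite A Y
    exact (isNoetherian_submodule.mp hN) X hXY.le
  have hpos : 0 < Module.finrank K ((Y.restrictScalars K).map (X.restrictScalars K).mkQ) := by
    by_contra h0
    have h0' : Module.finrank K ((Y.restrictScalars K).map (X.restrictScalars K).mkQ) = 0 := by
      omega
    rw [Submodule.finrank_eq_zero] at h0'
    refine hXY.not_ge fun y hy => ?_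
    have : (X.restrictScalars K).mkQ y ∈ (Y.restrictScalars K).map (X.restrictScalars K).mkQ :=
      ⟨y, hy, rfl⟩
    rw [h0', Submodule.mem_bot, Submodule.mkQ_apply, Submodule.Quotient.mk_eq_zero] at this
    exact this
  have := ih _ (by omega) X hX1 hXfg
    (Submodule.finiteDimensional_of_le (Submodule.map_mono 
      (show X.restrictScalars K ≤ Y.restrictScalars K from hXY.le)))
    (Submodule.finiteDimensional_of_le (Submodule.map_mono hle3)) rfl
  omega

end Degree
end CurveTower

namespace CurveTower

/-! ### Comparison of genera -/

/-- The images of a basis of `V' / W'` span `V / W`. Semilinearity with a spanning image, rather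
than linearity and surjectivity, lets the same statement serve the trace and the Frobenius. -/
theorem finrank_quotient_le_of_semilinear {K V V' : Type*} [Field K] [AddCommGroup V] [Module K V]
    [AddCommGroup V'] [Module K V'] (σ : K →+* K) (φ : V' →ₛₗ[σ] V) (W' : Submodule K V')
    (W : Submodule K V) (hφ : ∀ x ∈ W', φ x ∈ W) (hspan : Submodule.span K (Set.range φ) = ⊤)
    [Module.Finite K (V' ⧸ W')] :
    Module.finrank K (V ⧸ W) ≤ Module.finrank K (V' ⧸ W') := by
  let b := Module.finBasis K (V' ⧸ W')
  choose e he using fun i => W'.mkQ_surjective (b i)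
  have h : Submodule.span K (Set.range fun i => W.mkQ (φ (e i))) = ⊤ := by
    rw [eq_top_iff, ← Submodule.range_mkQ, LinearMap.range_eq_map, ← hspan, Submodule.map_span,
      Submodule.span_le]
    rintro _ ⟨_, ⟨x, rfl⟩, rfl⟩
    have hx : x - ∑ i, b.repr (W'.mkQ x) i • e i ∈ W' := by
      rw [← Submodule.Quotient.mk_eq_zero, ← Submodule.mkQ_apply, map_sub, map_sum]
      simp_rw [map_smul, he]
      rw [b.sum_repr, sub_self]
    have h1 := (Submodule.Quotient.mk_eq_zero W).mpr (hφ _ hx)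
    rw [← Submodule.mkQ_apply, map_sub, map_sub, sub_eq_zero, map_sum, map_sum] at h1
    rw [h1]
    refine sum_mem fun i _ => ?_
    rw [LinearMap.map_smulₛₗ, map_smul]
    exact Submodule.smul_mem _ _ (Submodule.subset_span ⟨i, rfl⟩)
  have h2 := finrank_range_le_card (R := K) (fun i => W.mkQ (φ (e i)))
  rw [Set.finrank, h, finrank_top, Fintype.card_fin] at h2
  exact h2

section Genus

variable {K F : Type*} [Field K] [Field F] [Algebra K F]

/-- The dimension of `H¹` computed by the pair of charts `A`, `B`. -/
noncomputable def chartGenus (A B : Subalgebra K F) : ℕ :=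
  Module.finrank K (F ⧸ (Subalgebra.toSubmodule A ⊔ Subalgebra.toSubmodule B))

theorem IsChartPair.finite {A B : Subalgebra K F} {t : F} (h : IsChartPair A B t) :
    Module.Finite K (F ⧸ (Subalgebra.toSubmodule A ⊔ Subalgebra.toSubmodule B)) := by
  have : shift B t⁻¹ 0 = Subalgebra.toSubmodule B := by ext x; simp
  exact this ▸ h.finite_quot 0

theorem exists_fg_sup_eq {V : Type*} [AddCommGroup V] [Module K V] {A I : Submodule K V}
    (hAI : A ≤ I) [Module.Finite K (I.map A.mkQ)] : ∃ W : Submodule K V, W.FG ∧ A ⊔ W = I := by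
  obtain ⟨C, hC⟩ := A.exists_isCompl
  refine ⟨C ⊓ I, ?_, by rw [← sup_inf_assoc_of_le C hAI, hC.sup_eq_top, top_inf_eq]⟩
  let f : ↥(C ⊓ I) →ₗ[K] I.map A.mkQ := (A.mkQ.domRestrict _).codRestrict _ fun x =>
    ⟨x, x.2.2, rfl⟩
  have hf : Function.Injective f := by
    rw [injective_iff_map_eq_zero]
    intro x hx
    have h1 : A.mkQ x = 0 := congrArg Subtype.val hx
    rw [Submodule.mkQ_apply, Submodule.Quotient.mk_eq_zero] at h1
    have h2 : (x : V) ∈ A ⊓ C := ⟨h1, x.2.1⟩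
    rw [hC.inf_eq_bot] at h2
    exact Subtype.ext h2
  exact Module.Finite.iff_fg.mp (Module.Finite.of_injective f hf)

/-- A stable subspace containing `A`, of finite codimension over `A`, as a finite `A`-module. -/
theorem exists_fg_submodule {A : Subalgebra K F} {I : Submodule K F}
    (hAI : Subalgebra.toSubmodule A ≤ I) (hI : ∀ a ∈ A, ∀ x ∈ I, a * x ∈ I)
    [Module.Finite K (I.map (Subalgebra.toSubmodule A).mkQ)] :
    ∃ Y : Submodule A F, Y.restrictScalars K = I ∧ 1 ≤ Y ∧ Y.FG := by
  let Y : Submodule A F :=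
    { I with smul_mem' := fun a x hx => hI a a.2 x hx }
  refine ⟨Y, rfl, ?_, ?_⟩
  · rw [Submodule.one_le]
    exact hAI A.one_mem
  · obtain ⟨W, ⟨S, hS⟩, hW⟩ := exists_fg_sup_eq hAI
    have h1 : Y = Submodule.span A {1} ⊔ Submodule.span A (S : Set F) := by
      refine le_antisymm ?_ (sup_le ?_ ?_)
      · intro x hx
        have hx' : x ∈ Subalgebra.toSubmodule A ⊔ W := hW ▸ hx
        obtain ⟨a, ha, w, hw, rfl⟩ := Submodule.mem_sup.mp hx'
        refine Submodule.add_mem_sup (Submodule.mem_span_singleton.mpr ⟨⟨a, ha⟩, mul_one a⟩) ?_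
        rw [← hS] at hw
        exact Submodule.span_le_restrictScalars K A _ hw
      · rw [Submodule.span_singleton_le_iff_mem]
        exact hAI A.one_mem
      · rw [Submodule.span_le]
        intro s hs
        have : s ∈ W := hS ▸ Submodule.subset_span hs
        exact hW.le (Submodule.mem_sup_right this)
    rw [h1]
    exact (Submodule.fg_span_singleton _).sup (Submodule.fg_span S.finite_toSet)

variable {L : Type*} [Field L] [Algebra F L] [FiniteDimensional F L]

/-- On generators `Tr(m y) = y Tr(m)`, and `Tr(m)` lies in `A` because `A` is integrally closed. -/
theorem trace_mem {A : Subalgebra K F} [IsDedekindDomain A] [IsFractionRing A F] {Y : Submodule A F}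
    {x : L} (hx : x ∈ extendIdeal L Y) : Algebra.trace F L x ∈ Y := by
  induction hx using Submodule.mul_induction_on' with
  | mem_mul_mem m hm n hn =>
    obtain ⟨y, hy, rfl⟩ := hn
    have h1 : m * algebraMap F L y = y • m := by rw [mul_comm, Algebra.smul_def]
    change Algebra.trace F L (m * algebraMap F L y) ∈ Y
    rw [h1, map_smul, smul_eq_mul, mul_comm]
    obtain ⟨a, ha⟩ := IsIntegrallyClosed.isIntegral_iff.mp
      (Algebra.isIntegral_trace (R := A) (L := F) (F := L) (x := m) hm)
    rw [← ha]
    exact Y.smul_mem a hy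
  | add x _ y _ hx hy => rw [map_add]; exact add_mem hx hy

variable [Algebra K L] [IsScalarTower K F L] [Algebra.IsSeparable F L]

theorem span_range_trace :
    Submodule.span K (Set.range ((Algebra.trace F L).restrictScalars K)) = ⊤ := by
  have : Set.range ((Algebra.trace F L).restrictScalars K) = Set.univ :=
    Set.range_eq_univ.mpr (Algebra.trace_surjective F L)
  rw [this, Submodule.span_univ]

variable (L) in
theorem IsChartPair.genus_le {A B : Subalgebra K F} {t : F} (h : IsChartPair A B t) :
    chartGenus A B ≤ chartGenus (CurveTower.intClosure A L) (CurveTower.intClosure B L) := by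
  have := h.dedekind_left
  have := h.dedekind_right
  have := h.fraction_left
  have := h.fraction_right
  have := (h.intClosure L).finite
  refine finrank_quotient_le_of_semilinear (RingHom.id K) ((Algebra.trace F L).restrictScalars K)
    _ _ (fun x hx => ?_) span_range_trace
  obtain ⟨a, ha, b, hb, rfl⟩ := Submodule.mem_sup.mp hx
  rw [map_add]
  have key : ∀ (C : Subalgebra K F) [IsDedekindDomain C] [IsFractionRing C F],
      ∀ x ∈ CurveTower.intClosure C L, Algebra.trace F L x ∈ C := by
    intro C _ _ x hx
    obtain ⟨a, ha⟩ := IsIntegrallyClosed.isIntegral_iff.mp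
      (Algebra.isIntegral_trace (R := C) (L := F) (F := L) (x := x) hx)
    rw [← ha]
    exact a.2
  exact Submodule.add_mem_sup (key A a ha) (key B b hb)

/-- Extend the canonical pair to `L` and use `ψ ∘ Tr` as functional. Then `2g' ≥ 1 + d' + h'` with
`d' ≥ 2d` and `h' ≥ h`, while `2g ≤ d + 1 + h` and `d ≥ 1`; combining, `2g' ≥ 2g + d`. -/
theorem IsChartPair.genus_lt {A B : Subalgebra K F} {t : F} (h : IsChartPair A B t)
    (hK : ∀ x : L, IsIntegral K x → ∃ c, algebraMap K L c = x) (hn : 2 ≤ Module.finrank F L)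
    (hg : 2 ≤ chartGenus A B) :
    chartGenus A B < chartGenus (CurveTower.intClosure A L) (CurveTower.intClosure B L) := by
  have := h.dedekind_left
  have := h.dedekind_right
  have := h.fraction_left
  have := h.fraction_right
  have h' := h.intClosure L
  have hfin' := h'.finite
  have hKF : ∀ x : F, IsIntegral K x → ∃ c, algebraMap K F c = x := by
    intro x hx
    obtain ⟨c, hc⟩ := hK _ (hx.map (IsScalarTower.toAlgHom K F L))
    refine ⟨c, (algebraMap F L).injective ?_⟩
    rw [← IsScalarTower.algebraMap_apply, hc]
    rfl
  have h01 := h'.finrank_inf hK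
  obtain ⟨I, J, ψ, hψ, hψI, hψJ, hAI, hBJ, hI, hJ, f1, f2, d1, d2⟩ :=
    exists_canonical h.inv_mem h.not_mem h.finite_quot (h.finrank_inf hKF) hg
  obtain ⟨Y, rfl, hY1, hYfg⟩ := exists_fg_submodule hAI hI
  obtain ⟨Z, rfl, hZ1, hZfg⟩ := exists_fg_submodule hBJ hJ
  set I' := (extendIdeal L Y).restrictScalars K with hI'
  set J' := (extendIdeal L Z).restrictScalars K with hJ'
  set A' := CurveTower.intClosure A L with hA'
  set B' := CurveTower.intClosure B L with hB'
  let ψ' : L →ₗ[K] K := ψ.comp ((Algebra.trace F L).restrictScalars K)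
  have hψ' : ψ' ≠ 0 := by
    intro h0
    apply hψ
    ext f
    obtain ⟨x, rfl⟩ := Algebra.trace_surjective F L f
    exact LinearMap.congr_fun h0 x
  have hle : ∀ (C : Subalgebra K F) (U : Submodule C F), 1 ≤ U →
      Subalgebra.toSubmodule (CurveTower.intClosure C L) ≤ (extendIdeal L U).restrictScalars K := by
    intro C U hU a ha
    have := mul_mem_extendIdeal L (mem_intClosure.mp ha) (hU (Submodule.one_le.mp le_rfl))
    rwa [map_one, mul_one] at this
  have hAI' := hle A Y hY1
  have hBJ' := hle B Z hZ1
  -- Elements of `I' ∩ J'` twist `ψ ∘ Tr` into functionals killing `A' + B'`, so there are at most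
  -- `g'` independent ones.
  obtain ⟨f3, d3⟩ := finrank_le_of_twist hψ' (I' ⊓ J')
    (Subalgebra.toSubmodule A' ⊔ Subalgebra.toSubmodule B') (by
      rintro s ⟨hs1, hs2⟩ p hp
      obtain ⟨a, ha, b, hb, rfl⟩ := Submodule.mem_sup.mp hp
      rw [mul_add, map_add, mul_comm s a, mul_comm s b]
      have e1 : ψ' (a * s) = 0 := hψI _ (trace_mem (mul_mem_extendIdeal' L ha hs1))
      have e2 : ψ' (b * s) = 0 := hψJ _ (trace_mem (mul_mem_extendIdeal' L hb hs2))
      rw [e1, e2, add_zero])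
  have e := euler_char (Subalgebra.toSubmodule A') (Subalgebra.toSubmodule B') I' J' hAI' hBJ'
  have f4 : Module.Finite K ↥(I' ⊓ Subalgebra.toSubmodule B') :=
    Submodule.finiteDimensional_of_le (inf_le_inf_left I' hBJ')
  have f5 : Module.Finite K ↥(J' ⊓ Subalgebra.toSubmodule A') :=
    Submodule.finiteDimensional_of_le (S₂ := I' ⊓ J')
      (by rw [inf_comm]; exact inf_le_inf_right J' hAI')
  have f6 := finite_map_mkQ_of_inf (Subalgebra.toSubmodule A') (Subalgebra.toSubmodule B') I' hAI'
  have f7 : Module.Finite K (J'.map (Subalgebra.toSubmodule B').mkQ) := by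
    have : Module.Finite K (L ⧸ (Subalgebra.toSubmodule B' ⊔ Subalgebra.toSubmodule A')) := by
      rwa [sup_comm]
    exact finite_map_mkQ_of_inf (Subalgebra.toSubmodule B') (Subalgebra.toSubmodule A') J' hBJ'
  have d4 : _ ≤ Module.finrank K (I'.map (Subalgebra.toSubmodule A').mkQ) :=
    two_mul_finrank_le (K := K) L hn _ Y hY1 hYfg f1 f6 rfl
  have d5 : _ ≤ Module.finrank K (J'.map (Subalgebra.toSubmodule B').mkQ) :=
    two_mul_finrank_le (K := K) L hn _ Z hZ1 hZfg f2 f7 rfl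
  have f8 : Module.Finite K (L ⧸ (I' ⊔ J')) :=
    Module.Finite.of_surjective (Submodule.factor (sup_le_sup hAI' hBJ'))
      (Submodule.factor_surjective _)
  have d6 : Module.finrank K (F ⧸ (Y.restrictScalars K ⊔ Z.restrictScalars K)) ≤
      Module.finrank K (L ⧸ (I' ⊔ J')) := by
    refine finrank_quotient_le_of_semilinear (RingHom.id K)
      ((Algebra.trace F L).restrictScalars K) _ _ (fun x hx => ?_) span_range_trace
    obtain ⟨a, ha, b, hb, rfl⟩ := Submodule.mem_sup.mp hx
    rw [map_add]
    exact Submodule.add_mem_sup (trace_mem (Y := Y) ha) (trace_mem (Y := Z) hb)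
  unfold chartGenus at hg ⊢
  omega

end Genus
end CurveTower

namespace CurveTower

/-! ### Centers of valuation rings on Dedekind domains -/

section Center

variable {F C : Type*} [Field F] [CommRing C] [Algebra C F]

/-- The center of a valuation ring on a subring. -/
def center (V : ValuationSubring F) (hC : ∀ c : C, algebraMap C F c ∈ V) : Ideal C :=
  (IsLocalRing.maximalIdeal V).comap ((algebraMap C F).codRestrict V.toSubring hC)

variable {V : ValuationSubring F} {hC : ∀ c : C, algebraMap C F c ∈ V}

instance : (center V hC).IsPrime := Ideal.comap_isPrime _ _

theorem inv_mem_of_notMem_center {c : C} (hc : c ∉ center V hC) : (algebraMap C F c)⁻¹ ∈ V := by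
  have h1 : IsUnit (⟨algebraMap C F c, hC c⟩ : V) := by
    by_contra h
    exact hc h
  obtain ⟨u, hu⟩ := h1
  have h2 : ((u⁻¹ : Vˣ) : V) * (⟨algebraMap C F c, hC c⟩ : V) = 1 := by
    rw [← hu, Units.inv_mul]
  have h3 : (((u⁻¹ : Vˣ) : V) : F) * algebraMap C F c = 1 := congrArg Subtype.val h2
  rw [← eq_inv_of_mul_eq_one_left h3]
  exact SetLike.coe_mem _

theorem inv_notMem_of_mem_center {c : C} (hc : c ∈ center V hC) (h0 : algebraMap C F c ≠ 0) :
    (algebraMap C F c)⁻¹ ∉ V := by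
  intro h
  have h1 : (⟨algebraMap C F c, hC c⟩ : V) ∈ IsLocalRing.maximalIdeal V := hc
  exact h1 (IsUnit.of_mul_eq_one ⟨_, h⟩ (Subtype.ext (mul_inv_cancel₀ h0)))

theorem div_mem_of_notMem_center {c d : C} (hd : d ∉ center V hC) :
    algebraMap C F c / algebraMap C F d ∈ V := by
  rw [div_eq_mul_inv]
  exact V.mul_mem _ _ (hC c) (inv_mem_of_notMem_center hd)

variable [IsDedekindDomain C] [IsFractionRing C F]

theorem center_ne_bot (hV : V ≠ ⊤) : center V hC ≠ ⊥ := by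
  intro h
  refine hV (eq_top_iff.mpr fun f _ => ?_)
  obtain ⟨a, b, hb, rfl⟩ := IsFractionRing.div_surjective (A := C) f
  refine div_mem_of_notMem_center (hC := hC) ?_
  rw [h, Ideal.mem_bot]
  exact nonZeroDivisors.ne_zero hb

/-- The localization of `C` at the center is a discrete valuation ring, so it contains `f` or `f⁻¹`;
in the second case a numerator in the center would have its inverse in `V`. Hence a place is
determined by its center. -/
theorem exists_div_of_mem (hV : V ≠ ⊤) {f : F} (hf : f ∈ V) :
    ∃ c d : C, d ∉ center V hC ∧ f = algebraMap C F c / algebraMap C F d := by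
  set P := center V hC with hP
  have hS : P.primeCompl ≤ nonZeroDivisors C := P.primeCompl_le_nonZeroDivisors
  let S := Localization.subalgebra.ofField F P.primeCompl hS
  have : IsLocalization.AtPrime S P := Localization.subalgebra.isLocalization_ofField _ _ _
  have := IsLocalization.AtPrime.isDiscreteValuationRing_of_dedekind_domain C
    (center_ne_bot (hC := hC) hV) S
  have hmem : ∀ x : S, ∃ c d : C, d ∉ P ∧ (x : F) = algebraMap C F c / algebraMap C F d := by
    rintro ⟨x, a, s, hs, rfl⟩
    exact ⟨a, s, hs, by rw [div_eq_mul_inv]⟩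
  rcases ValuationRing.isInteger_or_isInteger S f with ⟨x, hx⟩ | ⟨x, hx⟩
  · obtain ⟨c, d, hd, hcd⟩ := hmem x
    exact ⟨c, d, hd, hx ▸ hcd⟩
  · obtain ⟨c, d, hd, hcd⟩ := hmem x
    have hx' : f⁻¹ = algebraMap C F c / algebraMap C F d := hx ▸ hcd
    by_cases hc : c ∈ P
    · by_cases h0 : algebraMap C F c = 0
      · rw [h0, zero_div, inv_eq_zero] at hx'
        exact ⟨0, d, hd, by simp [hx']⟩
      · exfalso
        refine inv_notMem_of_mem_center hc h0 ?_
        have h1 : f = algebraMap C F d / algebraMap C F c := by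
          rw [← inv_inv f, hx', inv_div]
        have hd0 : algebraMap C F d ≠ 0 := by
          rw [Ne, FaithfulSMul.algebraMap_eq_zero_iff]
          rintro rfl
          exact hd (zero_mem _)
        have h2 : (algebraMap C F c)⁻¹ = f * (algebraMap C F d)⁻¹ := by
          rw [h1]; field_simp
        rw [h2]
        exact V.mul_mem _ _ hf (inv_mem_of_notMem_center hd)
    · exact ⟨d, c, hc, by rw [← inv_inv f, hx', inv_div]⟩

theorem eq_of_center_eq {V' : ValuationSubring F} {hC' : ∀ c : C, algebraMap C F c ∈ V'}
    (hV : V ≠ ⊤) (hV' : V' ≠ ⊤) (h : center V hC = center V' hC') : V = V' := by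
  ext f
  constructor
  · intro hf
    obtain ⟨c, d, hd, rfl⟩ := exists_div_of_mem (hC := hC) hV hf
    exact div_mem_of_notMem_center (hC := hC') (h ▸ hd)
  · intro hf
    obtain ⟨c, d, hd, rfl⟩ := exists_div_of_mem (hC := hC') hV' hf
    exact div_mem_of_notMem_center (hC := hC) (h ▸ hd)

/-- Write `r = a / b` and `(b) = P^k Q` with `P` the center and `P` not dividing `Q`. From `1 = p +
q` with `p ∈ P^k`, `q ∈ Q`, take `c = q r`: the factor `q` removes the poles of `r` away from `P`,
and `c - r = -p r` has no pole at `P`. -/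
theorem exists_approximation (V : ValuationSubring F) (hC : ∀ c : C, algebraMap C F c ∈ V)
    (hV : V ≠ ⊤) (r : F) : ∃ c : F, c - r ∈ V ∧
      ∀ V' : ValuationSubring F, (∀ c : C, algebraMap C F c ∈ V') → V' ≠ ⊤ → V' ≠ V → c ∈ V' := by
  obtain ⟨a, b, hb, rfl⟩ := IsFractionRing.div_surjective (A := C) r
  have hb0 : b ≠ 0 := nonZeroDivisors.ne_zero hb
  have hb0' : algebraMap C F b ≠ 0 := by rwa [Ne, FaithfulSMul.algebraMap_eq_zero_iff]
  set P := center V hC with hP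
  have hPb : P ≠ ⊥ := center_ne_bot hV
  have hPmax : P.IsMaximal := (inferInstance : P.IsPrime).isMaximal hPb
  obtain ⟨Q, hQ, hPQ⟩ := (FiniteMultiplicity.of_not_isUnit (a := P) (b := Ideal.span {b})
    (by rw [Ideal.isUnit_iff]; exact hPmax.ne_top)
    (by rwa [Ne, Ideal.zero_eq_bot, Ideal.span_singleton_eq_bot])).exists_eq_pow_mul_and_not_dvd
  set k := multiplicity P (Ideal.span {b})
  rw [Ideal.dvd_iff_le] at hPQ
  have hsup : P ^ k ⊔ Q = ⊤ := by
    have h1 : P ⊔ Q = ⊤ := by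
      refine hPmax.1.2 _ (lt_of_le_of_ne le_sup_left fun h => hPQ ?_)
      rw [h]; exact le_sup_right
    exact Ideal.pow_sup_eq_top h1
  obtain ⟨p, hp, q, hq, hpq⟩ := Submodule.mem_sup.mp
    (hsup ▸ Submodule.mem_top : (1 : C) ∈ P ^ k ⊔ Q)
  have key : ∀ x ∈ P ^ k, ∀ y ∈ Q, ∃ u, x * y = b * u := by
    intro x hx y hy
    have := hQ ▸ Ideal.mul_mem_mul hx hy
    obtain ⟨u, hu⟩ := Ideal.mem_span_singleton.mp this
    exact ⟨u, hu⟩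
  have hquot : ∀ x s u : C, algebraMap C F s ≠ 0 → x * s = b * u →
      algebraMap C F x * (algebraMap C F a / algebraMap C F b) =
        algebraMap C F (u * a) / algebraMap C F s := by
    intro x s u hs h
    have := congrArg (algebraMap C F) h
    rw [map_mul, map_mul] at this
    rw [map_mul]
    field_simp
    linear_combination (algebraMap C F a) * this
  have hne : ∀ {I : Ideal C} {s : C}, s ∉ I → algebraMap C F s ≠ 0 := by
    intro I s hs
    rw [Ne, FaithfulSMul.algebraMap_eq_zero_iff]
    rintro rfl
    exact hs (zero_mem _)
  refine ⟨algebraMap C F q * (algebraMap C F a / algebraMap C F b), ?_, ?_⟩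
  · obtain ⟨s, hsQ, hsP⟩ := SetLike.not_le_iff_exists.mp hPQ
    obtain ⟨u, hu⟩ := key p hp s hsQ
    have h1 : algebraMap C F q = 1 - algebraMap C F p := by
      rw [eq_sub_iff_add_eq, ← map_add, add_comm, hpq, map_one]
    have h2 := hquot p s u (hne hsP) hu
    have h3 : algebraMap C F q * (algebraMap C F a / algebraMap C F b) -
        algebraMap C F a / algebraMap C F b = -(algebraMap C F (u * a) / algebraMap C F s) := by
      rw [h1, ← h2]; ring
    rw [h3]
    exact V.neg_mem _ (div_mem_of_notMem_center hsP)
  · intro V' hC' hV' hVV'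
    have hPk : ¬ P ^ k ≤ center V' hC' := by
      intro h
      have h1 := (inferInstance : (center V' hC').IsPrime).le_of_pow_le h
      have h2 := hPmax.eq_of_le (inferInstance : (center V' hC').IsPrime).ne_top h1
      exact hVV' (eq_of_center_eq hV hV' h2).symm
    obtain ⟨s, hsP, hs⟩ := SetLike.not_le_iff_exists.mp hPk
    obtain ⟨u, hu⟩ := key s hsP q hq
    rw [hquot q s u (hne hs) (by rw [mul_comm, hu])]
    exact div_mem_of_notMem_center hs

/-- The center of such a place is one of the finitely many prime factors of `(b)`, and it determines
the place. -/
theorem finite_places {b : C} (hb : b ≠ 0) :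
    {V : ValuationSubring F | V ≠ ⊤ ∧ (∀ c : C, algebraMap C F c ∈ V) ∧
      (algebraMap C F b)⁻¹ ∉ V}.Finite := by
  have hfin := Ideal.finite_factors (R := C) (I := Ideal.span {b}) (by simpa using hb)
  let g : {V : ValuationSubring F | V ≠ ⊤ ∧ (∀ c : C, algebraMap C F c ∈ V) ∧
      (algebraMap C F b)⁻¹ ∉ V} → {v : IsDedekindDomain.HeightOneSpectrum C |
        v.asIdeal ∣ Ideal.span {b}} := fun V =>
    ⟨⟨center V.1 V.2.2.1, inferInstance, center_ne_bot V.2.1⟩, by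
      change center V.1 V.2.2.1 ∣ Ideal.span {b}
      rw [Ideal.dvd_iff_le, Ideal.span_singleton_le_iff_mem]
      by_contra h
      exact V.2.2.2 (inv_mem_of_notMem_center h)⟩
  have := hfin.to_subtype
  have hg : Function.Injective g := by
    intro V V' h
    have h1 : center V.1 V.2.2.1 = center V'.1 V'.2.2.1 :=
      congrArg (fun v => v.1.asIdeal) h
    exact Subtype.ext (eq_of_center_eq V.2.1 V'.2.1 h1)
  have := Finite.of_injective g hg
  exact Set.toFinite _

end Center

/-! ### Repartitions and charts -/

section Link

variable {K F ι : Type u} [Field K] [Field F] [Algebra K F]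

/-- The family `O` enumerates the places of `F / K`, without repetition. -/
structure IsPlaceFamily (O : ι → Subalgebra K F) : Prop where
  exists_valuationSubring : ∀ x, ∃ V : ValuationSubring F, V ≠ ⊤ ∧ ∀ f, f ∈ V ↔ f ∈ O x
  injective : Function.Injective O
  exists_eq : ∀ V : ValuationSubring F, V ≠ ⊤ → (∀ c : K, algebraMap K F c ∈ V) →
    ∃ x, ∀ f, f ∈ V ↔ f ∈ O x

theorem exists_valuationSubring_notMem {C : Subalgebra K F} [IsDedekindDomain C]
    [IsFractionRing C F] {f : F} (hf : f ∉ C) :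
    ∃ V : ValuationSubring F, (∀ c ∈ C, c ∈ V) ∧ f ∉ V := by
  have : IsIntegrallyClosedIn C.toSubring F :=
    (isIntegrallyClosed_iff_isIntegrallyClosedIn (R := C) F).mp inferInstance
  obtain ⟨V, hV, hfV⟩ := Subring.exists_le_valuationSubring_of_isIntegrallyClosedIn
    (R := C.toSubring) (x := f) hf
  exact ⟨V, hV, hfV⟩

variable {O : ι → Subalgebra K F}

theorem sub_sum_single_mem [DecidableEq ι] {r : ι → F} (hr : {x | r x ∉ O x}.Finite) :
    r - ∑ x ∈ hr.toFinset, Pi.single x (r x) ∈ regularRepartitions O := by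
  rw [regularRepartitions, Submodule.mem_pi]
  intro y _
  rw [Pi.sub_apply, Finset.sum_apply]
  by_cases hy : y ∈ hr.toFinset
  · rw [Finset.sum_eq_single_of_mem y hy fun x _ hxy => Pi.single_eq_of_ne' hxy _,
      Pi.single_eq_same, sub_self]
    exact zero_mem _
  · rw [Finset.sum_eq_zero fun x hx => Pi.single_eq_of_ne (by rintro rfl; exact hy hx) _, sub_zero]
    simpa using hy

open Classical in
/-- The repartition equal to `f` at the poles of `t`, and to `0` elsewhere. -/
noncomputable def polarRepartition (O : ι → Subalgebra K F) (t : F) : F →ₗ[K] ι → F :=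
  LinearMap.pi fun x => if t ∈ O x then 0 else LinearMap.id

/-- The map sending `f` to the repartition `f` at the poles of `t` and `0` elsewhere induces an
isomorphism from `F / (A + B)`. The right-hand side depends on the charts and the left does not, so
any two chart pairs give the same number. -/
theorem IsPlaceFamily.finrank_eq (hO : IsPlaceFamily O) {A B : Subalgebra K F} {t : F}
    (h : IsChartPair A B t) : Module.finrank K (RepartitionQuotient O) = chartGenus A B := by
  classical
  have := h.dedekind_left
  have := h.dedekind_right
  have := h.fraction_left
  have := h.fraction_right
  choose V hVtop hV using hO.exists_valuationSubring
  have hVK : ∀ x, ∀ c : K, algebraMap K F c ∈ V x := fun x c =>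
    (hV x _).mpr ((O x).algebraMap_mem c)
  have hVinj : Function.Injective V := fun x y hxy => hO.injective (by
    ext f; rw [← hV, ← hV, hxy])
  set ρ := polarRepartition O t with hρ
  have hρ1 : ∀ f x, t ∈ O x → ρ f x = 0 := fun f x hx => by
    simp [hρ, polarRepartition, hx]
  have hρ2 : ∀ f x, t ∉ O x → ρ f x = f := fun f x hx => by
    simp [hρ, polarRepartition, hx]
  have hAx : ∀ x, t ∈ O x → ∀ a : A, algebraMap A F a ∈ V x := fun x hx a =>
    h.left_le _ (hVK x) ((hV x t).mpr hx) a a.2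
  have hBx : ∀ x, t ∉ O x → ∀ b : B, algebraMap B F b ∈ V x := fun x hx b =>
    h.right_le _ (hVK x) (fun h => hx ((hV x t).mp h)) b b.2
  have hfin : {x | t ∉ O x}.Finite := by
    have h1 := finite_places (F := F) (C := B) (b := ⟨t⁻¹, h.inv_mem⟩)
      (fun h0 => inv_ne_zero h.ne_zero (congrArg Subtype.val h0))
    refine Set.Finite.of_finite_image (h1.subset ?_) hVinj.injOn
    rintro _ ⟨x, hx, rfl⟩
    refine ⟨hVtop x, hBx x hx, fun hinv => hx ?_⟩
    have h2 : (t⁻¹)⁻¹ ∈ V x := hinv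
    rw [inv_inv] at h2
    exact (hV x t).mp h2
  have hρmem : ∀ f, ρ f ∈ repartitions O := fun f =>
    hfin.subset fun x hx h1 => hx (by rw [hρ1 f x h1]; exact zero_mem _)
  set N := regularRepartitions O ⊔ principalRepartitions K F ι with hN
  have hreg : ∀ r : ι → F, r ∈ regularRepartitions O ↔ ∀ x, r x ∈ O x := fun r => by
    simp [regularRepartitions, Submodule.mem_pi]
  -- If `ρ f = s + c` with `s` regular and `c` constant, then `c` is regular where `t` is, so `c ∈
  -- A`, and `f - c` is regular at the poles of `t`, so `f - c ∈ B`. A Dedekind chart is the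
  -- intersection of the valuation rings containing it.
  have hker : ∀ f, ρ f ∈ N ↔ f ∈ Subalgebra.toSubmodule A ⊔ Subalgebra.toSubmodule B := by
    intro f
    constructor
    · intro hf
      obtain ⟨s, hs, _, ⟨c, rfl⟩, hsc⟩ := Submodule.mem_sup.mp hf
      rw [hreg] at hs
      have hsc' : ∀ x, s x + c = ρ f x := fun x => congrFun hsc x
      have hcA : c ∈ A := by
        by_contra hc
        obtain ⟨W, hW, hcW⟩ := exists_valuationSubring_notMem hc
        obtain ⟨x, hx⟩ := hO.exists_eq W (by rintro rfl; exact hcW trivial)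
          (fun k => hW _ (A.algebraMap_mem k))
        have h1 := hsc' x
        rw [hρ1 f x ((hx t).mp (hW t h.mem)), add_eq_zero_iff_eq_neg'] at h1
        exact hcW ((hx c).mpr (h1 ▸ neg_mem (hs x)))
      have hcB : f - c ∈ B := by
        by_contra hc
        obtain ⟨W, hW, hcW⟩ := exists_valuationSubring_notMem hc
        have hWt : W ≠ ⊤ := by rintro rfl; exact hcW trivial
        obtain ⟨x, hx⟩ := hO.exists_eq W hWt (fun k => hW _ (B.algebraMap_mem k))
        have h1 := hsc' x
        rw [hρ2 f x fun ht => hWt (h.eq_top W ((hx t).mpr ht) hW)] at h1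
        refine hcW ((hx _).mpr ?_)
        rw [← h1, add_sub_cancel_right]
        exact hs x
      exact Submodule.mem_sup.mpr ⟨c, hcA, f - c, hcB, by ring⟩
    · intro hf
      obtain ⟨a, ha, b, hb, rfl⟩ := Submodule.mem_sup.mp hf
      rw [map_add]
      refine add_mem ?_ (Submodule.mem_sup_left ((hreg _).mpr fun x => ?_))
      · have h1 : ρ a = (ρ a - fun _ => a) + fun _ => a := by rw [sub_add_cancel]
        rw [h1]
        refine Submodule.add_mem_sup ((hreg _).mpr fun x => ?_) ⟨a, rfl⟩
        rw [Pi.sub_apply]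
        by_cases hx : t ∈ O x
        · rw [hρ1 a x hx, zero_sub]
          exact neg_mem ((hV x a).mp (hAx x hx ⟨a, ha⟩))
        · rw [hρ2 a x hx, sub_self]
          exact zero_mem _
      · by_cases hx : t ∈ O x
        · rw [hρ1 b x hx]; exact zero_mem _
        · rw [hρ2 b x hx]
          exact (hV x b).mp (hBx x hx ⟨b, hb⟩)
  -- Approximate `v` at `x` by some `c` without other poles on the chart containing `x`. On the
  -- chart `A` the family is congruent to `ρ (-c)` after subtracting the constant `c`; on the chart
  -- `B` it is congruent to `ρ c`.
  have hsingle : ∀ x v, (Pi.single x v : ι → F) ∈ LinearMap.range ρ ⊔ N := by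
    intro x v
    by_cases hx : t ∈ O x
    · obtain ⟨c, hc, hc'⟩ := exists_approximation (C := A) (V x) (hAx x hx) (hVtop x) v
      have h1 : (Pi.single x v : ι → F) = ρ (-c) +
          ((Pi.single x v + ρ c - fun _ => c) + fun _ => c) := by
        rw [map_neg]; abel
      rw [h1]
      refine Submodule.add_mem_sup ⟨_, rfl⟩ (Submodule.add_mem_sup ((hreg _).mpr fun y => ?_)
        ⟨c, rfl⟩)
      rw [Pi.sub_apply, Pi.add_apply]
      by_cases hxy : y = x
      · subst hxy
        rw [Pi.single_eq_same, hρ1 c y hx, add_zero, ← neg_sub]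
        exact neg_mem ((hV y _).mp hc)
      · rw [Pi.single_eq_of_ne hxy, zero_add]
        by_cases hy : t ∈ O y
        · rw [hρ1 c y hy, zero_sub]
          exact neg_mem ((hV y c).mp (hc' _ (hAx y hy) (hVtop y) (hVinj.ne hxy)))
        · rw [hρ2 c y hy, sub_self]
          exact zero_mem _
    · obtain ⟨c, hc, hc'⟩ := exists_approximation (C := B) (V x) (hBx x hx) (hVtop x) v
      have h1 : (Pi.single x v : ι → F) = ρ c + (Pi.single x v - ρ c) := by abel
      rw [h1]
      refine Submodule.add_mem_sup ⟨_, rfl⟩ (Submodule.mem_sup_left ((hreg _).mpr fun y => ?_))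
      rw [Pi.sub_apply]
      by_cases hxy : y = x
      · subst hxy
        rw [Pi.single_eq_same, hρ2 c y hx, ← neg_sub]
        exact neg_mem ((hV y _).mp hc)
      · rw [Pi.single_eq_of_ne hxy, zero_sub]
        by_cases hy : t ∈ O y
        · rw [hρ1 c y hy, neg_zero]
          exact zero_mem _
        · rw [hρ2 c y hy]
          exact neg_mem ((hV y c).mp (hc' _ (hBx y hy) (hVtop y) (hVinj.ne hxy)))
  have hall : ∀ r ∈ repartitions O, r ∈ LinearMap.range ρ ⊔ N := by
    intro r hr
    have h1 : r = (r - ∑ x ∈ Set.Finite.toFinset hr, Pi.single x (r x)) +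
        ∑ x ∈ Set.Finite.toFinset hr, Pi.single x (r x) := by rw [sub_add_cancel]
    rw [h1]
    exact add_mem (Submodule.mem_sup_right (Submodule.mem_sup_left (sub_sum_single_mem hr)))
      (sum_mem fun x _ => hsingle x (r x))
  let θ : F →ₗ[K] RepartitionQuotient O :=
    (N.comap (repartitions O).subtype).mkQ ∘ₗ ρ.codRestrict (repartitions O) hρmem
  have hθker : LinearMap.ker θ = Subalgebra.toSubmodule A ⊔ Subalgebra.toSubmodule B := by
    ext f
    rw [← hker]
    exact Submodule.Quotient.mk_eq_zero _
  have hθsurj : Function.Surjective θ := by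
    intro z
    obtain ⟨⟨r, hr⟩, rfl⟩ := Submodule.mkQ_surjective _ z
    obtain ⟨_, ⟨f, rfl⟩, n, hn, hfn⟩ := Submodule.mem_sup.mp (hall r hr)
    refine ⟨f, (Submodule.Quotient.eq _).mpr ?_⟩
    change ρ f - r ∈ N
    rw [← hfn, sub_add_cancel_left]
    exact neg_mem hn
  rw [chartGenus, ← hθker]
  exact (θ.quotKerEquivOfSurjective hθsurj).finrank_eq.symm

end Link
end CurveTower

namespace CurveTower

/-! ### Semilinear maps of function fields -/

section Semilinear

variable {K : Type*} [Field K]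

theorem le_comap_mapRingHom (σ : K →+* K) : nonZeroDivisors (Polynomial K) ≤
    Submonoid.comap (Polynomial.mapRingHom σ) (nonZeroDivisors (Polynomial K)) :=
  nonZeroDivisors_le_comap_nonZeroDivisors_of_injective _ (Polynomial.map_injective σ σ.injective)

/-- The endomorphism of `K(X)` induced by an endomorphism of `K`. -/
noncomputable def ratFuncMap (σ : K →+* K) : RatFunc K →+* RatFunc K :=
  RatFunc.mapRingHom (Polynomial.mapRingHom σ) (le_comap_mapRingHom σ)

theorem ratFuncMap_div (σ : K →+* K) (p q : Polynomial K) :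
    ratFuncMap σ (algebraMap _ _ p / algebraMap _ _ q) =
      algebraMap _ _ (p.map σ) / algebraMap _ _ (q.map σ) :=
  RatFunc.map_apply_div (Polynomial.mapRingHom σ) (le_comap_mapRingHom σ) p q

theorem ratFuncMap_algebraMap (σ : K →+* K) (p : Polynomial K) :
    ratFuncMap σ (algebraMap _ _ p) = algebraMap _ _ (p.map σ) := by
  have := ratFuncMap_div σ p 1
  simpa using this

theorem ratFuncMap_mem_polynomialChart (σ : K →+* K) {f : RatFunc K} (hf : f ∈ polynomialChart K) :
    ratFuncMap σ f ∈ polynomialChart K := by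
  obtain ⟨p, rfl⟩ := hf
  exact ⟨p.map σ, (ratFuncMap_algebraMap σ p).symm⟩

theorem ratFuncMap_mem_inftyChart (σ : K →+* K) {f : RatFunc K} (hf : f ∈ inftyChart K) :
    ratFuncMap σ f ∈ inftyChart K := by
  rw [mem_inftyChart] at hf ⊢
  by_cases h0 : f = 0
  · simp [h0]
  have hn : algebraMap (Polynomial K) (RatFunc K) (f.num.map σ) ≠ 0 :=
    RatFunc.algebraMap_ne_zero ((Polynomial.map_ne_zero_iff σ.injective).mpr
      (RatFunc.num_ne_zero h0))
  have hd : algebraMap (Polynomial K) (RatFunc K) (f.denom.map σ) ≠ 0 :=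
    RatFunc.algebraMap_ne_zero ((Polynomial.map_ne_zero_iff σ.injective).mpr f.denom_ne_zero)
  have h1 : ratFuncMap σ f = algebraMap _ _ (f.num.map σ) / algebraMap _ _ (f.denom.map σ) := by
    rw [← ratFuncMap_div, RatFunc.num_div_denom]
  rw [h1, RatFunc.intDegree_div hn hd, RatFunc.intDegree_polynomial, RatFunc.intDegree_polynomial,
    Polynomial.natDegree_map, Polynomial.natDegree_map]
  exact hf

variable (K) in
/-- The genus of a function field, computed by the charts attached to a map to the projective line. -/
noncomputable def ratGenus (L : Type*) [Field L] [Algebra K L] [Algebra (RatFunc K) L]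
    [IsScalarTower K (RatFunc K) L] : ℕ :=
  chartGenus (intClosure (polynomialChart K) L) (intClosure (inftyChart K) L)

variable {L : Type*} [Field L] [Algebra K L]

theorem isChartPair_of_ratFunc [Algebra (RatFunc K) L] [IsScalarTower K (RatFunc K) L]
    [FiniteDimensional (RatFunc K) L] [Algebra.IsSeparable (RatFunc K) L] :
    IsChartPair (intClosure (polynomialChart K) L) (intClosure (inftyChart K) L)
      (algebraMap (RatFunc K) L RatFunc.X) :=
  (isChartPair_ratFunc K).intClosure L

/-- The embedding of `K(X)` given by a transcendental element. -/
noncomputable def ratFuncEmbedding {t : L} (ht : Transcendental K t) : RatFunc K →ₐ[K] L :=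
  IsFractionRing.liftAlgHom (g := Polynomial.aeval t) (transcendental_iff_injective.mp ht)

theorem ratFuncEmbedding_algebraMap {t : L} (ht : Transcendental K t) (p : Polynomial K) :
    ratFuncEmbedding ht (algebraMap _ _ p) = Polynomial.aeval t p := by
  rw [ratFuncEmbedding, IsFractionRing.liftAlgHom_apply]
  exact IsFractionRing.lift_algebraMap _ p

/-- A function field spanned by the image of another one under a semilinear embedding. -/
theorem exists_ratGenus_le [Algebra (RatFunc K) L] [IsScalarTower K (RatFunc K) L]
    [FiniteDimensional (RatFunc K) L] [Algebra.IsSeparable (RatFunc K) L]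
    {M : Type*} [Field M] [Algebra K M] (σ : K →+* K) (Φ : L →+* M)
    (hΦ : ∀ c, Φ (algebraMap K L c) = algebraMap K M (σ c))
    (hspan : Submodule.span K (Set.range Φ) = ⊤)
    (ht : Transcendental K (Φ (algebraMap (RatFunc K) L RatFunc.X))) :
    ∃ (_ : Algebra (RatFunc K) M) (_ : IsScalarTower K (RatFunc K) M),
      FiniteDimensional (RatFunc K) M ∧ Algebra.IsSeparable (RatFunc K) M ∧
      ratGenus K M ≤ ratGenus K L := by
  -- `M` is made an extension of `K(X)` through `X ↦ Φ X`, so that `Φ` lies over the map of `K(X)`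
  -- applying `σ` to coefficients and fixing `X`. That map preserves both charts of the line.
  let _ : Algebra (RatFunc K) M := (ratFuncEmbedding ht).toRingHom.toAlgebra
  have htower : IsScalarTower K (RatFunc K) M :=
    IsScalarTower.of_algebraMap_eq fun c => ((ratFuncEmbedding ht).commutes c).symm
  have hcomm : (algebraMap (RatFunc K) M).comp (ratFuncMap σ) =
      Φ.comp (algebraMap (RatFunc K) L) := by
    refine IsFractionRing.ringHom_ext (A := Polynomial K) fun p => ?_
    rw [RingHom.comp_apply, RingHom.comp_apply, ratFuncMap_algebraMap]
    change ratFuncEmbedding ht (algebraMap _ _ (p.map σ)) = _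
    rw [ratFuncEmbedding_algebraMap]
    induction p using Polynomial.induction_on' with
    | add p q hp hq => rw [Polynomial.map_add, map_add, hp, hq, map_add, map_add, map_add]
    | monomial n c =>
      rw [← Polynomial.C_mul_X_pow_eq_monomial]
      simp only [Polynomial.map_mul, Polynomial.map_C, Polynomial.map_pow, Polynomial.map_X,
        map_mul, map_pow, Polynomial.aeval_C, Polynomial.aeval_X, RatFunc.algebraMap_X, ← hΦ]
      congr 2
      rw [RatFunc.algebraMap_C, ← RatFunc.algebraMap_eq_C, ← IsScalarTower.algebraMap_apply]
  have hcomm' : ∀ r, Φ (algebraMap (RatFunc K) L r) = algebraMap (RatFunc K) M (ratFuncMap σ r) :=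
    fun r => (RingHom.congr_fun hcomm r).symm
  have hfin : FiniteDimensional (RatFunc K) M := by
    let b := Module.finBasis (RatFunc K) L
    have htop : Submodule.span (RatFunc K) (Set.range fun i => Φ (b i)) = ⊤ → 
        FiniteDimensional (RatFunc K) M := fun h =>
      Module.finite_def.mpr (h ▸ Submodule.fg_span (Set.finite_range _))
    refine htop (eq_top_iff.mpr fun m _ => ?_)
    have hm : m ∈ Submodule.span K (Set.range Φ) := hspan ▸ Submodule.mem_top
    have hle : Submodule.span K (Set.range Φ) ≤
        (Submodule.span (RatFunc K) (Set.range fun i => Φ (b i))).restrictScalars K := by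
      rw [Submodule.span_le]
      rintro _ ⟨x, rfl⟩
      rw [← b.sum_repr x, map_sum]
      refine sum_mem fun i _ => ?_
      rw [Algebra.smul_def, map_mul, hcomm', ← Algebra.smul_def]
      exact Submodule.smul_mem (Submodule.span (RatFunc K) (Set.range fun i => Φ (b i))) _
        (Submodule.subset_span (Set.mem_range_self i))
    exact hle hm
  have hsep : Algebra.IsSeparable (RatFunc K) M := by
    have h1 : ∀ m : M, m ∈ separableClosure (RatFunc K) M := by
      intro m
      have hm : m ∈ Submodule.span K (Set.range Φ) := hspan ▸ Submodule.mem_top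
      induction hm using Submodule.span_induction with
      | mem m hm =>
        obtain ⟨x, rfl⟩ := hm
        rw [mem_separableClosure_iff]
        have hx : (minpoly (RatFunc K) x).Separable := Algebra.IsSeparable.isSeparable (RatFunc K) x
        -- `Φ x` is a root of the separable minimal polynomial of `x` with `σ` applied to its
        -- coefficients.
        refine (hx.map (f := ratFuncMap σ)).of_dvd (minpoly.dvd _ _ ?_)
        rw [Polynomial.aeval_def, Polynomial.eval₂_map, hcomm, ← Polynomial.hom_eval₂,
          ← Polynomial.aeval_def, minpoly.aeval, map_zero]
      | zero => exact zero_mem _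
      | add x y _ _ hx hy => exact add_mem hx hy
      | smul c x _ hx =>
        rw [Algebra.smul_def, IsScalarTower.algebraMap_apply K (RatFunc K) M]
        exact mul_mem (IntermediateField.algebraMap_mem _ _) hx
    exact ⟨fun m => mem_separableClosure_iff.mp (h1 m)⟩
  refine ⟨inferInstance, htower, hfin, hsep, ?_⟩
  have hmap : ∀ C : Subalgebra K (RatFunc K), (∀ f ∈ C, ratFuncMap σ f ∈ C) →
      ∀ x ∈ intClosure C L, Φ x ∈ intClosure C M := by
    intro C hC x hx
    let g : C →+* C := ((ratFuncMap σ).comp (algebraMap C (RatFunc K))).codRestrict C.toSubring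
      fun c => hC c c.2
    exact IsIntegral.map_of_comp_eq g Φ (RingHom.ext fun c => (hcomm' c).symm) hx
  have := (isChartPair_of_ratFunc (K := K) (L := L)).finite
  let φ : L →ₛₗ[σ] M :=
    { Φ.toAddMonoidHom with
      map_smul' := fun c x => by
        change Φ (c • x) = σ c • Φ x
        rw [Algebra.smul_def, map_mul, hΦ, ← Algebra.smul_def] }
  refine finrank_quotient_le_of_semilinear σ φ _ _ (fun x hx => ?_) hspan
  obtain ⟨a, ha, b, hb, rfl⟩ := Submodule.mem_sup.mp hx
  rw [map_add]
  exact Submodule.add_mem_sup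
    (hmap _ (fun f hf => ratFuncMap_mem_polynomialChart σ hf) a ha)
    (hmap _ (fun f hf => ratFuncMap_mem_inftyChart σ hf) b hb)

end Semilinear
end CurveTower

namespace CurveTower

/-! ### Purely inseparable extensions of function fields -/

section Insep

variable {K L : Type*} [Field K] [Field L] [Algebra K L]

theorem transcendental_algebraMap_X [Algebra (RatFunc K) L] [IsScalarTower K (RatFunc K) L] :
    Transcendental K (algebraMap (RatFunc K) L RatFunc.X) := by
  rw [transcendental_algebraMap_iff (algebraMap (RatFunc K) L).injective]
  exact RatFunc.transcendental_X

variable (K L) in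
/-- The subfield `K · L ^ q`. -/
noncomputable def powSpan (q : ℕ) : IntermediateField K L :=
  (Algebra.adjoin K (Set.range fun x : L => x ^ q)).toIntermediateField fun x hx => by
    rcases Nat.eq_zero_or_pos q with rfl | hq
    · have h1 : Set.range (fun x : L => x ^ 0) = {1} := by
        ext y; simp
      rw [h1, Algebra.adjoin_singleton_one] at hx ⊢
      obtain ⟨c, rfl⟩ := Algebra.mem_bot.mp hx
      exact Algebra.mem_bot.mpr ⟨c⁻¹, map_inv₀ _ _⟩
    by_cases h0 : x = 0
    · simp [h0]
    have h1 : x⁻¹ = x ^ (q - 1) * x⁻¹ ^ q := by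
      obtain ⟨k, rfl⟩ := Nat.exists_eq_add_of_le' hq
      rw [Nat.add_sub_cancel, pow_succ, ← mul_assoc, ← mul_pow, mul_inv_cancel₀ h0, one_pow,
        one_mul]
    rw [h1]
    exact mul_mem (pow_mem hx _) (Algebra.subset_adjoin ⟨_, rfl⟩)

theorem pow_mem_powSpan (q : ℕ) (x : L) : x ^ q ∈ powSpan K L q :=
  Algebra.subset_adjoin (R := K) ⟨x, rfl⟩

theorem mem_powSpan {q : ℕ} {x : L} :
    x ∈ powSpan K L q ↔ x ∈ Submodule.span K (Set.range fun x : L => x ^ q) := by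
  have h1 : ((Submonoid.closure (Set.range fun x : L => x ^ q) : Submonoid L) : Set L) =
      Set.range fun x : L => x ^ q := by
    have : Set.range (fun x : L => x ^ q) = (MonoidHom.mrange (powMonoidHom q : L →* L) : Set L) :=
      rfl
    rw [this, Submonoid.closure_eq]
  rw [← h1, ← Algebra.adjoin_eq_span]
  rfl

/-- Over `K · L^q (t)`, with `t` the image of `X`, the field `L` is separable since `K(t)` is
contained in it, and purely inseparable since it contains `L^q`. So `L = K · L^q (t)`, and `t` is a
root of a polynomial of degree `q`. -/
theorem finrank_powSpan_le [Algebra (RatFunc K) L] [IsScalarTower K (RatFunc K) L]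
    [Algebra.IsSeparable (RatFunc K) L] (p n : ℕ) [ExpChar K p] :
    FiniteDimensional (powSpan K L (p ^ n)) L ∧
      Module.finrank (powSpan K L (p ^ n)) L ≤ p ^ n := by
  set S := powSpan K L (p ^ n) with hS
  set t := algebraMap (RatFunc K) L RatFunc.X with ht
  let E := IntermediateField.adjoin S {t}
  have htE : t ∈ E := IntermediateField.mem_adjoin_simple_self S t
  have hpos : 0 < p ^ n := pow_pos (expChar_pos K p) n
  have hmem : ∀ r : RatFunc K, algebraMap (RatFunc K) L r ∈ E := by
    have h1 : ∀ f : Polynomial K, algebraMap (RatFunc K) L (algebraMap _ _ f) ∈ E := by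
      intro f
      induction f using Polynomial.induction_on' with
      | add f g hf hg => rw [map_add, map_add]; exact add_mem hf hg
      | monomial n c =>
        rw [← Polynomial.C_mul_X_pow_eq_monomial, map_mul, map_pow, RatFunc.algebraMap_X,
          RatFunc.algebraMap_C, ← RatFunc.algebraMap_eq_C, map_mul, map_pow,
          ← IsScalarTower.algebraMap_apply]
        exact mul_mem (E.algebraMap_mem (algebraMap K S c)) (pow_mem htE n)
    intro r
    rw [← RatFunc.num_div_denom r, map_div₀]
    exact div_mem (h1 _) (h1 _)
  let _ : Algebra (RatFunc K) E :=
    ((algebraMap (RatFunc K) L).codRestrict E.toSubring hmem).toAlgebra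
  have : IsScalarTower (RatFunc K) E L := IsScalarTower.of_algebraMap_eq fun r => rfl
  have hsep : Algebra.IsSeparable E L := Algebra.isSeparable_tower_top_of_isSeparable (RatFunc K) E L
  have : ExpChar S p := expChar_of_injective_algebraMap (algebraMap K S).injective p
  have : ExpChar E p := expChar_of_injective_algebraMap (algebraMap S E).injective p
  have hinsep : IsPurelyInseparable E L := by
    rw [isPurelyInseparable_iff_pow_mem E p]
    exact fun x => ⟨n, ⟨⟨x ^ p ^ n, E.algebraMap_mem ⟨_, pow_mem_powSpan _ x⟩⟩, rfl⟩⟩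
  have hEtop : E = ⊤ := by
    rw [eq_top_iff]
    intro x _
    obtain ⟨y, rfl⟩ := IsPurelyInseparable.surjective_algebraMap_of_isSeparable E L x
    exact y.2
  let f : Polynomial S := Polynomial.X ^ (p ^ n) - Polynomial.C ⟨t ^ p ^ n, pow_mem_powSpan _ t⟩
  have hf : f.Monic := Polynomial.monic_X_pow_sub_C _ hpos.ne'
  have hft : Polynomial.aeval t f = 0 := by
    simp only [f, map_sub, map_pow, Polynomial.aeval_X, Polynomial.aeval_C]
    exact sub_self _
  have hint : IsIntegral S t := ⟨f, hf, hft⟩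
  have hEfin : FiniteDimensional S E := IntermediateField.adjoin.finiteDimensional hint
  have hd : Module.finrank S E ≤ p ^ n := by
    rw [IntermediateField.adjoin.finrank hint]
    refine (Polynomial.natDegree_le_of_dvd (minpoly.dvd S t hft) hf.ne_zero).trans ?_
    rw [Polynomial.natDegree_X_pow_sub_C]
  rw [hEtop] at hEfin hd
  have e : (⊤ : IntermediateField S L) ≃ₗ[S] L := IntermediateField.topEquiv.toLinearEquiv
  exact ⟨Module.Finite.equiv e, e.finrank_eq ▸ hd⟩

/-- A purely inseparable extension `L / M` of degree `q` of function fields satisfies `M = K · L ^ q`. -/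
theorem exists_frobenius [Algebra (RatFunc K) L] [IsScalarTower K (RatFunc K) L]
    [Algebra.IsSeparable (RatFunc K) L] (p : ℕ) [ExpChar K p]
    (M : Type*) [Field M] [Algebra K M] [Algebra M L] [IsScalarTower K M L]
    [FiniteDimensional M L] [IsPurelyInseparable M L] :
    ∃ (n : ℕ) (Φ : L →+* M), (∀ x, algebraMap M L (Φ x) = x ^ p ^ n) ∧
      Submodule.span K (Set.range Φ) = ⊤ := by
  have : ExpChar M p := expChar_of_injective_algebraMap (algebraMap K M).injective p
  have : ExpChar L p := expChar_of_injective_algebraMap (algebraMap K L).injective p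
  obtain ⟨n, hn⟩ := IsPurelyInseparable.finrank_eq_pow M L p
  have hpow : ∀ x : L, x ^ p ^ n ∈ (algebraMap M L).range := by
    intro x
    have h1 := minpoly.natDegree_le (A := M) x
    rw [IsPurelyInseparable.minpoly_natDegree_eq' M p x, hn] at h1
    have h2 : p ^ IsPurelyInseparable.elemExponent M x ∣ p ^ n := by
      -- In exponential characteristic one both powers are `1`; otherwise exponents can be compared.
      rcases (Nat.eq_or_lt_of_le (expChar_pos K p)) with h | h
      · rw [← h]; simp
      · exact pow_dvd_pow p ((Nat.pow_le_pow_iff_right h).mp h1)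
    obtain ⟨k, hk⟩ := h2
    rw [hk, pow_mul]
    exact pow_mem (IsPurelyInseparable.elemExponent_def' M p x) k
  let e := RingEquiv.ofBijective (algebraMap M L).rangeRestrict
    ⟨fun a b h => (algebraMap M L).injective (congrArg Subtype.val h),
      (algebraMap M L).rangeRestrict_surjective⟩
  let Φ : L →+* M := (e.symm : _ →+* M).comp
    ((iterateFrobenius L p n).codRestrict (algebraMap M L).range hpow)
  have hΦ : ∀ x, algebraMap M L (Φ x) = x ^ p ^ n := fun x =>
    congrArg Subtype.val (e.apply_symm_apply ⟨x ^ p ^ n, hpow x⟩)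
  refine ⟨n, Φ, hΦ, ?_⟩
  let M' : IntermediateField K L := (IsScalarTower.toAlgHom K M L).fieldRange
  have hle : powSpan K L (p ^ n) ≤ M' := by
    intro x hx
    rw [mem_powSpan] at hx
    have : Submodule.span K (Set.range fun x : L => x ^ p ^ n) ≤ Subalgebra.toSubmodule M'.toSubalgebra := by
      rw [Submodule.span_le]
      rintro _ ⟨y, rfl⟩
      exact ⟨Φ y, hΦ y⟩
    exact this hx
  obtain ⟨hfin, hle'⟩ := finrank_powSpan_le (K := K) (L := L) p n
  have hM' : Module.finrank M' L = Module.finrank M L := by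
    let e' : M ≃+* M' := (AlgEquiv.ofInjectiveField (IsScalarTower.toAlgHom K M L)).toRingEquiv
    exact (Algebra.finrank_eq_of_equiv_equiv e' (RingEquiv.refl L) (by ext x; rfl)).symm
  -- `K · L^q` is contained in `M`, and `L` has degree at most `q = [L : M]` over it, so the two
  -- coincide.
  have heq := IntermediateField.eq_of_le_of_finrank_le' hle (by rw [hM', hn]; exact hle')
  rw [eq_top_iff]
  intro m _
  have hm : algebraMap M L m ∈ powSpan K L (p ^ n) := heq ▸ ⟨m, rfl⟩
  rw [mem_powSpan] at hm
  have h1 : (Set.range fun x : L => x ^ p ^ n) =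
      (IsScalarTower.toAlgHom K M L).toLinearMap '' Set.range Φ := by
    rw [← Set.range_comp]
    exact congrArg Set.range (funext fun x => (hΦ x).symm)
  rw [h1, ← Submodule.map_span] at hm
  obtain ⟨m', hm', hmm⟩ := hm
  rwa [← (algebraMap M L).injective hmm]

end Insep

/-! ### Genera in an arbitrary finite extension -/

section Main

variable {K F L : Type u} [Field K] [Field F] [Field L] [Algebra K F] [Algebra K L]

/-- The family of all the places of a function field. -/
def allPlaces (K F : Type u) [Field K] [Field F] [Algebra K F] :
    {V : ValuationSubring F // V ≠ ⊤ ∧ ∀ c : K, algebraMap K F c ∈ V} → Subalgebra K F := fun V =>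
  { V.1.toSubring with algebraMap_mem' := V.2.2 }

theorem isPlaceFamily_allPlaces : IsPlaceFamily (allPlaces K F) where
  exists_valuationSubring V := ⟨V.1, V.2.1, fun _ => Iff.rfl⟩
  injective V V' h := Subtype.ext (by
    ext f
    exact SetLike.ext_iff.mp h f)
  exists_eq V h1 h2 := ⟨⟨V, h1, h2⟩, fun _ => Iff.rfl⟩

/-- Genera in an extension of function fields. -/
theorem finrank_repartitionQuotient_le [Algebra (RatFunc K) F] [IsScalarTower K (RatFunc K) F]
    [FiniteDimensional (RatFunc K) F] [Algebra.IsSeparable (RatFunc K) F]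
    [Algebra (RatFunc K) L] [IsScalarTower K (RatFunc K) L]
    [FiniteDimensional (RatFunc K) L] [Algebra.IsSeparable (RatFunc K) L]
    [Algebra F L] [IsScalarTower K F L] [FiniteDimensional F L]
    (hK : ∀ x : L, IsIntegral K x → ∃ c, algebraMap K L c = x)
    {ι ι' : Type u} {O : ι → Subalgebra K F} (hO : IsPlaceFamily O)
    {O' : ι' → Subalgebra K L} (hO' : IsPlaceFamily O') :
    Module.finrank K (RepartitionQuotient O) ≤ Module.finrank K (RepartitionQuotient O') ∧
    (¬ IsPurelyInseparable F L → 2 ≤ Module.finrank K (RepartitionQuotient O) →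
      Module.finrank K (RepartitionQuotient O) < Module.finrank K (RepartitionQuotient O')) := by
  let M := separableClosure F L
  have hKM : IsScalarTower K M L :=
    IsScalarTower.of_algebraMap_eq fun c => (IsScalarTower.algebraMap_apply K F L c).trans (by
      rw [IsScalarTower.algebraMap_apply K F M, ← IsScalarTower.algebraMap_apply F M L])
  have : IsPurelyInseparable M L := separableClosure.isPurelyInseparable F L
  obtain ⟨p, hp⟩ := ExpChar.exists K
  obtain ⟨n, Φ, hΦ, hspan⟩ := exists_frobenius (K := K) (L := L) p M
  have ht : Transcendental K (Φ (algebraMap (RatFunc K) L RatFunc.X)) := by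
    rw [← transcendental_algebraMap_iff (algebraMap M L).injective, hΦ]
    exact transcendental_algebraMap_X.pow (pow_pos (expChar_pos K p) n)
  have hσ : ∀ c, Φ (algebraMap K L c) = algebraMap K M (iterateFrobenius K p n c) := by
    intro c
    refine (algebraMap M L).injective ?_
    rw [hΦ, ← IsScalarTower.algebraMap_apply, iterateFrobenius_def, map_pow]
  have h := isChartPair_of_ratFunc (K := K) (L := F)
  have hM := h.intClosure M
  have hL := isChartPair_of_ratFunc (K := K) (L := L)
  have e1 := hO.finrank_eq h
  have e2 := hO'.finrank_eq hL
  -- `M` carries two chart pairs, one extended from `F` and one transported from `L` by Frobenius.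
  -- Both compute the repartition quotient over all places of `M`, which links the two inequalities.
  have e3 := (isPlaceFamily_allPlaces (K := K) (F := M)).finrank_eq hM
  obtain ⟨i1, i2, i3, i4, hle⟩ := exists_ratGenus_le (iterateFrobenius K p n) Φ hσ hspan ht
  have e4 := (isPlaceFamily_allPlaces (K := K) (F := M)).finrank_eq
    (isChartPair_of_ratFunc (K := K) (L := M))
  unfold ratGenus at hle
  have hle' := h.genus_le M
  refine ⟨by omega, fun hins hg => ?_⟩
  have hKM' : ∀ x : M, IsIntegral K x → ∃ c, algebraMap K M c = x := by
    intro x hx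
    obtain ⟨c, hc⟩ := hK _ (hx.map (IsScalarTower.toAlgHom K M L))
    refine ⟨c, (algebraMap M L).injective ?_⟩
    rw [← IsScalarTower.algebraMap_apply, hc]
    rfl
  -- Degree one would mean that the separable closure is `F`, so that `L / F` is purely inseparable.
  have hn : 2 ≤ Module.finrank F M := by
    have h0 : 0 < Module.finrank F M := Module.finrank_pos
    by_contra hlt
    have h1 : Module.finrank F M = 1 := by omega
    exact hins (separableClosure.eq_bot_iff.mp (IntermediateField.finrank_eq_one_iff.mp h1))
  have hlt := h.genus_lt hKM' hn (by omega)
  omega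

end Main
end CurveTower

namespace CurveTower

/-! ### The geometry of a curve -/

section Proper

attribute [local instance] MvPolynomial.gradedAlgebra

theorem isProper_projSpaceStr (K : Type u) [Field K] (n : ℕ) : IsProper (projSpaceStr K n) := by
  let 𝒜 := MvPolynomial.homogeneousSubmodule (Fin (n + 1)) K
  have h1 : Algebra.FiniteType (𝒜 0) (MvPolynomial (Fin (n + 1)) K) :=
    have : IsScalarTower K (𝒜 0) (MvPolynomial (Fin (n + 1)) K) :=
      ⟨fun a b c => Algebra.smul_mul_assoc a (b : MvPolynomial (Fin (n + 1)) K) c⟩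
    Algebra.FiniteType.of_restrictScalars_finiteType K (𝒜 0) _
  have h2 : Function.Bijective (algebraMap K (𝒜 0)) := by
    refine ⟨fun a b h => MvPolynomial.C_injective (Fin (n + 1)) K (congrArg Subtype.val h),
      fun ⟨x, hx⟩ => ?_⟩
    have hx' : x ∈ MvPolynomial.homogeneousSubmodule (Fin (n + 1)) K 0 := hx
    rw [MvPolynomial.homogeneousSubmodule_zero, Submodule.mem_one] at hx'
    obtain ⟨c, hc⟩ := hx'
    exact ⟨c, Subtype.ext hc⟩
  have h3 : IsIso (CommRingCat.ofHom (algebraMap K (𝒜 0))) :=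
    (ConcreteCategory.isIso_iff_bijective _).mpr h2
  have h4 : IsProper (Proj.toSpecZero 𝒜) := inferInstance
  have h5 : IsIso (Spec.map (CommRingCat.ofHom (algebraMap K (𝒜 0)))) := inferInstance
  exact MorphismProperty.comp_mem _ _ _ h4 (inferInstance : IsProper (Spec.map (CommRingCat.ofHom (algebraMap K (𝒜 0)))))

theorem IsProjectiveOver.isProper {K : Type u} [Field K] {X : Scheme.{u}} {f : X ⟶ Spec (.of K)}
    (h : IsProjectiveOver f) : IsProper f := by
  obtain ⟨n, i, hi, rfl⟩ := h
  have := isProper_projSpaceStr K n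
  infer_instance

end Proper

/-! ### Étale coordinates and local rings -/

namespace Curve

variable {K : Type u} [Field K] (C : Curve K)

theorem exists_etale (x : C.X) : ∃ (V : C.X.Opens) (_ : IsAffineOpen V) (hx : x ∈ V)
    (g : MvPolynomial (Fin 1) K →+* Γ(C.X, V)), g.Etale ∧
      ∀ c, C.X.presheaf.germ V x hx (g (MvPolynomial.C c)) = C.scalarsToStalk x c := by
  have := C.smooth
  obtain ⟨U, hU, V, hV, hx, e, hf⟩ :=
    SmoothOfRelativeDimension.exists_isStandardSmoothOfRelativeDimension (n := 1) (f := C.str) x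
  have hUt : U = ⊤ := by
    ext y
    simp only [TopologicalSpace.Opens.coe_top, Set.mem_univ, iff_true]
    exact Subsingleton.elim (C.str x) y ▸ e hx
  subst hUt
  obtain ⟨g, hgC, hg⟩ := hf.exists_etale_mvPolynomial
  let σ : K ≃+* Γ(Spec (.of K), ⊤) := (Scheme.ΓSpecIso (.of K)).symm.commRingCatIsoToRingEquiv
  refine ⟨V, hV, hx, g.comp (MvPolynomial.map σ.toRingHom), ?_, fun c => ?_⟩
  · exact RingHom.Etale.stableUnderComposition _ _ (RingHom.Etale.of_bijective (MvPolynomial.mapEquiv (Fin 1) σ).bijective) hg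
  · rw [RingHom.comp_apply, MvPolynomial.map_C, ← RingHom.comp_apply g, hgC]
    exact ConcreteCategory.congr_hom (C.X.presheaf.germ_res (homOfLE le_top) x hx)
      (C.str.appTop (σ c))

/-- The chart is unramified over `K[X]`, so the maximal ideal at `x` is generated by a generator of
the contracted prime of `K[X]`. -/
theorem isNoetherianRing_stalk_and_isPrincipal (x : C.X) : IsNoetherianRing (C.X.presheaf.stalk x) ∧
    (IsLocalRing.maximalIdeal (C.X.presheaf.stalk x)).IsPrincipal := by
  obtain ⟨V, hV, hx, g, hg, -⟩ := C.exists_etale x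
  algebraize [g]
  let P := MvPolynomial (Fin 1) K
  have : IsNoetherianRing Γ(C.X, V) := Algebra.FiniteType.isNoetherianRing P _
  let q := (hV.primeIdealOf ⟨x, hx⟩).asIdeal
  let : Algebra Γ(C.X, V) (C.X.presheaf.stalk x) := (C.X.presheaf.germ V x hx).hom.toAlgebra
  have : IsLocalization.AtPrime (C.X.presheaf.stalk x) q := hV.isLocalization_stalk ⟨x, hx⟩
  have hP : IsPrincipalIdealRing P :=
    IsPrincipalIdealRing.of_surjective (MvPolynomial.uniqueAlgEquiv K (Fin 1)).symm
      (MvPolynomial.uniqueAlgEquiv K (Fin 1)).symm.surjective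
  let e := (IsLocalization.algEquiv q.primeCompl (Localization.AtPrime q) (C.X.presheaf.stalk x)).toRingEquiv
  have hN : IsNoetherianRing (C.X.presheaf.stalk x) :=
    IsLocalization.isNoetherianRing q.primeCompl _ inferInstance
  refine ⟨hN, ?_⟩
  let p := q.under P
  let := Localization.AtPrime.algebraOfLiesOver p q
  have h := ((Algebra.isUnramifiedAt_iff_map_eq P p q).mp inferInstance).2
  obtain ⟨t, ht⟩ := hP.principal p
  have h2 : IsLocalRing.maximalIdeal (C.X.presheaf.stalk x) =
      (IsLocalRing.maximalIdeal (Localization.AtPrime q)).map e := by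
    exact (IsLocalRing.map_ringEquiv_maximalIdeal e).symm
  refine ⟨e (algebraMap P _ t), ?_⟩
  rw [h2, ← h, ht, ← Ideal.span, Ideal.map_span, Ideal.map_span]
  simp

instance (x : C.X) : IsPrincipalIdealRing (C.X.presheaf.stalk x) :=
  have := (C.isNoetherianRing_stalk_and_isPrincipal x).1
  ((tfae_of_isNoetherianRing_of_isLocalRing_of_isDomain _).out 4 0).mp (C.isNoetherianRing_stalk_and_isPrincipal x).2

instance (x : C.X) : ValuationRing (C.X.presheaf.stalk x) :=
  have := (C.isNoetherianRing_stalk_and_isPrincipal x).1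
  ((tfae_of_isNoetherianRing_of_isLocalRing_of_isDomain _).out 4 1).mp (C.isNoetherianRing_stalk_and_isPrincipal x).2

theorem fromSpecStalk_str (x : C.X) :
    C.X.fromSpecStalk x ≫ C.str = Spec.map (CommRingCat.ofHom (C.scalarsToStalk x)) := by
  have h := Scheme.toSpecΓ_naturality C.str
  rw [← cancel_mono (Spec (.of K)).toSpecΓ, Category.assoc, h, Scheme.fromSpecStalk_toSpecΓ_assoc,
    ← SpecMap_ΓSpecIso_hom]
  rw [← Spec.map_comp, ← Spec.map_comp]
  congr 1
  ext a
  obtain ⟨c, rfl⟩ := (Scheme.ΓSpecIso (.of K)).symm.commRingCatIsoToRingEquiv.surjective a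
  have h1 : (Scheme.ΓSpecIso (.of K)).hom ((Scheme.ΓSpecIso (.of K)).inv c) = c :=
    ConcreteCategory.congr_hom (Scheme.ΓSpecIso (.of K)).inv_hom_id c
  exact congrArg (C.scalarsToStalk x) h1.symm

end Curve
end CurveTower

/-! ### Points of the curve and places of its function field -/

namespace CurveTower
namespace Curve

variable {K : Type u} [Field K] (C : Curve K)

theorem generic_specializes (x : C.X) : C.generic ⤳ x :=
  (genericPoint_spec C.X).specializes trivial

theorem stalkToFunctionField_injective (x : C.X) :
    Function.Injective (C.stalkToFunctionField x) :=
  IsFractionRing.injective (C.X.presheaf.stalk x) C.X.functionField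

/-- The inclusion of the generic point. -/
noncomputable def fromSpecFunctionField : Spec (.of C.FunctionField) ⟶ C.X :=
  C.X.fromSpecStalk C.generic

theorem SpecMap_stalkToFunctionField (x : C.X) :
    Spec.map (CommRingCat.ofHom (C.stalkToFunctionField x)) ≫ C.X.fromSpecStalk x =
      C.fromSpecFunctionField :=
  Scheme.SpecMap_stalkSpecializes_fromSpecStalk (C.generic_specializes x)

/-- If `y` is in the closure of `x`, then `x` is a prime of the local ring at `y`, a principal ideal
domain: the zero ideal is the generic point and a maximal one is `y`. -/
theorem isClosed_of_ne_generic {x : C.X} (hx : x ≠ C.generic) : IsClosed ({x} : Set C.X) := by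
  rw [← closure_subset_iff_isClosed]
  intro y hy
  have hxy : x ⤳ y := specializes_iff_mem_closure.mpr hy
  obtain ⟨p, hp⟩ : x ∈ Set.range (C.X.fromSpecStalk y) := by
    rw [Scheme.range_fromSpecStalk]; exact hxy
  obtain ⟨q, hq⟩ : C.generic ∈ Set.range (C.X.fromSpecStalk y) := by
    rw [Scheme.range_fromSpecStalk]; exact C.generic_specializes y
  by_cases hp0 : p.asIdeal = ⊥
  · refine absurd ?_ hx
    have h1 : p ⤳ q := (PrimeSpectrum.le_iff_specializes p q).mp (by
      change p.asIdeal ≤ q.asIdeal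
      rw [hp0]; exact bot_le)
    have h2 := h1.map (C.X.fromSpecStalk y).continuous
    rw [hp, hq] at h2
    exact (h2.antisymm (C.generic_specializes x)).eq
  · have h1 : p.asIdeal.IsMaximal :=
      have := p.isPrime
      IsPrime.to_maximal_ideal hp0
    have h2 : p = IsLocalRing.closedPoint _ := PrimeSpectrum.ext (IsLocalRing.eq_maximalIdeal h1)
    rw [h2, Scheme.fromSpecStalk_closedPoint] at hp
    exact Set.mem_singleton_iff.mpr hp

theorem isProper : IsProper C.str := C.projective.isProper

section Valuation

variable (V : ValuationSubring C.FunctionField) (hV : ∀ c : K, algebraMap K C.FunctionField c ∈ V)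

/-- The valuative square of a valuation ring of the function field. -/
noncomputable def valuativeCommSq : ValuativeCommSq C.str where
  R := V
  K := C.FunctionField
  i₁ := C.fromSpecFunctionField
  i₂ := Spec.map (CommRingCat.ofHom ((algebraMap K C.FunctionField).codRestrict V hV))
  commSq := ⟨by
    rw [← Spec.map_comp]
    exact C.fromSpecStalk_str C.generic⟩

variable {V}

/-- The lift of the valuative square given by a point whose local ring is contained in `V`. -/
noncomputable def liftStruct {x : C.X} (hx : ∀ f ∈ C.localRing x, f ∈ V) :
    (C.valuativeCommSq V hV).commSq.LiftStruct where
  l := Spec.map (CommRingCat.ofHom ((C.stalkToFunctionField x).codRestrict V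
    fun s => hx _ ⟨s, rfl⟩)) ≫ C.X.fromSpecStalk x
  fac_left := by
    rw [← Category.assoc]
    erw [← Spec.map_comp]
    exact C.SpecMap_stalkToFunctionField x
  fac_right := by
    rw [Category.assoc, C.fromSpecStalk_str]
    erw [← Spec.map_comp]
    refine congrArg Spec.map ?_
    ext c
    exact Subtype.ext (C.stalkToFunctionField_scalars x c)

/-- Both points give lifts of the same valuative square, which coincide by separatedness. The lift
sends the closed point of `Spec V` to `x`, as the local ring at `x` maps isomorphically to `V`. -/
theorem eq_of_localRing_eq {x y : C.X} (hx : ∀ f, f ∈ C.localRing x ↔ f ∈ V)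
    (hy : ∀ f, f ∈ C.localRing y ↔ f ∈ V) : x = y := by
  have hV : ∀ c : K, algebraMap K C.FunctionField c ∈ V := fun c =>
    (hx _).mp ((C.localRing x).algebraMap_mem c)
  have := C.isProper
  have h := IsSeparated.valuativeCriterion C.str (C.valuativeCommSq V hV)
  have key : ∀ {x : C.X} (hx : ∀ f, f ∈ C.localRing x ↔ f ∈ V),
      (C.liftStruct hV fun f hf => (hx f).mp hf).l (IsLocalRing.closedPoint V) = x := by
    intro x hx
    let φ := (C.stalkToFunctionField x).codRestrict V fun s => (hx _).mp ⟨s, rfl⟩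
    have hφ : Function.Bijective φ := by
      refine ⟨fun a b hab => C.stalkToFunctionField_injective x (congrArg Subtype.val hab), ?_⟩
      rintro ⟨f, hf⟩
      obtain ⟨s, hs⟩ := (hx f).mpr hf
      exact ⟨s, Subtype.ext hs⟩
    have hloc : IsLocalHom φ := IsLocalHom.of_surjective φ hφ.2
    have h1 : Spec.map (CommRingCat.ofHom φ) (IsLocalRing.closedPoint V) =
      IsLocalRing.closedPoint (C.X.presheaf.stalk x) := IsLocalRing.comap_closedPoint φ
    exact (congrArg (C.X.fromSpecStalk x) h1).trans Scheme.fromSpecStalk_closedPoint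
  rw [← key hx, ← key hy, Subsingleton.elim (C.liftStruct hV fun f hf => (hx f).mp hf)]

/-- By properness the valuative square has a lift; let `x` be the image of the closed point. Then
`V` dominates the local ring at `x`, which is itself a valuation ring of the same field, so they are
equal. -/
theorem exists_localRing_eq (hV : ∀ c : K, algebraMap K C.FunctionField c ∈ V) :
    ∃ x : C.X, ∀ f, f ∈ C.localRing x ↔ f ∈ V := by
  have := C.isProper
  obtain ⟨l, hl1, hl2⟩ := ((UniversallyClosed.eq_valuativeCriterion ▸
    (inferInstance : UniversallyClosed C.str) :
      (ValuativeCriterion.Existence ⊓ @QuasiCompact) C.str).1 (C.valuativeCommSq V hV)).exists_lift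
  change Spec (.of V) ⟶ C.X at l
  let x := l (IsLocalRing.closedPoint V)
  let φ : C.X.presheaf.stalk x ⟶ .of V := Scheme.stalkClosedPointTo l
  have hφ : Spec.map φ ≫ C.X.fromSpecStalk x = l := Scheme.Spec_stalkClosedPointTo_fromSpecStalk l
  have hcomp : V.subtype.comp φ.hom = C.stalkToFunctionField x := by
    have h1 : Spec.map (φ ≫ CommRingCat.ofHom V.subtype) ≫ C.X.fromSpecStalk x =
        Spec.map (CommRingCat.ofHom (C.stalkToFunctionField x)) ≫ C.X.fromSpecStalk x := by
      rw [C.SpecMap_stalkToFunctionField, Spec.map_comp, Category.assoc, hφ]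
      exact hl1
    have h2 := Spec.map_injective ((cancel_mono _).mp h1)
    exact congrArg CommRingCat.Hom.hom h2
  have hloc : IsLocalHom φ.hom := inferInstanceAs (IsLocalHom (Scheme.stalkClosedPointTo l).hom)
  let : Algebra (C.X.presheaf.stalk x) C.FunctionField := (C.stalkToFunctionField x).toAlgebra
  have : IsFractionRing (C.X.presheaf.stalk x) C.FunctionField :=
    inferInstanceAs (IsFractionRing (C.X.presheaf.stalk x) C.X.functionField)
  have hb := bijective_rangeRestrict_comp_of_valuationRing (K := C.FunctionField) φ.hom V.subtype hcomp
  refine ⟨x, fun f => ⟨?_, fun hf => ?_⟩⟩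
  · rintro ⟨s, rfl⟩
    change C.stalkToFunctionField x s ∈ V
    rw [← hcomp]
    exact (φ.hom s).2
  · obtain ⟨s, hs⟩ := hb.2 ⟨f, ⟨f, hf⟩, rfl⟩
    refine ⟨s, ?_⟩
    change C.stalkToFunctionField x s = f
    rw [← hcomp]
    exact congrArg Subtype.val hs

end Valuation

/-- A nontrivial valuation ring exists as soon as there is a transcendental element. -/
theorem _root_.CurveTower.exists_valuationSubring_ne_top {F : Type*} [Field F] [Algebra K F] {t : F}
    (ht : Transcendental K t) :
    ∃ V : ValuationSubring F, V ≠ ⊤ ∧ ∀ c : K, algebraMap K F c ∈ V := by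
  let A := Algebra.adjoin K {t}
  let t' : A.toSubring := ⟨t, Algebra.self_mem_adjoin_singleton K t⟩
  have hI : Ideal.span {t'} ≠ ⊤ := by
    rw [Ne, Ideal.span_singleton_eq_top]
    intro h
    obtain ⟨s, hs⟩ := h.exists_right_inv
    obtain ⟨p, hp⟩ : (s : F) ∈ (Polynomial.aeval (R := K) t).range :=
      Algebra.adjoin_singleton_eq_range_aeval K t ▸ (show (s : F) ∈ Algebra.adjoin K {t} from s.2)
    have h1 : Polynomial.aeval t (Polynomial.X * p - 1) = 0 := by
      have h2 : t * s = 1 := congrArg Subtype.val hs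
      have h3 : Polynomial.aeval t p = s := hp
      simp [h3, h2]
    have h4 := (transcendental_iff.mp ht) _ h1
    have h5 := congrArg (Polynomial.eval 0) h4
    simp at h5
  obtain ⟨V, hAV, hV⟩ := Ideal.image_subset_nonunits_valuationSubring _ hI
  have htV : t ∈ V.nonunits := hV ⟨t', Ideal.mem_span_singleton_self _, rfl⟩
  refine ⟨V, fun h => ?_, fun c => hAV (A.algebraMap_mem c)⟩
  have ht0 : t ≠ 0 := fun h0 => ht (h0 ▸ isAlgebraic_zero)
  have h1 := (ValuationSubring.mem_nonunits_iff_exists_mem_maximalIdeal.mp htV)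
  obtain ⟨ha, hm⟩ := h1
  refine hm (isUnit_iff_exists_inv.mpr ⟨⟨t⁻¹, h ▸ trivial⟩, Subtype.ext (mul_inv_cancel₀ ht0)⟩)

theorem mem_localRing_generic (f : C.FunctionField) : f ∈ C.localRing C.generic :=
  ⟨f, ConcreteCategory.congr_hom (C.X.presheaf.stalkSpecializes_refl C.generic) f⟩

theorem eq_generic_of_localRing_eq_top {x : C.X} (hx : ∀ f, f ∈ C.localRing x) : x = C.generic := by
  obtain ⟨q, hq⟩ : C.generic ∈ Set.range (C.X.fromSpecStalk x) := by
    rw [Scheme.range_fromSpecStalk]; exact C.generic_specializes x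
  have hb : Function.Bijective (C.stalkToFunctionField x) :=
    ⟨C.stalkToFunctionField_injective x, hx⟩
  have hf : IsField (C.X.presheaf.stalk x) :=
    (RingEquiv.ofBijective _ hb).toMulEquiv.isField (Field.toIsField _)
  have hq' := q.isPrime
  have h2 : q = IsLocalRing.closedPoint _ := PrimeSpectrum.ext
    (le_antisymm (IsLocalRing.le_maximalIdeal hq'.ne_top)
      ((IsLocalRing.isField_iff_maximalIdeal_eq.mp hf).le.trans bot_le))
  rw [← hq, h2, Scheme.fromSpecStalk_closedPoint]

theorem isPlaceFamily {t : C.FunctionField} (ht : Transcendental K t) :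
    IsPlaceFamily fun x : C.ClosedPoint => C.localRing x.1 where
  exists_valuationSubring x := by
    let V : ValuationSubring C.FunctionField :=
      { (C.localRing x.1).toSubring with
        mem_or_inv_mem' := fun f => by
          have : IsFractionRing (C.X.presheaf.stalk x.1) C.X.functionField := inferInstance
          rcases ValuationRing.isInteger_or_isInteger (C.X.presheaf.stalk x.1)
            (K := C.X.functionField) f with h | h
          · exact Or.inl h
          · exact Or.inr h }
    refine ⟨V, fun hV => ?_, fun _ => Iff.rfl⟩
    -- If the local ring of a closed point were the whole field, the generic point would be closed
    -- and hence the only point. But the transcendental `t` provides a nontrivial place, centered at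
    -- some point.
    have hx := C.eq_generic_of_localRing_eq_top (x := x.1) fun f => by
      have : f ∈ V := hV ▸ trivial
      exact this
    obtain ⟨W, hW, hKW⟩ := exists_valuationSubring_ne_top ht
    obtain ⟨y, hy⟩ := C.exists_localRing_eq hKW
    have hyx : y = x.1 := by
      have h1 := C.generic_specializes y
      rw [← hx, specializes_iff_mem_closure, x.2.closure_eq] at h1
      exact h1
    refine hW (eq_top_iff.mpr fun f _ => (hy f).mp ?_)
    rw [hyx, hx]
    exact C.mem_localRing_generic f
  injective x y hxy := by
    let V : ValuationSubring C.FunctionField :=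
      { (C.localRing x.1).toSubring with
        mem_or_inv_mem' := fun f => by
          rcases ValuationRing.isInteger_or_isInteger (C.X.presheaf.stalk x.1)
            (K := C.X.functionField) f with h | h
          · exact Or.inl h
          · exact Or.inr h }
    exact Subtype.ext (C.eq_of_localRing_eq (V := V) (fun _ => Iff.rfl)
      fun f => (SetLike.ext_iff.mp hxy f).symm)
  exists_eq V hV hKV := by
    obtain ⟨x, hx⟩ := C.exists_localRing_eq hKV
    refine ⟨⟨x, C.isClosed_of_ne_generic fun h => hV ?_⟩, fun f => (hx f).symm⟩
    refine eq_top_iff.mpr fun f _ => (hx f).mp ?_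
    rw [h]
    exact C.mem_localRing_generic f

end Curve
end CurveTower

namespace CurveTower
noncomputable section
namespace Curve

variable {K : Type u} [Field K] (C : Curve K)

/-- The function field of a curve is a finite separable extension of a field of rational functions. -/
theorem exists_ratFunc_algebra : ∃ φ : RatFunc K →+* C.FunctionField,
    φ.comp (algebraMap K (RatFunc K)) = algebraMap K C.FunctionField ∧
    letI := φ.toAlgebra
    FiniteDimensional (RatFunc K) C.FunctionField ∧
      Algebra.IsSeparable (RatFunc K) C.FunctionField := by
  obtain ⟨V, hV, hx, g, hg, hgC⟩ := C.exists_etale C.generic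
  have : Nonempty V := ⟨⟨_, hx⟩⟩
  let S := Γ(C.X, V)
  let g' : Polynomial K →+* S := g.comp (MvPolynomial.uniqueAlgEquiv K (Fin 1)).symm.toRingHom
  have hg' : g'.Etale := RingHom.Etale.stableUnderComposition _ _
    (RingHom.Etale.of_bijective (MvPolynomial.uniqueAlgEquiv K (Fin 1)).symm.bijective) hg
  algebraize [g']
  let : Algebra S C.FunctionField := inferInstanceAs (Algebra S C.X.functionField)
  have hS : IsFractionRing S C.FunctionField := functionField_isFractionRing_of_isAffineOpen _ V hV
  let : Algebra (Polynomial K) C.FunctionField :=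
    ((algebraMap S C.FunctionField).comp g').toAlgebra
  have hT : IsScalarTower (Polynomial K) S C.FunctionField := IsScalarTower.of_algebraMap_eq' rfl
  -- An étale algebra is flat, so a nonzero polynomial acts injectively on it and cannot map to
  -- zero.
  have hinj : Function.Injective (algebraMap (Polynomial K) C.FunctionField) := by
    have h1 : Function.Injective (algebraMap S C.FunctionField) := IsFractionRing.injective _ _
    refine h1.comp ?_
    rw [injective_iff_map_eq_zero]
    intro p hp
    by_contra h0
    have hr : IsSMulRegular (Polynomial K) p :=
      IsLeftRegular.isSMulRegular (IsRegular.of_ne_zero h0).left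
    have h2 := IsSMulRegular.of_flat (S := S) hr
    have h3 : (1 : S) = 0 := h2 (by
      change algebraMap (Polynomial K) S p • (1 : S) = algebraMap (Polynomial K) S p • (0 : S)
      rw [show algebraMap (Polynomial K) S p = 0 from hp]; simp)
    exact one_ne_zero h3
  let φ : RatFunc K →+* C.FunctionField := IsFractionRing.lift hinj
  have hφ : ∀ p, φ (algebraMap _ _ p) = algebraMap (Polynomial K) C.FunctionField p :=
    IsFractionRing.lift_algebraMap hinj
  let : Algebra (RatFunc K) C.FunctionField := φ.toAlgebra
  refine ⟨φ, ?_, ?_⟩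
  · ext c
    rw [RingHom.comp_apply, IsScalarTower.algebraMap_apply K (Polynomial K) (RatFunc K), hφ]
    have h1 : g' (algebraMap K (Polynomial K) c) = g (MvPolynomial.C c) := by
      simp [g']
    exact (congrArg (algebraMap S C.FunctionField) h1).trans (hgC c)
  · have : IsScalarTower (Polynomial K) (RatFunc K) C.FunctionField :=
      IsScalarTower.of_algebraMap_eq fun p => (hφ p).symm
    -- Localizing source and target, the function field is formally étale and essentially of finite
    -- type over the field `K(X)`, hence finite separable.
    have e1 : Algebra.FormallyEtale S C.FunctionField :=
      Algebra.FormallyEtale.of_isLocalization (nonZeroDivisors S)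
    have e2 : Algebra.FormallyEtale (Polynomial K) C.FunctionField :=
      Algebra.FormallyEtale.comp _ S _
    have e3 : Algebra.FormallyEtale (RatFunc K) C.FunctionField :=
      Algebra.FormallyEtale.localization_base (nonZeroDivisors (Polynomial K))
    have f1 : Algebra.EssFiniteType S C.FunctionField :=
      Algebra.EssFiniteType.of_isLocalization _ (nonZeroDivisors S)
    have f2 : Algebra.EssFiniteType (Polynomial K) C.FunctionField :=
      Algebra.EssFiniteType.comp _ S _
    have f3 : Algebra.EssFiniteType (RatFunc K) C.FunctionField :=
      Algebra.EssFiniteType.of_comp (Polynomial K) _ _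
    exact ⟨Algebra.FormallyUnramified.finite_of_free _ _,
      Algebra.FormallyUnramified.isSeparable _ _⟩

end Curve
end
end CurveTower

/-! ### The field of constants of a geometrically connected curve -/

namespace CurveTower
open TensorProduct

/-- A domain integral over a field is a field, so multiplication `L ⊗ L → L` is injective, and `[L :
K]² ≤ [L : K]`. -/
theorem finrank_eq_one_of_isDomain_tensorProduct {K L : Type*} [Field K] [Field L] [Algebra K L]
    [FiniteDimensional K L] [IsDomain (L ⊗[K] L)] : Module.finrank K L = 1 := by
  have hf : IsField (L ⊗[K] L) := by
    have := Algebra.IsIntegral.of_finite K (L ⊗[K] L)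
    exact isField_of_isIntegral_of_isField' (Field.toIsField K)
  let := hf.toField
  have hinj : Function.Injective (Algebra.TensorProduct.lmul' K (S := L)).toLinearMap :=
    (Algebra.TensorProduct.lmul' K (S := L)).toRingHom.injective
  have h := LinearMap.finrank_le_finrank_of_injective hinj
  rw [Module.finrank_tensorProduct] at h
  have h0 : 0 < Module.finrank K L := Module.finrank_pos
  nlinarith

namespace Curve
open Limits

variable {K : Type u} [Field K] (C : Curve K)

/-- The base change of the curve to `L` is again smooth and connected, hence integral, and the
spectrum of this tensor product is an open subscheme of it. -/
theorem isDomain_tensorProduct {V : C.X.Opens} (hV : IsAffineOpen V) [Nonempty V]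
    [Algebra K Γ(C.X, V)]
    (hVK : hV.fromSpec ≫ C.str = Spec.map (CommRingCat.ofHom (algebraMap K Γ(C.X, V))))
    (L : Type u) [Field L] [Algebra K L] : IsDomain (Γ(C.X, V) ⊗[K] L) := by
  let g := Spec.map (CommRingCat.ofHom (algebraMap K L))
  have := C.smooth
  have := C.geometricallyConnected
  have : SmoothOfRelativeDimension 1 (pullback.snd C.str g) :=
    (smoothOfRelativeDimension_isStableUnderBaseChange 1).of_isPullback
      (IsPullback.of_hasPullback C.str g) C.smooth
  have : ConnectedSpace ↥(pullback C.str g) :=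
    GeometricallyConnected.connectedSpace_of_subsingleton (pullback.snd C.str g)
  have : IsIntegral (pullback C.str g) := isIntegral_of_smooth (pullback.snd C.str g)
  let e := pullbackSpecIso K Γ(C.X, V) L
  let j : Spec (.of (Γ(C.X, V) ⊗[K] L)) ⟶ pullback C.str g :=
    e.inv ≫ (pullback.congrHom hVK.symm rfl).hom ≫
      (pullbackRightPullbackFstIso C.str g hV.fromSpec).inv ≫ pullback.snd _ _
  have : IsOpenImmersion j := inferInstance
  have : Nontrivial Γ(C.X, V) := inferInstance
  have := isIntegral_of_isOpenImmersion j
  exact (affine_isIntegral_iff _).mp this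

/-- The element `a` is a section over some affine open `V`, so `L = K[a]` embeds in the ring `S` of
sections there. By flatness `L ⊗ L` embeds in `S ⊗ L`, a domain, and this forces `L = K`. -/
theorem exists_algebraMap_eq_of_isIntegral {a : C.FunctionField} (ha : IsIntegral K a) :
    ∃ c, algebraMap K C.FunctionField c = a := by
  obtain ⟨U, hxU, s', hs'⟩ := C.X.presheaf.exists_germ_eq (x := C.generic) a
  obtain ⟨_, ⟨V, hV, rfl⟩, hxV, hVU⟩ :=
    C.X.isBasis_affineOpens.exists_subset_of_mem_open hxU U.2
  have : Nonempty V := ⟨⟨_, hxV⟩⟩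
  let S := Γ(C.X, V)
  let γ : S →+* C.FunctionField := (C.X.presheaf.germ V C.generic hxV).hom
  have hγ : Function.Injective γ := germ_injective_of_isIntegral C.X C.generic hxV
  obtain ⟨s, hs⟩ : ∃ s : S, γ s = a := ⟨C.X.presheaf.map (homOfLE hVU).op s',
    (C.X.presheaf.germ_res_apply (homOfLE hVU) _ hxV s').trans hs'⟩
  let ψ : CommRingCat.of K ⟶ S := Spec.preimage (hV.fromSpec ≫ C.str)
  have hψ : Spec.map ψ = hV.fromSpec ≫ C.str := Spec.map_preimage _
  let : Algebra K S := ψ.hom.toAlgebra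
  have hγK : ∀ c, γ (algebraMap K S c) = algebraMap K C.FunctionField c := by
    have h1 : Spec.map (ψ ≫ C.X.presheaf.germ V C.generic hxV) =
        Spec.map (CommRingCat.ofHom (C.scalarsToStalk C.generic)) := by
      rw [Spec.map_comp, hψ, ← C.fromSpecStalk_str, ← hV.fromSpecStalk_eq_fromSpecStalk hxV,
        ← Category.assoc]
      rfl
    exact fun c => ConcreteCategory.congr_hom (Spec.map_injective h1) c
  let f := minpoly K a
  have : Fact (Irreducible f) := ⟨minpoly.irreducible ha⟩
  let L := AdjoinRoot f
  have : FiniteDimensional K L := (AdjoinRoot.powerBasis (minpoly.ne_zero ha)).finite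
  let γ' : S →ₐ[K] C.FunctionField := { γ with commutes' := hγK }
  have hroot : Polynomial.aeval s f = 0 := by
    refine hγ ?_
    have h1 : γ' (Polynomial.aeval s f) = Polynomial.aeval (γ' s) f :=
      (Polynomial.aeval_algHom_apply γ' s f).symm
    have h2 : γ' s = a := hs
    rw [h2, minpoly.aeval] at h1
    exact h1.trans (map_zero γ).symm
  let ι : L →ₐ[K] S := AdjoinRoot.liftAlgHom f (Algebra.ofId K S) s hroot
  have hι : Function.Injective ι := ι.toRingHom.injective
  have hdom : IsDomain (S ⊗[K] L) := C.isDomain_tensorProduct hV hψ.symm L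
  have hinj : Function.Injective (Algebra.TensorProduct.map ι (AlgHom.id K L)) :=
    Module.Flat.rTensor_preserves_injective_linearMap (M := L) ι.toLinearMap hι
  have hLL : IsDomain (L ⊗[K] L) := hinj.isDomain (Algebra.TensorProduct.map ι (AlgHom.id K L)).toRingHom
  have h1 := finrank_eq_one_of_isDomain_tensorProduct (K := K) (L := L)
  obtain ⟨c, hc⟩ := (finrank_eq_one_iff_of_nonzero' (1 : L) one_ne_zero).mp h1 (AdjoinRoot.root f)
  refine ⟨c, ?_⟩
  rw [← hγK, ← hs]
  congr 1
  have h2 := congrArg ι hc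
  rw [← Algebra.algebraMap_eq_smul_one, AlgHom.commutes] at h2
  rw [h2]
  exact AdjoinRoot.liftAlgHom_root _ _ _ _

end Curve
end CurveTower

/-! ### Morphisms of curves and extensions of function fields -/

namespace CurveTower

theorem isPurelyInseparable_of_equiv_equiv {A₁ B₁ A₂ B₂ : Type*} [Field A₁] [Field B₁] [Field A₂]
    [Field B₂] [Algebra A₁ B₁] [Algebra A₂ B₂] (i : A₁ ≃+* A₂) (j : B₁ ≃+* B₂)
    (h : ∀ a, algebraMap A₂ B₂ (i a) = j (algebraMap A₁ B₁ a)) [IsPurelyInseparable A₁ B₁] :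
    IsPurelyInseparable A₂ B₂ := by
  obtain ⟨q, hq⟩ := ExpChar.exists A₁
  have : ExpChar A₂ q := expChar_of_injective_ringHom (f := (i : A₁ →+* A₂)) i.injective q
  rw [isPurelyInseparable_iff_pow_mem A₂ q]
  intro x
  obtain ⟨n, a, ha⟩ := IsPurelyInseparable.pow_mem A₁ q (j.symm x)
  exact ⟨n, i a, by rw [h, ha, map_pow, j.apply_symm_apply]⟩

section Morphisms

variable {K : Type u} [Field K] {C D : Curve K} (f : C.X ⟶ D.X)

/-- Otherwise the image of the generic point is closed, and all its specializations, that is all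
points, go to it. -/
theorem map_generic (hf : ¬ IsConstant f) : f C.generic = D.generic := by
  by_contra h
  have h1 := D.isClosed_of_ne_generic h
  refine hf ⟨f C.generic, fun x => ?_⟩
  have h2 := (C.generic_specializes x).map f.continuous
  rwa [specializes_iff_mem_closure, h1.closure_eq] at h2

variable (h : f C.generic = D.generic)

/-- The extension of function fields given by a morphism mapping the generic point to the generic
point. -/
noncomputable def functionFieldMap : D.FunctionField →+* C.FunctionField :=
  (f.stalkMap C.generic).hom.comp (D.X.presheaf.stalkCongr (.of_eq h.symm)).hom.hom

theorem functionFieldMap_algebraMap (hf : f ≫ D.str = C.str) (c : K) :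
    functionFieldMap f h (algebraMap K D.FunctionField c) = algebraMap K C.FunctionField c := by
  have h1 : D.X.presheaf.germ ⊤ D.generic trivial ≫
      (D.X.presheaf.stalkCongr (.of_eq h.symm)).hom ≫ f.stalkMap C.generic =
      f.appTop ≫ C.X.presheaf.germ ⊤ C.generic trivial := by
    rw [← Category.assoc]
    exact (congrArg (· ≫ f.stalkMap C.generic) (D.X.presheaf.germ_stalkSpecializes (U := ⊤)
      trivial (specializes_of_eq h))).trans (f.germ_stalkMap ⊤ C.generic trivial)
  have h2 : D.str.appTop ≫ f.appTop = C.str.appTop := by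
    rw [← hf]; rfl
  have h3 := ConcreteCategory.congr_hom h1 (D.str.appTop ((Scheme.ΓSpecIso (.of K)).inv c))
  refine h3.trans ?_
  exact congrArg (C.X.presheaf.germ ⊤ C.generic trivial)
    (ConcreteCategory.congr_hom h2 ((Scheme.ΓSpecIso (.of K)).inv c))

/-- Local rings at generic points are fields, so they agree with their residue fields. This
transfers `degree` and `IsPurelyInsep` to the extension of function fields. -/
theorem exists_residueField_equiv : ∃ (i : D.FunctionField ≃+* D.X.residueField (f C.generic))
    (j : C.FunctionField ≃+* C.X.residueField C.generic),
    ∀ a, (f.residueFieldMap C.generic).hom (i a) = j (functionFieldMap f h a) := by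
  let i : D.FunctionField →+* D.X.residueField (f C.generic) :=
    (D.X.residue (f C.generic)).hom.comp (D.X.presheaf.stalkCongr (.of_eq h.symm)).hom.hom
  let j : C.FunctionField →+* C.X.residueField C.generic := (C.X.residue C.generic).hom
  have hi : Function.Surjective i := IsLocalRing.residue_surjective.comp
    (D.X.presheaf.stalkCongr (.of_eq h.symm)).commRingCatIsoToRingEquiv.surjective
  have hj : Function.Surjective j := IsLocalRing.residue_surjective
  refine ⟨RingEquiv.ofBijective i ⟨i.injective, hi⟩, RingEquiv.ofBijective j ⟨j.injective, hj⟩,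
    fun a => ?_⟩
  exact ConcreteCategory.congr_hom (Scheme.residue_residueFieldMap f C.generic)
    ((D.X.presheaf.stalkCongr (.of_eq h.symm)).hom a)

/-- The genus in a nonconstant morphism of curves. -/
theorem genus_le_genus (hf : f ≫ D.str = C.str) (hc : ¬ IsConstant f) (hdeg : 1 < degree f) :
    D.genus ≤ C.genus ∧ (¬ IsPurelyInsep f → 1 < D.genus → D.genus < C.genus) := by
  have h := map_generic f hc
  let : Algebra D.FunctionField C.FunctionField := (functionFieldMap f h).toAlgebra
  have : IsScalarTower K D.FunctionField C.FunctionField :=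
    IsScalarTower.of_algebraMap_eq fun c => (functionFieldMap_algebraMap f h hf c).symm
  obtain ⟨i, j, hij⟩ := exists_residueField_equiv f h
  have hd : Module.finrank D.FunctionField C.FunctionField = degree f := by
    let := (f.residueFieldMap C.generic).hom.toAlgebra
    exact Algebra.finrank_eq_of_equiv_equiv i j (RingHom.ext hij)
  have hins : IsPurelyInseparable D.FunctionField C.FunctionField → IsPurelyInsep f := by
    intro _
    let := (f.residueFieldMap C.generic).hom.toAlgebra
    exact isPurelyInseparable_of_equiv_equiv i j hij
  -- The degree of an infinite extension is zero by convention, so a degree above one includes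
  -- finiteness.
  have : FiniteDimensional D.FunctionField C.FunctionField :=
    Module.finite_of_finrank_pos (by omega)
  obtain ⟨φ, hφ, hφ'⟩ := D.exists_ratFunc_algebra
  obtain ⟨ψ, hψ, hψ'⟩ := C.exists_ratFunc_algebra
  let := φ.toAlgebra
  let := ψ.toAlgebra
  have : IsScalarTower K (RatFunc K) D.FunctionField := IsScalarTower.of_algebraMap_eq' hφ.symm
  have : IsScalarTower K (RatFunc K) C.FunctionField := IsScalarTower.of_algebraMap_eq' hψ.symm
  obtain ⟨_, _⟩ := hφ'
  obtain ⟨_, _⟩ := hψ'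
  have key := finrank_repartitionQuotient_le (K := K)
    (fun x hx => C.exists_algebraMap_eq_of_isIntegral hx)
    (D.isPlaceFamily transcendental_algebraMap_X) (C.isPlaceFamily transcendental_algebraMap_X)
  exact ⟨key.1, fun h1 => key.2 fun h2 => h1 (hins h2)⟩

end Morphisms

/-! ### Genera along a tower -/

namespace Tower

variable {K : Type u} [Field K] (T : Tower K)

theorem genus_le_genus (n : ℕ) : (T.curve n).genus ≤ (T.curve (n + 1)).genus :=
  (CurveTower.genus_le_genus (T.map n) (T.map_str n) (T.not_isConstant n) (T.one_lt_degree n)).1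

theorem genus_lt_genus (n : ℕ) (hn : ¬ IsPurelyInsep (T.map n)) (h : 1 < (T.curve n).genus) :
    (T.curve n).genus < (T.curve (n + 1)).genus :=
  (CurveTower.genus_le_genus (T.map n) (T.map_str n) (T.not_isConstant n) (T.one_lt_degree n)).2 hn h

theorem monotone_genus : Monotone fun n => (T.curve n).genus :=
  monotone_nat_of_le_succ T.genus_le_genus

theorem tendsto_iSup_genus : Filter.Tendsto (fun n => ((T.curve n).genus : ℕ∞)) Filter.atTop
    (nhds (⨆ n, ((T.curve n).genus : ℕ∞))) :=
  tendsto_atTop_iSup fun _ _ h => Nat.cast_le.mpr (T.monotone_genus h)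

theorem genus_eq_iSup : T.genus = ⨆ n, ((T.curve n).genus : ℕ∞) :=
  T.tendsto_iSup_genus.limsup_eq

end Tower
end CurveTower

theorem mainTheorem12 {K : Type u} [Field K] (T : CurveTower.Tower K) :
    -- the genera are nondecreasing, and the genus of the tower is their limit
    (∀ n, (T.curve n).genus ≤ (T.curve (n + 1)).genus) ∧
    Filter.Tendsto (fun n => ((T.curve n).genus : ℕ∞)) Filter.atTop (nhds T.genus) ∧
    -- if no map of the tower is purely inseparable
    ((∀ n, ¬ CurveTower.IsPurelyInsep (T.map n)) →
      (∀ n, 1 < (T.curve n).genus →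
        ∀ m, n ≤ m → (T.curve m).genus < (T.curve (m + 1)).genus) ∧
      (T.genus = 0 ∨ T.genus = 1 ∨ T.genus = ⊤)) := by
  refine ⟨T.genus_le_genus, T.genus_eq_iSup ▸ T.tendsto_iSup_genus, fun hins => ?_⟩
  have hlt : ∀ n, 1 < (T.curve n).genus →
      ∀ m, n ≤ m → (T.curve m).genus < (T.curve (m + 1)).genus := fun n hn m hm =>
    T.genus_lt_genus m (hins m) (hn.trans_le (T.monotone_genus hm))
  refine ⟨hlt, ?_⟩
  rw [T.genus_eq_iSup]
  by_cases h : ∃ n, 1 < (T.curve n).genus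
  · obtain ⟨n, hn⟩ := h
    -- Past level `n` the genus strictly increases at every step, so it is unbounded.
    have hk : ∀ k, k ≤ (T.curve (n + k)).genus := fun k => by
      induction k with
      | zero => exact Nat.zero_le _
      | succ k ih => exact ih.trans_lt (hlt n hn (n + k) (Nat.le_add_right n k))
    refine Or.inr (Or.inr (ENat.eq_top_iff_forall_ge.mpr fun k => ?_))
    exact (Nat.cast_le.mpr (hk k)).trans (le_iSup (fun n => ((T.curve n).genus : ℕ∞)) (n + k))
  · push Not at h
    have hle : ⨆ n, ((T.curve n).genus : ℕ∞) ≤ 1 := iSup_le fun n => by exact_mod_cast h n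
    rcases eq_or_ne (⨆ n, ((T.curve n).genus : ℕ∞)) 0 with h0 | h0
    · exact Or.inl h0
    · exact Or.inr (Or.inl (le_antisymm hle (Order.one_le_iff_pos.mpr (pos_iff_ne_zero.mpr h0))))
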